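/- **Setting.** Let $\Lambda=(\mathbb Z/L)^D$ be the periodic lattice with the $\infty$-norm distance and balls $B_r(k)$, with a qubit on each of its links. Let $\mathcal C$ be a stabilizer code with one Pauli stabilizer generator $g_r$ at each site, supported in $B_r(\Delta)$. A logical state is a density matrix $\rho_{\log}$ with $g_r\rho_{\log}=\rho_{\log}g_r=\rho_{\log}$ for all $r$; write $\Pi_{\mathbf 1}=\prod_r(1+g_r)/2$, and call a state $\rho$ anyon-free if $\mathrm{Tr}[\rho\,\Pi_{\mathbf 1}]=1$. *Synchronous decoder.* A local synchronous automaton decoder $\mathcal D$ keeps at each site a control variable $m_r$ in a finite alphabet and the syndrome $\sigma_r=\pm1$. It first measures all $g_r$. Each time step then consists of $v\ge 1$ simultaneous updates $m\mapsto\mathcal A(m,\sigma)$ followed by the feedback $\prod_r\mathcal F_r(m,\sigma)$, controlled by the updated $m$; $\sigma$ is multiplied by the syndrome of the feedback. The new value of $m_r$, and $\mathcal F_r$, depend only on $m,\sigma$ in $B_r(\Delta)$; the $\mathcal F_r(m,\sigma)$ are mutually commuting unitaries supported in $B_r(\Delta)$, each commuting or anticommuting with every $g_{r'}$. Let $\mathcal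 D^t(\rho)_{\rm qu}$ be the quantum state after $t$ steps. *Desynchronization.* Put $R=2\Delta$ and fix $\mu>0$. The marching-soldiers desynchronization $\mathcal D_{\sf asynch}$ has the control variables $m_r^{\sf old},m_r^{\sf new}$, $\sigma_r^{\sf old},\sigma_r^{\sf new},\sigma_r^{\sf future}\in\{\pm1\}$, $\mathsf{lag}_{r\to r'}\in\{-1,0,1\}$ for $0<|r-r'|\le 2R$, and $u_r\in\mathbb Z/v$. Initially $m^{\sf old},m^{\sf new}$ equal the initial control variables of $\mathcal D$, all $\sigma$'s are $1$, and $\mathsf{lag}=u=0$. A proposed update at $r$ measures the stabilizers in $B_r(2R)$ and sets $\sigma_{r'}^{\sf new}:=\sigma_{r'}\sigma_{r'}^{\sf future}$ for $r'\in B_r(R)$, where $\sigma_{r'}$ are the measured values. It is accepted iff $\mathsf{lag}_{r\to r'}\le0$ for all $r'\ne r$ in $B_r(2R)$. If so, let $m^{\sf present},\sigma^{\sf present}$ be the $\sf old$ values at sites with $\mathsf{lag}_{r\to r'}=-1$ and the $\sf new$ values elsewhere. If $u_r=v-1$ the feedback $F=\mathcal F_r(\mathcal A(m^{\sf present},\sigma^{\sf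 present}),\sigma^{\sf present})$ is applied (otherwise $F=1$). Simultaneously $m_r^{\sf old}:=m_r^{\sf new}$; $m_r^{\sf new}:=\mathcal A(m^{\sf present},\sigma^{\sf present})[m_r]$; $\sigma_r^{\sf old}:=\sigma_r^{\sf new}$; $\sigma_r^{\sf future}:=1$ if $u_r=v-1$; $\sigma^{\sf future}_{r'}$ is multiplied by the syndrome of $F$ at $r'$ for each $r'\neq r$ in $B_r(R)$ with $\mathsf{lag}_{r\to r'}=0$; and, for $r'\neq r$ in $B_r(2R)$, $\mathsf{lag}_{r\to r'}$ increases and $\mathsf{lag}_{r'\to r}$ decreases by $1$; $u_r:=u_r+1$. The jump operators $L_i$ are the Kraus operators of these updates divided by $\sqrt\mu$, and $\mathcal D_{\sf asynch}^t(\rho)_{\rm qu}$ is the quantum marginal of $e^{t\mathcal L}$ applied to $\rho$ with the initial control registers, for the Lindbladian $\mathcal L(X)=\sum_i(L_iXL_i^\dagger-\frac12\{L_i^\dagger L_i,X\})$. In the unraveling into trajectories, each site proposes updates at the points of an independent Poisson process of rate $1/\mu$. *Figures of merit.* Let $\mathcal E(\rho)=\sum_s p(s)P_s\rho P_s^\dagger$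 be a stochastic Pauli noise channel. The logical failure rates are $$p_{\log}^{(\mathcal E)}=\tfrac12\sup_{\rho_{\log}}\lim_{t\to\infty}\|\mathcal D^t(\mathcal E(\rho_{\log}))_{\rm qu}-\rho_{\log}\|_1,\qquad p_{\log}^{\mathsf a,(\mathcal E)}=\tfrac12\sup_{\rho_{\log}}\lim_{t\to\infty}\|\mathcal D_{\sf asynch}^t(\mathcal E(\rho_{\log}))_{\rm qu}-\rho_{\log}\|_1 .$$ Let $T_{\rm dec}(\rho)\in[0,\infty]$ be the first $t$ at which $\mathcal D^t(\rho)_{\rm qu}$ is anyon-free, and $T_{\rm dec}^{(\mathcal E)}=\mathbb E\,T_{\rm dec}(\rho)$ for $\rho=P_s\rho_{\log}P_s^\dagger$ with $s\sim p$. Let $T^{\mathsf a}_{\rm dec}(\rho)$ be the random time from which on the trajectory of $\mathcal D_{\sf asynch}$ started from $\rho$ is anyon-free, and $T_{\rm dec}^{\mathsf a,(\mathcal E)}$ its expectation over $s\sim p$ and the proposed update times. **Theorem.** Fix $D,\Delta,v,\mu$. There are $C>0$ and, for each $f>0$, constants $c_f,K_f>0$, depending on nothing else, such that the following holds for all $L\ge1$,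 $\mathcal C$, $\mathcal D$, $\mathcal E$ as above. Suppose that for every logical $\rho_{\log}$ and every $s$ with $p(s)>0$, $\mathcal D$ terminates on $P_s\rho_{\log}P_s^\dagger$: it applies no nontrivial feedback after some finite time, and none after a time at which the state is anyon-free. Then: 1. All the limits above exist, and $p_{\log}^{\mathsf a,(\mathcal E)}=p_{\log}^{(\mathcal E)}$. 2. For every logical $\rho_{\log}$, $T_{\rm dec}^{\mathsf a,(\mathcal E)}\le C\,(T_{\rm dec}^{(\mathcal E)}+\log L)$. 3. For every logical $\rho_{\log}$ and $f>0$, if $T_{\rm dec}^{(\mathcal E)}\ge f\log L$ then $c_f\,T_{\rm dec}^{(\mathcal E)}\le T_{\rm dec}^{\mathsf a,(\mathcal E)}\le K_f\,T_{\rm dec}^{(\mathcal E)}$. -/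

import Mathlib

open MeasureTheory ProbabilityTheory Filter Topology
open scoped ENNReal Kronecker Matrix ComplexOrder

noncomputable section

namespace AutomatonDecoder

/-! ## The lattice -/

/-- Sites of the `D`-dimensional periodic lattice of linear size `L`. -/
abbrev Site (D L : ℕ) : Type := Fin D → ZMod L

/-- Links of the lattice: `(r, a)` is the link joining `r` and `r + e_a`. -/
abbrev Link (D L : ℕ) : Type := Site D L × Fin D

variable {D L : ℕ}

/-- Distance on the torus for the `∞`-norm. -/
def torusDist (r r' : Site D L) : ℕ :=
  Finset.univ.sup fun a => (r' a - r a).valMinAbs.natAbs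

/-- The ball `B_r(k)`. -/
def ball (r : Site D L) (k : ℕ) : Set (Site D L) := {r' | torusDist r r' ≤ k}

/-- The links both of whose endpoints lie in a given set of sites. -/
def linksIn (B : Set (Site D L)) : Set (Link D L) :=
  {l | l.1 ∈ B ∧ l.1 + Pi.single l.2 1 ∈ B}

theorem torusDist_le_iff (r r' : Site D L) (k : ℕ) :
    torusDist r r' ≤ k ↔ ∀ a, (r' a - r a).valMinAbs.natAbs ≤ k := by
  simp [torusDist]

theorem mem_ball_self (r : Site D L) (k : ℕ) : r ∈ ball r k := by
  simp [ball, torusDist]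

theorem mem_ball_add {r r' r'' : Site D L} {j k : ℕ} (h : r' ∈ ball r j) (h' : r'' ∈ ball r' k) :
    r'' ∈ ball r (j + k) := by
  simp only [ball, Set.mem_ofPred_eq, torusDist_le_iff] at *
  intro a
  have e : r'' a - r a = (r'' a - r' a) + (r' a - r a) := by ring
  have h2 := ZMod.natAbs_valMinAbs_add_le (r'' a - r' a) (r' a - r a)
  have h3 := Int.natAbs_add_le (r'' a - r' a).valMinAbs (r' a - r a).valMinAbs
  have h4 := h a
  have h5 := h' a
  rw [e]
  omega

theorem torusDist_zero_sub (r r' : Site D L) : torusDist 0 (r - r') = torusDist r r' := by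
  unfold torusDist
  congr 1
  funext a
  rw [← ZMod.natAbs_valMinAbs_neg]
  congr 2
  simp

theorem ball_mono (r : Site D L) {j k : ℕ} (h : j ≤ k) : ball r j ⊆ ball r k :=
  fun _ hx => le_trans hx h

/-! ## Qubits on the links, Pauli operators, stabilizer codes -/

/-- Labels of the computational basis of the qubits on the links. -/
abbrev QBasis (D L : ℕ) : Type := Link D L → ZMod 2

/-- Operators on the Hilbert space of the qubits. -/
abbrev QMat (D L : ℕ) : Type := Matrix (QBasis D L) (QBasis D L) ℂ

/-- Labels of Pauli strings. -/
abbrev PauliLabel (D L : ℕ) : Type := (Link D L → ZMod 2) × (Link D L → ZMod 2)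

/-- `O` acts only on the qubits in `S`, i.e. `O = O' ⊗ 1` with `O'` an operator on those qubits. -/
def SupportedOn (S : Set (Link D L)) (O : QMat D L) : Prop :=
  (∀ a b, (∃ l, l ∉ S ∧ a l ≠ b l) → O a b = 0) ∧
  ∀ a b a' b', (∀ l ∈ S, a l = a' l ∧ b l = b' l) → (∀ l, l ∉ S → a l = b l ∧ a' l = b' l) →
    O a b = O a' b'

theorem SupportedOn.mono {S T : Set (Link D L)} {O : QMat D L} (h : SupportedOn S O)
    (hST : S ⊆ T) : SupportedOn T O := by
  refine ⟨fun a b ⟨l, hl, hab⟩ => h.1 a b ⟨l, fun h' => hl (hST h'), hab⟩, ?_⟩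
  intro a b a' b' h1 h2
  by_cases hs : ∃ l, l ∉ S ∧ a l ≠ b l
  · have hs' : ∃ l, l ∉ S ∧ a' l ≠ b' l := by
      obtain ⟨l, hl, hab⟩ := hs
      refine ⟨l, hl, ?_⟩
      by_cases hT : l ∈ T
      · rw [← (h1 l hT).1, ← (h1 l hT).2]; exact hab
      · exact absurd (h2 l hT).1 hab
    rw [h.1 a b hs, h.1 a' b' hs']
  · push Not at hs
    refine h.2 a b a' b' (fun l hl => h1 l (hST hl)) fun l hl => ⟨hs l hl, ?_⟩
    by_cases hT : l ∈ T
    · rw [← (h1 l hT).1, ← (h1 l hT).2]; exact hs l hl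
    · exact (h2 l hT).2

variable [NeZero L]

theorem supportedOn_one (S : Set (Link D L)) : SupportedOn S (1 : QMat D L) := by
  refine ⟨fun a b ⟨l, _, hab⟩ => Matrix.one_apply_ne fun h => hab (congrFun h l), ?_⟩
  intro a b a' b' h1 h2
  have : a = b ↔ a' = b' := by
    constructor <;> intro h <;> funext l <;> by_cases hl : l ∈ S
    · rw [← (h1 l hl).1, ← (h1 l hl).2, h]
    · exact (h2 l hl).2
    · rw [(h1 l hl).1, (h1 l hl).2, h]
    · exact (h2 l hl).1
  simp [Matrix.one_apply, this]

/-- The Pauli string `⊗_l X^{s.1 l} Z^{s.2 l}`. -/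
def pauli (s : PauliLabel D L) : QMat D L :=
  fun a b => if a = b + s.1 then (-1 : ℂ) ^ (∑ l, s.2 l * b l).val else 0

/-- A geometrically local stabilizer code with one stabilizer generator at every site. -/
structure StabilizerCode (D L : ℕ) [NeZero L] (Δ : ℕ) where
  g : Site D L → QMat D L
  isPauli : ∀ r, ∃ (s : PauliLabel D L) (c : ℂ), g r = c • pauli s
  hermitian : ∀ r, (g r).IsHermitian
  sq : ∀ r, g r * g r = 1
  comm : ∀ r r', Commute (g r) (g r')
  codespace : ∃ ψ : QBasis D L → ℂ, ψ ≠ 0 ∧ ∀ r, g r *ᵥ ψ = ψ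
  isLocal : ∀ r, SupportedOn (linksIn (ball r Δ)) (g r)

variable {Δ : ℕ}

namespace StabilizerCode

variable (𝒞 : StabilizerCode D L Δ)

/-- `(1 + s g_r)/2`, the projector onto the eigenspace `g_r = s`. -/
def proj (r : Site D L) (s : ℤˣ) : QMat D L := (2⁻¹ : ℂ) • (1 + ((s : ℤ) : ℂ) • 𝒞.g r)

theorem commute_proj (r r' : Site D L) (s s' : ℤˣ) : Commute (𝒞.proj r s) (𝒞.proj r' s') := by
  unfold proj
  refine Commute.smul_left (Commute.smul_right ?_ _) _
  refine Commute.add_left (Commute.one_left _) (Commute.add_right (Commute.one_right _) ?_)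
  exact Commute.smul_left (Commute.smul_right (𝒞.comm r r') _) _

/-- `Π_{σ|B} = ∏_{r ∈ B} (1 + σ_r g_r)/2`. -/
def projOn (B : Finset (Site D L)) (σ : Site D L → ℤˣ) : QMat D L :=
  B.noncommProd (fun r => 𝒞.proj r (σ r)) fun _ _ _ _ _ => 𝒞.commute_proj _ _ _ _

/-- `O` commutes or anticommutes with each stabilizer generator. -/
def HasSyndrome (O : QMat D L) : Prop :=
  ∀ r, 𝒞.g r * O = O * 𝒞.g r ∨ 𝒞.g r * O = -(O * 𝒞.g r)

open Classical in
/-- The syndrome of an operator: `1` where it commutes with the generator, and `-1` elsewhere. -/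
def syndrome (O : QMat D L) (r : Site D L) : ℤˣ := if 𝒞.g r * O = O * 𝒞.g r then 1 else -1

/-- Logical states: density matrices with `g_r ρ = ρ g_r = ρ` for all `r`. -/
def IsLogical (ρ : QMat D L) : Prop :=
  ρ.PosSemidef ∧ ρ.trace = 1 ∧ ∀ r, 𝒞.g r * ρ = ρ ∧ ρ * 𝒞.g r = ρ

/-- The quantum state `ρ` has no anyons: `Tr[ρ Π_1] = 1`. -/
def AnyonFree (ρ : QMat D L) : Prop := (ρ * 𝒞.projOn Finset.univ 1).trace = 1

end StabilizerCode

/-- The trace norm `Tr √(A† A)`: the sum of the singular values. -/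
def traceNorm {n : Type*} [Fintype n] [DecidableEq n] (A : Matrix n n ℂ) : ℝ :=
  ∑ i, √((Matrix.isHermitian_conjTranspose_mul_self A).eigenvalues i)

/-- The state `P_s ρ P_s†`. -/
def noisy (s : PauliLabel D L) (ρ : QMat D L) : QMat D L := pauli s * ρ * (pauli s)ᴴ

/-- The stochastic Pauli noise channel `ρ ↦ ∑_s p(s) P_s ρ P_s†`. -/
def noiseChannel (p : PMF (PauliLabel D L)) (ρ : QMat D L) : QMat D L :=
  ∑ s, ((p s).toReal : ℂ) • noisy s ρ

/-! ## States of the quantum system together with the classical control -/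

/-- Configurations of the classical registers: control variables `m`, stored syndromes `σ`. -/
abbrev Cl (D L : ℕ) (N : Type*) : Type _ := (Site D L → N) × (Site D L → ℤˣ)

/-- Operators on `H_qu ⊗ H_cl`. -/
abbrev State (D L : ℕ) (N : Type*) : Type _ :=
  Matrix (QBasis D L × Cl D L N) (QBasis D L × Cl D L N) ℂ

/-- The block `⟨c| ρ |c⟩` of a joint state. -/
def block {N : Type*} (ρ : State D L N) (c : Cl D L N) : QMat D L := fun a b => ρ (a, c) (b, c)

/-- `ρ_qu = Tr_{H_cl} ρ`. -/
def trCl {N : Type*} [Fintype N] (ρ : State D L N) : QMat D L := ∑ c, block ρ c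

/-! ## Synchronous automaton decoders -/

/-- A local synchronous automaton decoder with control alphabet `M`, locality radius `Δ`, and `v`
elementary automaton updates before each feedback operation. -/
structure SyncDecoder (𝒞 : StabilizerCode D L Δ) (M : Type*) (v : ℕ) where
  init : Site D L → M
  /-- the elementary automaton rule: `A m σ r` is the new value of `m_r` -/
  A : (Site D L → M) → (Site D L → ℤˣ) → Site D L → M
  /-- the feedback operators `F_r(m, σ)` -/
  F : Site D L → (Site D L → M) → (Site D L → ℤˣ) → QMat D L
  A_local : ∀ r m σ m' σ', (∀ r' ∈ ball r Δ, m r' = m' r' ∧ σ r' = σ' r') → A m σ r = A m' σ' r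
  F_local : ∀ r m σ m' σ', (∀ r' ∈ ball r Δ, m r' = m' r' ∧ σ r' = σ' r') → F r m σ = F r m' σ'
  F_supp : ∀ r m σ, SupportedOn (linksIn (ball r Δ)) (F r m σ)
  F_unitary : ∀ r m σ, F r m σ ∈ Matrix.unitaryGroup (QBasis D L) ℂ
  F_syndrome : ∀ r m σ, 𝒞.HasSyndrome (F r m σ)
  F_comm : ∀ r r' m σ, Commute (F r m σ) (F r' m σ)

namespace SyncDecoder

variable {𝒞 : StabilizerCode D L Δ} {M : Type*} {v : ℕ} (𝒟 : SyncDecoder 𝒞 M v)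

/-- The automaton rule of one time step: `v` repetitions of the elementary rule. -/
def rule (m : Site D L → M) (σ : Site D L → ℤˣ) : Site D L → M := (fun m => 𝒟.A m σ)^[v] m

/-- The feedback operator `F(m, σ) = ∏_r F_r(m, σ)`. -/
def feedback (m : Site D L → M) (σ : Site D L → ℤˣ) : QMat D L :=
  Finset.univ.noncommProd (fun r => 𝒟.F r m σ) fun _ _ _ _ _ => 𝒟.F_comm _ _ _ _

variable [Fintype M] [DecidableEq M]

/-- The initial state `∑_σ Π_σ ρ Π_σ ⊗ |m₀, σ⟩⟨m₀, σ|`. -/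
def initial (ρ : QMat D L) : State D L M :=
  ∑ σ, (𝒞.projOn Finset.univ σ * ρ * 𝒞.projOn Finset.univ σ) ⊗ₖ
    Matrix.single (𝒟.init, σ) (𝒟.init, σ) (1 : ℂ)

/-- Kraus operators of the automaton update. -/
def krausA (c : Cl D L M) : State D L M :=
  (1 : QMat D L) ⊗ₖ Matrix.single (𝒟.rule c.1 c.2, c.2) c (1 : ℂ)

/-- Kraus operators of the feedback. -/
def krausF (c : Cl D L M) : State D L M :=
  𝒟.feedback c.1 c.2 ⊗ₖ
    Matrix.single (c.1, c.2 * 𝒞.syndrome (𝒟.feedback c.1 c.2)) c (1 : ℂ)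

/-- The channel `Φ_A`. -/
def channelA (X : State D L M) : State D L M := ∑ c, 𝒟.krausA c * X * (𝒟.krausA c)ᴴ

/-- The channel `Φ_F`. -/
def channelF (X : State D L M) : State D L M := ∑ c, 𝒟.krausF c * X * (𝒟.krausF c)ᴴ

/-- `𝒟^t(ρ) = (Φ_F ∘ Φ_A)^t [ρ₀]`. -/
def evolve (ρ : QMat D L) (t : ℕ) : State D L M :=
  (fun X => 𝒟.channelF (𝒟.channelA X))^[t] (𝒟.initial ρ)

/-- `𝒟^t(ρ)_qu`. -/
def output (ρ : QMat D L) (t : ℕ) : QMat D L := trCl (𝒟.evolve ρ t)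

/-- `T_dec(ρ) = min {t : Tr[𝒟^t(ρ)_qu Π_1] = 1}`, infinite if there is no such `t`. -/
def decodingTime (ρ : QMat D L) : ℝ≥0∞ :=
  ⨅ (t : ℕ) (_ : 𝒞.AnyonFree (𝒟.output ρ t)), (t : ℝ≥0∞)

/-- `T_dec = 𝔼_{ρ ∼ ℰ} T_dec(ρ)`, for noise applied to the state `ρ`. -/
def expectedDecodingTime (p : PMF (PauliLabel D L)) (ρ : QMat D L) : ℝ≥0∞ :=
  ∑ s, p s * 𝒟.decodingTime (noisy s ρ)

/-- On input `ρ`, no nontrivial feedback operator is applied after time `tend`: at each time step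
`t + 1 > tend`, all feedback operators are trivial for every classical configuration that occurs
after the automaton update of that step. -/
def TerminatesIn (ρ : QMat D L) (tend : ℕ) : Prop :=
  ∀ t, tend ≤ t → ∀ c : Cl D L M, (block (𝒟.channelA (𝒟.evolve ρ t)) c).trace ≠ 0 →
    ∀ r, 𝒟.F r c.1 c.2 = 1

/-- The decoder terminates on input `ρ`: feedback stops after finitely many steps, and if the state
becomes anyon-free then no nontrivial feedback is applied afterwards. -/
def Terminates (ρ : QMat D L) : Prop :=
  (∃ tend, 𝒟.TerminatesIn ρ tend) ∧
    ∀ t, 𝒞.AnyonFree (𝒟.output ρ t) → 𝒟.TerminatesIn ρ t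

end SyncDecoder

/-! ## Lindbladian automaton decoders -/

/-- A local Lindbladian automaton decoder with control alphabet `N`. An update at `r` measures the
stabilizers in `B_r(radius)`, obtaining the syndromes `σ`; it then replaces the control variables
`m` by `rule r m σ`, which changes them only in `B_r(radius)`, and applies `feedback r m σ`. -/
structure LindbladianDecoder (𝒞 : StabilizerCode D L Δ) (N : Type*) where
  radius : ℕ
  /-- the mean waiting time between updates of a site -/
  μ : ℝ
  μ_pos : 0 < μ
  init : Site D L → N
  rule : Site D L → (Site D L → N) → (Site D L → ℤˣ) → Site D L → N
  feedback : Site D L → (Site D L → N) → (Site D L → ℤˣ) → QMat D L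
  rule_eq : ∀ r m σ r', r' ∉ ball r radius → rule r m σ r' = m r'
  rule_local : ∀ r m σ m' σ', (∀ r' ∈ ball r radius, m r' = m' r' ∧ σ r' = σ' r') →
    ∀ r' ∈ ball r radius, rule r m σ r' = rule r m' σ' r'
  feedback_local : ∀ r m σ m' σ', (∀ r' ∈ ball r radius, m r' = m' r' ∧ σ r' = σ' r') →
    feedback r m σ = feedback r m' σ'
  feedback_unitary : ∀ r m σ, feedback r m σ ∈ Matrix.unitaryGroup (QBasis D L) ℂ
  feedback_syndrome : ∀ r m σ, 𝒞.HasSyndrome (feedback r m σ)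
  feedback_supp : ∀ r m σ, SupportedOn (linksIn (ball r radius)) (feedback r m σ)

namespace LindbladianDecoder

open Classical in
/-- The stored syndromes `σ`, overwritten in `B` by the measured values `s`. -/
def overwrite (B : Set (Site D L)) (σ : Site D L → ℤˣ) (s : B → ℤˣ) : Site D L → ℤˣ :=
  fun r => if h : r ∈ B then s ⟨r, h⟩ else σ r

variable {𝒞 : StabilizerCode D L Δ} {N : Type*} (𝒟 : LindbladianDecoder 𝒞 N)

/-- The index of a jump operator at `r`: the classical registers in `B_r(radius)` before the jump,
and the outcomes of the measurements of the stabilizers in `B_r(radius)`. -/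
abbrev JumpIndex (r : Site D L) : Type _ := (ball r 𝒟.radius → N × ℤˣ) × (ball r 𝒟.radius → ℤˣ)

theorem rate_pos : 0 < (Fintype.card (Site D L) : ℝ) / 𝒟.μ :=
  div_pos (by exact_mod_cast Fintype.card_pos) 𝒟.μ_pos

variable [Fintype N] [DecidableEq N]

open Classical in
/-- The jump operators. By locality, summing over the configurations `c` of the registers of all
sites that extend the given configuration in the ball amounts to tensoring with the identity on the
registers outside the ball. The stored syndromes are updated with the measured values corrected by
the syndrome of the feedback. -/
def jump (r : Site D L) (i : 𝒟.JumpIndex r) : State D L N :=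
  ((1 / √𝒟.μ : ℝ) : ℂ) •
    ∑ c : Cl D L N, if ∀ x : ball r 𝒟.radius, i.1 x = (c.1 x, c.2 x) then
      (𝒟.feedback r c.1 (overwrite _ c.2 i.2) *
          𝒞.projOn (ball r 𝒟.radius).toFinset (overwrite _ c.2 i.2)) ⊗ₖ
        Matrix.single
          (𝒟.rule r c.1 (overwrite _ c.2 i.2),
            overwrite _ c.2 i.2 *
              𝒞.syndrome (𝒟.feedback r c.1 (overwrite _ c.2 i.2)))
          c (1 : ℂ)
    else 0

open Classical in
/-- The Lindbladian `X ↦ ∑_i (L_i X L_i† - ½ {L_i† L_i, X})`. -/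
def lindbladian (X : State D L N) : State D L N :=
  ∑ r, ∑ i : 𝒟.JumpIndex r,
    (𝒟.jump r i * X * (𝒟.jump r i)ᴴ -
      (2⁻¹ : ℂ) • ((𝒟.jump r i)ᴴ * 𝒟.jump r i * X + X * ((𝒟.jump r i)ᴴ * 𝒟.jump r i)))

/-- The initial state `ρ ⊗ |m₀, 1⟩⟨m₀, 1|`. -/
def initial (ρ : QMat D L) : State D L N :=
  ρ ⊗ₖ Matrix.single (𝒟.init, 1) (𝒟.init, 1) (1 : ℂ)

/-- The evolved state `e^{tℒ} ρ₀`. -/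
def evolve (ρ : QMat D L) (t : ℝ) : State D L N :=
  ∑' k : ℕ, ((t ^ k / k.factorial : ℝ) : ℂ) • 𝒟.lindbladian^[k] (𝒟.initial ρ)

/-- `𝒟^t(ρ)_qu`. -/
def output (ρ : QMat D L) (t : ℝ) : QMat D L := trCl (𝒟.evolve ρ t)

/-! ### The unraveling

The operators `L_i† L_i` sum to `|Λ|/μ` times the identity, and the part of the sum that belongs to
a site `r` is `1/μ` times the identity. So jumps occur at rate `|Λ|/μ` whatever the state is, and
each jump is at a uniformly random site: the sites propose updates at the points of independent
Poisson processes of rate `1/μ`. Given the proposed updates, the state at time `t` is obtained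
from the initial state by applying the channel `X ↦ μ ∑_{i at r} L_i X L_i†` for each update
proposed up to time `t`, in their order. -/

/-- A realization of the proposed updates: the waiting time before each one, and its site. -/
abbrev Clock (D L : ℕ) : Type := ℕ → ℝ × Site D L

/-- The law of the proposed updates: independent, with exponential waiting times of rate `|Λ|/μ` and
uniformly distributed sites. -/
def clockLaw : Measure (Clock D L) :=
  haveI := isProbabilityMeasure_expMeasure 𝒟.rate_pos
  Measure.infinitePi fun _ : ℕ =>
    (expMeasure ((Fintype.card (Site D L) : ℝ) / 𝒟.μ)).prod
      (PMF.uniformOfFintype (Site D L)).toMeasure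

open Classical in
/-- The channel by which an update proposed at `r` acts. -/
def updateChannel (r : Site D L) (X : State D L N) : State D L N :=
  (𝒟.μ : ℂ) • ∑ i : 𝒟.JumpIndex r, 𝒟.jump r i * X * (𝒟.jump r i)ᴴ

/-- The state after the first `k` proposed updates. -/
def trajectory (ρ : QMat D L) (ω : Clock D L) : ℕ → State D L N
  | 0 => 𝒟.initial ρ
  | k + 1 => 𝒟.updateChannel (ω k).2 (trajectory ρ ω k)

/-- The decoding time for given proposed updates: the time from which on the state is anyon-free
(infinite if there is none). As the state is constant between two proposed updates, this time is `0`
or the time of a proposed update. -/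
def decodingTime (ρ : QMat D L) (ω : Clock D L) : ℝ≥0∞ :=
  ⨅ (k : ℕ) (_ : ∀ k' ≥ k, 𝒞.AnyonFree (trCl (𝒟.trajectory ρ ω k'))),
    ENNReal.ofReal (∑ j ∈ Finset.range k, (ω j).1)

/-- The expected decoding time, for noise applied to the state `ρ`. -/
def expectedDecodingTime (p : PMF (PauliLabel D L)) (ρ : QMat D L) : ℝ≥0∞ :=
  ∑ s, p s * ∫⁻ ω, 𝒟.decodingTime (noisy s ρ) ω ∂𝒟.clockLaw

end LindbladianDecoder

/-! ## Logical failure rates -/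

/-- The trace distance between the output of a decoder at time `t`, on the logical state `ρ`
subjected to noise, and `ρ`; here `out ρ' t` is the output at time `t` on input `ρ'`. -/
def failure {ι : Type*} (out : QMat D L → ι → QMat D L) (p : PMF (PauliLabel D L))
    (ρ : QMat D L) (t : ι) : ℝ :=
  traceNorm (out (noiseChannel p ρ) t - ρ) / 2

/-- The logical failure rate: the worst case over logical states of the limit of `failure` at late
times. (Written with the upper limit, which is the limit where that exists.) -/
def failureRate {ι : Type*} [Preorder ι] (𝒞 : StabilizerCode D L Δ)
    (out : QMat D L → ι → QMat D L) (p : PMF (PauliLabel D L)) : ℝ≥0∞ :=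
  ⨆ (ρ : QMat D L) (_ : 𝒞.IsLogical ρ),
    limsup (fun t => ENNReal.ofReal (failure out p ρ t)) atTop

/-! ## Desynchronization with marching soldiers -/

/-- The control variables of the desynchronized decoder at one site. The variable `lag d` of site
`r` is the lag time from `r` to `r + d`, for `0 < |d| ≤ 2R`. -/
structure AsyncVars (D L : ℕ) [NeZero L] (R v : ℕ) (M : Type*) where
  mOld : M
  mNew : M
  sOld : ℤˣ
  sNew : ℤˣ
  sFut : ℤˣ
  lag : {d : Site D L // d ≠ 0 ∧ torusDist 0 d ≤ 2 * R} → SignType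
  u : Fin v

open Classical in
instance {R v : ℕ} {M : Type*} : DecidableEq (AsyncVars D L R v M) := Classical.decEq _

open Classical in
instance {R v : ℕ} {M : Type*} [Fintype M] : Fintype (AsyncVars D L R v M) :=
  Fintype.ofInjective
    (fun x => (x.mOld, x.mNew, x.sOld, x.sNew, x.sFut, x.lag, x.u))
    (by
      rintro ⟨_, _, _, _, _, _, _⟩ ⟨_, _, _, _, _, _, _⟩ h
      simpa using h)

/-- `lag ↦ lag + 1`, within `{-1, 0, 1}`. -/
def lagSucc (l : SignType) : SignType := if l = -1 then 0 else 1

/-- `lag ↦ lag - 1`, within `{-1, 0, 1}`. -/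
def lagPred (l : SignType) : SignType := if l = 1 then 0 else -1

namespace SyncDecoder

variable {𝒞 : StabilizerCode D L Δ} {M : Type*} {v : ℕ} (𝒟 : SyncDecoder 𝒞 M v)

/-- The radius `R` such that the feedback operator applied at `r` in a step, which is controlled
by the control variables after the automaton update, depends on the variables before that step
only in `B_r(R)`, and such that it changes syndromes only in `B_r(R)`. -/
def range (_ : SyncDecoder 𝒞 M v) : ℕ := 2 * Δ

/-- Configurations of the control variables of the desynchronized decoder. -/
abbrev AConf : Type _ := Site D L → AsyncVars D L 𝒟.range v M

variable {𝒟}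

open Classical in
/-- `lag_{r → r'}`, set to `0` if `r' = r` or `r'` is outside `B_r(2R)`. -/
def lagTo (x : 𝒟.AConf) (r r' : Site D L) : SignType :=
  if h : r' - r ≠ 0 ∧ torusDist 0 (r' - r) ≤ 2 * 𝒟.range then (x r).lag ⟨r' - r, h⟩ else 0

/-- A proposed update at `r` is accepted iff `lag_{r → r'} ≤ 0` for all `r' ≠ r` in `B_r(2R)`. -/
def Accepted (x : 𝒟.AConf) (r : Site D L) : Prop :=
  ∀ r' ∈ ball r (2 * 𝒟.range), r' ≠ r → lagTo x r r' ≤ 0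

open Classical in
/-- The refreshed value `σ_{r'}^a σ_{r'}^future` of `σ_{r'}^new` for `r'` in `B_r(R)`; here `σ` are the
measured syndromes. -/
def newSyn (x : 𝒟.AConf) (r : Site D L) (σ : Site D L → ℤˣ) (r' : Site D L) : ℤˣ :=
  if r' ∈ ball r 𝒟.range then σ r' * (x r').sFut else (x r').sNew

/-- `m_r^present`: old values on the sites that are one step ahead of `r`, new values elsewhere. -/
def mPresent (x : 𝒟.AConf) (r r' : Site D L) : M :=
  if lagTo x r r' = -1 then (x r').mOld else (x r').mNew

/-- `σ_r^present`. -/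
def sPresent (x : 𝒟.AConf) (r : Site D L) (σ : Site D L → ℤˣ) (r' : Site D L) : ℤˣ :=
  if lagTo x r r' = -1 then (x r').sOld else newSyn x r σ r'

variable (𝒟)

open Classical in
/-- The feedback of the desynchronized decoder: if the update at `r` is accepted and `u_r = v - 1`,
it is the feedback operator of `𝒟` at `r`, controlled as in `𝒟` by the control variables after the
automaton update and by the syndromes before the feedback. -/
def asyncF (r : Site D L) (x : 𝒟.AConf) (σ : Site D L → ℤˣ) : QMat D L :=
  if Accepted x r ∧ (x r).u.val + 1 = v then
    𝒟.F r (𝒟.A (mPresent x r) (sPresent x r σ)) (sPresent x r σ)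
  else 1

open Classical in
/-- The marching soldiers desynchronization of the automaton rule. -/
def asyncA [NeZero v] (r : Site D L) (x : 𝒟.AConf) (σ : Site D L → ℤˣ) : 𝒟.AConf := fun r' =>
  if Accepted x r then
    if r' = r then
      { mOld := (x r).mNew
        mNew := 𝒟.A (mPresent x r) (sPresent x r σ) r
        sOld := newSyn x r σ r
        sNew := newSyn x r σ r
        sFut := if (x r).u.val + 1 = v then 1 else (x r).sFut
        lag := fun d => lagSucc ((x r).lag d)
        u := (x r).u + 1 }
    else
      { x r' with
        sNew := newSyn x r σ r'
        sFut :=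
          if r' ∈ ball r 𝒟.range ∧ lagTo x r r' = 0 then
            (x r').sFut * 𝒞.syndrome (𝒟.asyncF r x σ) r'
          else (x r').sFut
        lag := fun d => if d.val = r - r' then lagPred ((x r').lag d) else (x r').lag d }
  else { x r' with sNew := newSyn x r σ r' }

section Locality

variable {𝒟}
variable {r : Site D L} {x x' : 𝒟.AConf} {σ σ' : Site D L → ℤˣ}

theorem lagTo_congr (h : x r = x' r) (r' : Site D L) : lagTo x r r' = lagTo x' r r' := by
  simp only [lagTo, h]

theorem accepted_congr (h : x r = x' r) : Accepted x r ↔ Accepted x' r := by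
  simp only [Accepted, lagTo_congr h]

theorem newSyn_congr (h : ∀ r' ∈ ball r (2 * 𝒟.range), x r' = x' r' ∧ σ r' = σ' r')
    {r' : Site D L} (hr' : r' ∈ ball r (2 * 𝒟.range)) :
    newSyn x r σ r' = newSyn x' r σ' r' := by
  simp only [newSyn, (h r' hr').1, (h r' hr').2]

theorem mPresent_congr (h : ∀ r' ∈ ball r (2 * 𝒟.range), x r' = x' r' ∧ σ r' = σ' r')
    {r' : Site D L} (hr' : r' ∈ ball r (2 * 𝒟.range)) :
    mPresent x r r' = mPresent x' r r' := by
  simp only [mPresent, (h r' hr').1, lagTo_congr (h r (mem_ball_self _ _)).1]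

theorem sPresent_congr (h : ∀ r' ∈ ball r (2 * 𝒟.range), x r' = x' r' ∧ σ r' = σ' r')
    {r' : Site D L} (hr' : r' ∈ ball r (2 * 𝒟.range)) :
    sPresent x r σ r' = sPresent x' r σ' r' := by
  simp only [sPresent, (h r' hr').1, lagTo_congr (h r (mem_ball_self _ _)).1, newSyn_congr h hr']

theorem A_present_congr (h : ∀ r' ∈ ball r (2 * 𝒟.range), x r' = x' r' ∧ σ r' = σ' r')
    {r' : Site D L} (hr' : r' ∈ ball r Δ) :
    𝒟.A (mPresent x r) (sPresent x r σ) r' = 𝒟.A (mPresent x' r) (sPresent x' r σ') r' := by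
  refine 𝒟.A_local _ _ _ _ _ fun r'' hr'' => ?_
  have : r'' ∈ ball r (2 * 𝒟.range) :=
    ball_mono r (by unfold range; omega) (mem_ball_add hr' hr'')
  exact ⟨mPresent_congr h this, sPresent_congr h this⟩

theorem asyncF_congr (h : ∀ r' ∈ ball r (2 * 𝒟.range), x r' = x' r' ∧ σ r' = σ' r') :
    𝒟.asyncF r x σ = 𝒟.asyncF r x' σ' := by
  have h0 := (h r (mem_ball_self _ _)).1
  have hF : 𝒟.F r (𝒟.A (mPresent x r) (sPresent x r σ)) (sPresent x r σ) =
      𝒟.F r (𝒟.A (mPresent x' r) (sPresent x' r σ')) (sPresent x' r σ') := by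
    refine 𝒟.F_local _ _ _ _ _ fun r' hr' => ⟨A_present_congr h hr', sPresent_congr h ?_⟩
    exact ball_mono r (by unfold range; omega) hr'
  classical
  unfold asyncF
  rw [hF]
  refine if_congr ?_ rfl rfl
  rw [accepted_congr h0, h0]

theorem asyncA_congr [NeZero v]
    (h : ∀ r' ∈ ball r (2 * 𝒟.range), x r' = x' r' ∧ σ r' = σ' r')
    {r' : Site D L} (hr' : r' ∈ ball r (2 * 𝒟.range)) :
    𝒟.asyncA r x σ r' = 𝒟.asyncA r x' σ' r' := by
  have h0 := (h r (mem_ball_self _ _)).1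
  classical
  unfold asyncA
  refine if_congr (accepted_congr h0) (if_congr Iff.rfl ?_ ?_) ?_
  · simp only [h0, newSyn_congr h (mem_ball_self r _), A_present_congr h (mem_ball_self r _)]
  · rw [asyncF_congr h, (h r' hr').1, newSyn_congr h hr']
    have hl := lagTo_congr h0 r'
    by_cases h1 : r' ∈ ball r 𝒟.range ∧ lagTo x r r' = 0
    · rw [if_pos h1, if_pos (hl ▸ h1)]
    · rw [if_neg h1, if_neg (hl ▸ h1)]
  · simp only [(h r' hr').1, newSyn_congr h hr']

end Locality

theorem asyncA_eq [NeZero v] (r : Site D L) (x : 𝒟.AConf) (σ : Site D L → ℤˣ) (r' : Site D L)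
    (hr' : r' ∉ ball r (2 * 𝒟.range)) : 𝒟.asyncA r x σ r' = x r' := by
  have hne : r' ≠ r := by rintro rfl; exact hr' (mem_ball_self _ _)
  have hR : r' ∉ ball r 𝒟.range := fun h' => hr' (ball_mono r (by omega) h')
  have hlag : ∀ d : {d : Site D L // d ≠ 0 ∧ torusDist 0 d ≤ 2 * 𝒟.range}, d.val ≠ r - r' := by
    intro d hd
    have := d.2.2
    rw [hd, torusDist_zero_sub] at this
    exact hr' this
  simp [asyncA, newSyn, hne, hR, hlag]

/-- The desynchronization of a synchronous automaton decoder, with mean waiting time `μ`. -/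
def desynchronize [NeZero v] (μ : ℝ) (hμ : 0 < μ) :
    LindbladianDecoder 𝒞 (AsyncVars D L 𝒟.range v M) where
  radius := 2 * 𝒟.range
  μ := μ
  μ_pos := hμ
  init := fun r =>
    { mOld := 𝒟.init r, mNew := 𝒟.init r, sOld := 1, sNew := 1, sFut := 1, lag := 0, u := 0 }
  rule := 𝒟.asyncA
  feedback := 𝒟.asyncF
  rule_eq := 𝒟.asyncA_eq
  rule_local := fun _ _ _ _ _ h _ hr' => asyncA_congr h hr'
  feedback_local := fun _ _ _ _ _ h => asyncF_congr h
  feedback_unitary := fun r x σ => by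
    unfold asyncF
    split_ifs
    · exact 𝒟.F_unitary _ _ _
    · exact one_mem _
  feedback_syndrome := fun r x σ => by
    unfold asyncF
    split_ifs
    · exact 𝒟.F_syndrome _ _ _
    · exact fun _ => Or.inl (by simp)
  feedback_supp := fun r x σ => by
    unfold asyncF
    split_ifs
    · refine (𝒟.F_supp _ _ _).mono fun l hl => ?_
      have : ball r Δ ⊆ ball r (2 * 𝒟.range) := ball_mono r (by unfold range; omega)
      exact ⟨this hl.1, this hl.2⟩
    · exact supportedOn_one _

end SyncDecoder

end AutomatonDecoder

end

/-! The proof is an exact simulation argument followed by an estimate of how fast the simulation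
progresses.

Simulation. Pauli noise on a logical state gives a state with definite syndromes `τ`, and feedback
operators commute or anticommute with the stabilizers. Every measurement outcome is therefore
determined, and both decoders pass only through states `U ρ Uᴴ ⊗ |c⟩⟨c|`. In the desynchronized
decoder let `h r` count the accepted updates at `r`. A site may advance only if it is not ahead of
any site within `2R = 4Δ`, so nearby heights differ by at most one, and one stored old value per
site suffices to recover the synchronous past. The syndromes need a correction: a neighbour that is
already a time step ahead has changed the measured value too early, and `sFut` records exactly this
change, so that measured syndrome times `sFut` is the synchronous syndrome
(`quantumSyn_mul_futureSyn`). By induction over updates, a site of height `n` holds the control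
value of the synchronous decoder after `n` elementary updates (`Follows.advance`), and the quantum
state is `ρ` conjugated by the product `totalFb` of the synchronous feedback operators completed so
far. Their order is immaterial: operators of one time step commute, and one that is applied late has
support disjoint from those of later time steps already applied (`layers_update`). Once every site
has completed the `T` time steps after which feedback stops, the state is exactly the synchronous
output (`totalFb_eq_syncOp`).

Failure rates. On the states that occur, the Lindbladian is `(∑ᵣ Φᵣ - N)/μ` with `N` the number of
sites, so its exponential is a Poisson average over histories of proposed updates. The fraction of
histories in which some site lags tends to zero, hence both decoders converge to the same state.
Summing over the noise and using continuity of the trace norm gives item 1.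

Upper bound. The potential `∑ᵣ (2d)^(-h r)`, with `d` a bound on the neighbourhood size, shrinks on
average by a factor `1 - 1/(4N)` per proposal (`sum_potential_advance`). All heights thus reach `T
v` after an expected `O(N (log N + T v))` proposals, each taking time `μ/N` on average.

Lower bound. If the synchronous decoder becomes anyon-free only at step `T + 1`, some site `r`
applies in its last step a feedback operator with nontrivial syndrome. The completion of that step
at `r` changes the quantum syndromes, so decoding cannot have ended before (`le_decodingTime`). This
needs `(T + 1) v` proposals at `r`, and Markov's inequality gives expected time at least `μ (T + 1)
v / 2`. -/

noncomputable section

namespace AutomatonDecoder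

section

/-! ## Sums over sequences of sites -/

section Sequences

variable {Λ : Type*} [Fintype Λ]

/-- The sum of `g` over all extensions of the history `l` by `k` further sites. The latest site of a
history is its head. -/
def sumSeq {E : Type*} [AddCommMonoid E] : ℕ → (List Λ → E) → List Λ → E
  | 0, g, l => g l
  | k + 1, g, l => ∑ r, sumSeq k g (r :: l)

/-- The definition splits off the earliest added site. Splitting off the latest one instead is what
one-step estimates on the current configuration need. -/
theorem sumSeq_succ' {E : Type*} [AddCommMonoid E] (k : ℕ) (g : List Λ → E) (l : List Λ) :
    sumSeq (k + 1) g l = sumSeq k (fun l => ∑ r, g (r :: l)) l := by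
  induction k generalizing l with
  | zero => rfl
  | succ k ih => simp only [sumSeq] at ih ⊢; exact Finset.sum_congr rfl fun r _ => ih (r :: l)

theorem map_sumSeq {E F G : Type*} [AddCommMonoid E] [AddCommMonoid F] [FunLike G E F]
    [AddMonoidHomClass G E F] (φ : G) (k : ℕ) (g : List Λ → E) (l : List Λ) :
    φ (sumSeq k g l) = sumSeq k (fun l => φ (g l)) l := by
  induction k generalizing l with
  | zero => rfl
  | succ k ih => simp only [sumSeq, map_sum, ih]

theorem sumSeq_le {k : ℕ} {g g' : List Λ → ℝ} (h : ∀ l, g l ≤ g' l) (l : List Λ) :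
    sumSeq k g l ≤ sumSeq k g' l := by
  induction k generalizing l with
  | zero => exact h l
  | succ k ih => exact Finset.sum_le_sum fun r _ => ih _

theorem sumSeq_mul (k : ℕ) (a : ℝ) (g : List Λ → ℝ) (l : List Λ) :
    sumSeq k (fun l => a * g l) l = a * sumSeq k g l :=
  (map_sumSeq (AddMonoidHom.mulLeft a) k g l).symm

theorem sumSeq_add {E : Type*} [AddCommMonoid E] (k : ℕ) (g g' : List Λ → E) (l : List Λ) :
    sumSeq k (fun l => g l + g' l) l = sumSeq k g l + sumSeq k g' l := by
  induction k generalizing l with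
  | zero => rfl
  | succ k ih => simp only [sumSeq, ih, Finset.sum_add_distrib]

theorem sumSeq_const {E : Type*} [AddCommMonoid E] (k : ℕ) (a : E) (l : List Λ) :
    sumSeq k (fun _ => a) l = (Fintype.card Λ) ^ k • a := by
  induction k generalizing l with
  | zero => simp [sumSeq]
  | succ k ih => simp [sumSeq, ih, pow_succ', mul_smul]

theorem norm_sumSeq_le {E : Type*} [SeminormedAddCommGroup E] (k : ℕ) (g : List Λ → E)
    (l : List Λ) : ‖sumSeq k g l‖ ≤ sumSeq k (fun l => ‖g l‖) l := by
  induction k generalizing l with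
  | zero => exact le_rfl
  | succ k ih => exact (norm_sum_le _ _).trans (Finset.sum_le_sum fun r _ => ih _)

theorem sumSeq_le_pow_mul {g : List Λ → ℝ} {q : ℝ} (hq : 0 ≤ q)
    (h : ∀ l, ∑ r, g (r :: l) ≤ q * g l) (k : ℕ) (l : List Λ) :
    sumSeq k g l ≤ q ^ k * g l := by
  induction k with
  | zero => simp [sumSeq]
  | succ k ih =>
    rw [sumSeq_succ', pow_succ']
    calc _ ≤ sumSeq k (fun l => q * g l) l := sumSeq_le h l
      _ = q * sumSeq k g l := sumSeq_mul _ _ _ _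
      _ ≤ _ := by rw [mul_assoc]; exact mul_le_mul_of_nonneg_left ih hq

/-- Linearity of expectation: each new site equals `r` for a fraction `1/N` of the sequences. Both
sides carry a factor `N` to avoid division. -/
theorem sumSeq_count [DecidableEq Λ] (r : Λ) (k : ℕ) (l : List Λ) :
    (Fintype.card Λ : ℝ) * sumSeq k (fun l => (l.count r : ℝ)) l =
      (Fintype.card Λ : ℝ) ^ k * (k + Fintype.card Λ * l.count r) := by
  induction k generalizing l with
  | zero => simp [sumSeq]
  | succ k ih =>
    simp only [sumSeq]
    rw [Finset.mul_sum]
    simp only [ih, List.count_cons, beq_iff_eq]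
    rw [← Finset.mul_sum, pow_succ, mul_assoc]
    congr 1
    push_cast
    simp only [mul_add, Finset.sum_add_distrib, Finset.sum_const, Finset.card_univ,
      nsmul_eq_mul, Finset.sum_ite_eq', Finset.mem_univ, if_true, mul_ite, mul_one, mul_zero]
    ring

end Sequences

/-! ## Heights of marching soldiers -/

section Heights

variable {Λ : Type*} [Fintype Λ] [DecidableEq Λ] (ngb : Λ → Finset Λ)

/-- The site `r` advances if it is not ahead of any of its neighbours. -/
def advance (r : Λ) (h : Λ → ℕ) : Λ → ℕ :=
  if ∀ r' ∈ ngb r, h r ≤ h r' then Function.update h r (h r + 1) else h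

/-- The numbers of accepted updates of all sites, after the proposed updates in a history. -/
def heights : List Λ → Λ → ℕ
  | [] => 0
  | r :: l => advance ngb r (heights l)

/-- Some site has made fewer than `n` accepted updates. -/
def Lagging (n : ℕ) (l : List Λ) : Prop := ∃ r, heights ngb l r < n

theorem le_advance (r : Λ) (h : Λ → ℕ) (r' : Λ) : h r' ≤ advance ngb r h r' := by
  unfold advance
  split_ifs
  · by_cases e : r' = r
    · subst e; simp
    · simp [e]
  · exact le_rfl

theorem heights_le_count (l : List Λ) (r : Λ) : heights ngb l r ≤ l.count r := by
  induction l with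
  | nil => simp [heights]
  | cons a l ih =>
    simp only [heights, advance, List.count_cons, beq_iff_eq]
    by_cases e : a = r
    · subst e
      simp only [if_true]
      split_ifs
      · simpa using ih
      · exact ih.trans (Nat.le_succ _)
    · have e' : r ≠ a := fun h => e h.symm
      simp only [e, if_false, add_zero]
      split_ifs
      · simpa [e'] using ih
      · exact ih

/-- The potential of the marching soldiers. -/
def potential (a : ℝ) (h : Λ → ℕ) : ℝ := ∑ r, (a ^ h r)⁻¹

/-- A site that is free to advance loses the fraction `1 - 1/(2d) ≥ 1/2` of its weight. A blocked
site has a strictly lower neighbour, whose weight is at least `2d` times larger. Charging blocked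
sites to their neighbours costs each site at most `d · 1/(2d) = 1/2` of its weight, so the free
sites carry at least half of the potential, and the total drop is at least a quarter of it. -/
theorem sum_potential_advance {d : ℕ} (hd : 1 ≤ d) (hcard : ∀ r, (ngb r).card ≤ d)
    (hsymm : ∀ r r', r' ∈ ngb r → r ∈ ngb r') (h : Λ → ℕ) :
    ∑ r, potential (2 * d) (advance ngb r h) ≤
      (Fintype.card Λ - 1 / 4) * potential (2 * d) h := by
  set a : ℝ := 2 * d with ha
  have hd' : (1 : ℝ) ≤ d := by exact_mod_cast hd
  have ha2 : 2 ≤ a := by linarith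
  have ha0 : 0 < a := by linarith
  set w : Λ → ℝ := fun r => (a ^ h r)⁻¹ with hw
  have hw0 : ∀ r, 0 < w r := fun r => by positivity
  classical
  set P : Λ → Prop := fun r => ∀ r' ∈ ngb r, h r ≤ h r' with hP
  have h1 : ∀ r, potential a (advance ngb r h) =
      potential a h - if P r then (1 - a⁻¹) * w r else 0 := by
    intro r
    by_cases hr : P r
    · have : advance ngb r h = Function.update h r (h r + 1) := if_pos hr
      rw [this, if_pos hr]
      unfold potential
      rw [← Finset.add_sum_erase _ _ (Finset.mem_univ r),
        ← Finset.add_sum_erase (a := r) (f := fun r => (a ^ h r)⁻¹) _ (Finset.mem_univ r)]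
      have : ∑ x ∈ Finset.univ.erase r, (a ^ (Function.update h r (h r + 1)) x)⁻¹ =
          ∑ x ∈ Finset.univ.erase r, (a ^ h x)⁻¹ :=
        Finset.sum_congr rfl fun x hx => by simp [Finset.ne_of_mem_erase hx]
      rw [this]
      simp only [Function.update_self, pow_succ, mul_inv, hw]
      ring
    · have : advance ngb r h = h := if_neg hr
      rw [this, if_neg hr, sub_zero]
  -- The charging argument; symmetry of the neighbour relation allows the double sum to be reordered
  -- by the site that is charged.
  have h2 : ∑ r, (if P r then 0 else w r) ≤ ∑ r, w r / 2 := by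
    have key : ∀ r, (if P r then 0 else w r) ≤ ∑ r' ∈ ngb r, a⁻¹ * w r' := by
      intro r
      split_ifs with hr
      · exact Finset.sum_nonneg fun r' _ => by have := hw0 r'; positivity
      · simp only [hP, not_forall, not_le] at hr
        obtain ⟨r', hr', hlt⟩ := hr
        calc w r ≤ a⁻¹ * w r' := by
              rw [hw, ← mul_inv, ← pow_succ']
              exact inv_anti₀ (by positivity) (pow_le_pow_right₀ (by linarith) hlt)
          _ ≤ _ := Finset.single_le_sum (f := fun r' => a⁻¹ * w r')
              (fun r' _ => by have := hw0 r'; positivity) hr'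
    calc _ ≤ ∑ r, ∑ r' ∈ ngb r, a⁻¹ * w r' := Finset.sum_le_sum fun r _ => key r
      _ = ∑ r', ∑ r ∈ ngb r', a⁻¹ * w r' :=
          Finset.sum_comm' fun r r' => by
            constructor
            · rintro ⟨_, h⟩; exact ⟨hsymm _ _ h, Finset.mem_univ _⟩
            · rintro ⟨h, _⟩; exact ⟨Finset.mem_univ _, hsymm _ _ h⟩
      _ ≤ _ := Finset.sum_le_sum fun r' _ => by
          rw [Finset.sum_const, nsmul_eq_mul]
          have h3 : ((ngb r').card : ℝ) ≤ d := by exact_mod_cast hcard r'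
          have h4 : (d : ℝ) * a⁻¹ = 1 / 2 := by rw [ha]; field_simp
          calc _ ≤ (d : ℝ) * (a⁻¹ * w r') :=
                mul_le_mul_of_nonneg_right h3 (by have := hw0 r'; positivity)
            _ = w r' / 2 := by rw [← mul_assoc, h4]; ring
  have h3 : ∑ r, (if P r then w r else 0) + ∑ r, (if P r then 0 else w r) = ∑ r, w r := by
    rw [← Finset.sum_add_distrib]
    exact Finset.sum_congr rfl fun r _ => by split_ifs <;> simp
  have h4 : (1 : ℝ) / 2 ≤ 1 - a⁻¹ := by
    have : a⁻¹ ≤ 2⁻¹ := inv_anti₀ (by norm_num) ha2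
    linarith
  have h5 : ∑ r, (if P r then (1 - a⁻¹) * w r else 0) =
      (1 - a⁻¹) * ∑ r, (if P r then w r else 0) := by
    rw [Finset.mul_sum]; exact Finset.sum_congr rfl fun r _ => by split_ifs <;> simp
  simp only [h1, Finset.sum_sub_distrib, Finset.sum_const, Finset.card_univ, nsmul_eq_mul, h5]
  have h6 : potential a h = ∑ r, w r := rfl
  have h7 : ∑ r, w r / 2 = (∑ r, w r) / 2 := (Finset.sum_div _ _ _).symm
  have h8 : 0 ≤ ∑ r, w r := Finset.sum_nonneg fun r _ => (hw0 r).le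
  rw [h6]
  nlinarith

open Classical in
/-- The number of sequences of `k` proposed updates after which some site has made fewer than `n`
updates decays geometrically. -/
theorem sumSeq_lagging_le [Nonempty Λ] {d : ℕ} (hd : 1 ≤ d) (hcard : ∀ r, (ngb r).card ≤ d)
    (hsymm : ∀ r r', r' ∈ ngb r → r ∈ ngb r') (n k : ℕ) :
    sumSeq k (fun l => if Lagging ngb n l then (1 : ℝ) else 0) [] ≤
      (Fintype.card Λ * (2 * d : ℝ) ^ n) * (Fintype.card Λ - 1 / 4 : ℝ) ^ k := by
  have hd' : (1 : ℝ) ≤ d := by exact_mod_cast hd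
  have hN : (1 : ℝ) ≤ Fintype.card Λ := by exact_mod_cast Fintype.card_pos (α := Λ)
  have h0 : ∀ h : Λ → ℕ, 0 ≤ potential (2 * d) h := fun h =>
    Finset.sum_nonneg fun r _ => by positivity
  -- Markov's inequality for the potential: a single site of height below `n` already contributes at
  -- least `(2d)^(-n)`.
  have h1 : ∀ l, (if Lagging ngb n l then (1 : ℝ) else 0) ≤
      (2 * d : ℝ) ^ n * potential (2 * d) (heights ngb l) := by
    intro l
    split_ifs with hl
    · obtain ⟨r, hr⟩ := hl
      have : ((2 * d : ℝ) ^ heights ngb l r)⁻¹ ≤ potential (2 * d) (heights ngb l) :=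
        Finset.single_le_sum (f := fun r => ((2 * d : ℝ) ^ heights ngb l r)⁻¹)
          (fun r' _ => by positivity) (Finset.mem_univ r)
      calc (1 : ℝ) = (2 * d : ℝ) ^ n * ((2 * d : ℝ) ^ n)⁻¹ := by
            rw [mul_inv_cancel₀]; positivity
        _ ≤ (2 * d : ℝ) ^ n * ((2 * d : ℝ) ^ heights ngb l r)⁻¹ :=
            mul_le_mul_of_nonneg_left
              (inv_anti₀ (by positivity) (pow_le_pow_right₀ (by linarith) hr.le)) (by positivity)
        _ ≤ _ := mul_le_mul_of_nonneg_left this (by positivity)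
    · exact mul_nonneg (by positivity) (h0 _)
  calc _ ≤ _ := sumSeq_le h1 []
    _ = _ := sumSeq_mul _ _ _ _
    _ ≤ (2 * d : ℝ) ^ n * ((Fintype.card Λ - 1 / 4 : ℝ) ^ k *
          potential (2 * d) (heights ngb [])) :=
        mul_le_mul_of_nonneg_left
          (sumSeq_le_pow_mul (g := fun l => potential (2 * d) (heights ngb l)) (by linarith)
            (fun l => sum_potential_advance ngb hd hcard hsymm _) k []) (by positivity)
    _ = _ := by simp [potential, heights]; ring

open Classical in
/-- A lower bound on the number of sequences of `k` proposed updates after which `r` has made fewer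
than `m` updates. -/
theorem le_sumSeq_heights_lt [Nonempty Λ] (r : Λ) {m : ℕ} (hm : 0 < m) (k : ℕ) :
    (Fintype.card Λ : ℝ) ^ k * (1 - k / (Fintype.card Λ * m)) ≤
      sumSeq k (fun l => if heights ngb l r < m then (1 : ℝ) else 0) [] := by
  have hN : (0 : ℝ) < Fintype.card Λ := by exact_mod_cast Fintype.card_pos (α := Λ)
  have hm' : (0 : ℝ) < m := by exact_mod_cast hm
  -- Markov's inequality in pointwise form: the indicator of `height < m` is at least `1 - count/m`,
  -- since the height is at most the count.
  have h1 : ∀ l : List Λ, (1 : ℝ) + (-(m : ℝ)⁻¹) * l.count r ≤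
      if heights ngb l r < m then (1 : ℝ) else 0 := by
    intro l
    have h2 := heights_le_count ngb l r
    split_ifs with h
    · have : 0 ≤ (m : ℝ)⁻¹ * l.count r := by positivity
      linarith
    · have : (m : ℝ) ≤ l.count r := by exact_mod_cast (not_lt.mp h).trans h2
      have := mul_le_mul_of_nonneg_left this (inv_nonneg.mpr hm'.le)
      rw [inv_mul_cancel₀ hm'.ne'] at this
      linarith
  refine le_trans (le_of_eq ?_) (sumSeq_le h1 [])
  rw [sumSeq_add, sumSeq_const, sumSeq_mul]
  have h3 := sumSeq_count r k ([] : List Λ)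
  have h4 : sumSeq k (fun l => (l.count r : ℝ)) [] =
      (Fintype.card Λ : ℝ) ^ k * k / Fintype.card Λ := by
    rw [eq_div_iff hN.ne', mul_comm, h3]
    simp
  rw [h4]
  simp
  field_simp
  ring

end Heights

end

section

/-! ## Exponential waiting times -/

theorem lintegral_ofReal_expMeasure {r : ℝ} (hr : 0 < r) :
    ∫⁻ x, ENNReal.ofReal x ∂(expMeasure r) = ENNReal.ofReal r⁻¹ := by
  -- The density of the exponential law times `x` is `r⁻¹` times the gamma density of shape 2, so
  -- the mean follows from the normalization of the latter.
  have h2 := lintegral_gammaPDF_eq_one (a := 2) (by norm_num) hr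
  unfold expMeasure gammaMeasure
  rw [lintegral_withDensity_eq_lintegral_mul _ (by unfold gammaPDF; fun_prop) (by fun_prop)]
  rw [← mul_one (ENNReal.ofReal r⁻¹), ← h2,
    ← lintegral_const_mul _ (by unfold gammaPDF; fun_prop)]
  refine lintegral_congr fun x => ?_
  rcases lt_or_ge x 0 with hx | hx
  · simp [gammaPDF_of_neg hx]
  · simp only [Pi.mul_apply, gammaPDF_of_nonneg hx]
    rw [← ENNReal.ofReal_mul (by positivity), ← ENNReal.ofReal_mul (by positivity)]
    congr 1
    have h1 : (2 : ℝ) - 1 = 1 := by norm_num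
    rw [h1, Real.Gamma_one, Real.Gamma_two, sub_self, Real.rpow_zero, Real.rpow_one, Real.rpow_one,
      Real.rpow_two]
    field_simp

theorem ae_nonneg_expMeasure (r : ℝ) : ∀ᵐ x ∂(expMeasure r), 0 ≤ x := by
  unfold expMeasure gammaMeasure
  rw [ae_withDensity_iff (by unfold gammaPDF; fun_prop)]
  refine Eventually.of_forall fun x hx => ?_
  by_contra h
  exact hx (gammaPDF_of_neg (not_le.mp h))

/-! ## Proposed updates -/

theorem ofReal_sumSeq {Λ : Type*} [Fintype Λ] {k : ℕ} {g : List Λ → ℝ} (hg : ∀ l, 0 ≤ g l)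
    (l : List Λ) : ENNReal.ofReal (sumSeq k g l) = sumSeq k (fun l => ENNReal.ofReal (g l)) l := by
  have h0 : ∀ k l, 0 ≤ sumSeq k g l := by
    intro k
    induction k with
    | zero => exact hg
    | succ k ih => exact fun l => Finset.sum_nonneg fun r _ => ih _
  induction k generalizing l with
  | zero => rfl
  | succ k ih =>
    simp only [sumSeq]
    rw [ENNReal.ofReal_sum_of_nonneg fun r _ => h0 _ _]
    exact Finset.sum_congr rfl fun r _ => ih _

theorem exists_geometric_le_one {B N : ℝ} (hB : 1 ≤ B) (hN : 1 ≤ N) :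
    ∃ k : ℕ, (k : ℝ) ≤ 4 * N * Real.log B + 1 ∧ B * (1 - 1 / (4 * N)) ^ k ≤ 1 := by
  have hN0 : 0 < N := by linarith
  have hB0 : 0 < B := by linarith
  have hle : 1 / (4 * N) ≤ 1 := by
    rw [div_le_one (by positivity)]; linarith
  have hlog : 0 ≤ 4 * N * Real.log B := mul_nonneg (by linarith) (Real.log_nonneg hB)
  refine ⟨⌈4 * N * Real.log B⌉₊, (Nat.ceil_lt_add_one hlog).le, ?_⟩
  have hk1 : 4 * N * Real.log B ≤ ⌈4 * N * Real.log B⌉₊ := Nat.le_ceil _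
  generalize ⌈4 * N * Real.log B⌉₊ = k at hk1
  have h3 : 1 - 1 / (4 * N) ≤ Real.exp (-(1 / (4 * N))) := by
    have := Real.add_one_le_exp (-(1 / (4 * N)))
    linarith
  have h4 : (1 - 1 / (4 * N)) ^ k ≤ B⁻¹ := by
    calc _ ≤ Real.exp (-(1 / (4 * N))) ^ k := pow_le_pow_left₀ (by linarith) h3 _
      _ = Real.exp (k * -(1 / (4 * N))) := (Real.exp_nat_mul _ _).symm
      _ ≤ Real.exp (-Real.log B) := by
        apply Real.exp_le_exp.mpr
        have : Real.log B ≤ k * (1 / (4 * N)) := by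
          rw [mul_one_div, le_div_iff₀ (by positivity), mul_comm]; exact hk1
        linarith
      _ = B⁻¹ := by rw [Real.exp_neg, Real.exp_log hB0]
  calc _ ≤ B * B⁻¹ := mul_le_mul_of_nonneg_left h4 hB0.le
    _ = 1 := mul_inv_cancel₀ hB0.ne'

/-- Terms are bounded by 1 up to the cutoff where `B (1 - 1/(4N))^k` drops below 1, and by a
geometric series of sum `4N` beyond it. The prefactor `B` then enters only through `log B`, which is
the origin of the `log L` in the decoding time. -/
theorem tsum_le_of_le_geometric {a : ℕ → ℝ≥0∞} {B N : ℝ} (hB : 1 ≤ B) (hN : 1 ≤ N)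
    (h1 : ∀ k, a k ≤ 1) (h2 : ∀ k, a k ≤ ENNReal.ofReal (B * (1 - 1 / (4 * N)) ^ k)) :
    ∑' k, a k ≤ ENNReal.ofReal (4 * N * Real.log B + 1 + 4 * N) := by
  obtain ⟨k₀, hk, hBq⟩ := exists_geometric_le_one hB hN
  have hN0 : 0 < N := by linarith
  have hle : 1 / (4 * N) ≤ 1 := by
    rw [div_le_one (by positivity)]; linarith
  have hpos : 0 < 1 / (4 * N) := by positivity
  have hs : (1 - (1 - 1 / (4 * N)))⁻¹ = 4 * N := by simp
  have hq0 : 0 ≤ 1 - 1 / (4 * N) := by linarith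
  have hq1 : 1 - 1 / (4 * N) < 1 := by linarith
  generalize 1 - 1 / (4 * N) = q at *
  have h5 : ∑ i ∈ Finset.range k₀, a i ≤ ENNReal.ofReal k₀ := by
    calc _ ≤ ∑ i ∈ Finset.range k₀, (1 : ℝ≥0∞) := Finset.sum_le_sum fun i _ => h1 i
      _ = _ := by simp
  have h6 : ∑' i, a (i + k₀) ≤ ENNReal.ofReal (4 * N) := by
    calc _ ≤ ∑' i, ENNReal.ofReal (q ^ i) := ENNReal.tsum_le_tsum fun i => by
          refine (h2 _).trans (ENNReal.ofReal_le_ofReal ?_)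
          rw [pow_add, mul_comm (q ^ i), ← mul_assoc]
          exact mul_le_of_le_one_left (pow_nonneg hq0 _) hBq
      _ = ENNReal.ofReal (∑' i, q ^ i) := (ENNReal.ofReal_tsum_of_nonneg
          (fun i => pow_nonneg hq0 i) (summable_geometric_of_lt_one hq0 hq1)).symm
      _ = _ := by rw [tsum_geometric_of_lt_one hq0 hq1, hs]
  calc ∑' k, a k = ∑ i ∈ Finset.range k₀, a i + ∑' i, a (i + k₀) :=
        (ENNReal.summable.sum_add_tsum_nat_add' ).symm
    _ ≤ ENNReal.ofReal k₀ + ENNReal.ofReal (4 * N) := add_le_add h5 h6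
    _ = ENNReal.ofReal (k₀ + 4 * N) := (ENNReal.ofReal_add (by positivity) (by positivity)).symm
    _ ≤ _ := ENNReal.ofReal_le_ofReal (by linarith)

section Proposals

variable {Λ : Type*}

/-- The sites of the first `k` proposed updates, the latest one first. -/
def hist (ω : ℕ → ℝ × Λ) : ℕ → List Λ
  | 0 => []
  | k + 1 => (ω k).2 :: hist ω k

theorem hist_congr {ω ω' : ℕ → ℝ × Λ} {k : ℕ} (h : ∀ j < k, (ω j).2 = (ω' j).2) :
    hist ω k = hist ω' k := by
  induction k with
  | zero => rfl
  | succ k ih =>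
    simp only [hist, h k (Nat.lt_succ_self k), ih fun j hj => h j (hj.trans (Nat.lt_succ_self k))]

variable [Fintype Λ] [Nonempty Λ] [MeasurableSpace Λ] [MeasurableSingletonClass Λ]

/-- The law of independent proposed updates. -/
def proposalLaw {rate : ℝ} (hr : 0 < rate) : Measure (ℕ → ℝ × Λ) :=
  haveI := isProbabilityMeasure_expMeasure hr
  Measure.infinitePi fun _ : ℕ => (expMeasure rate).prod (PMF.uniformOfFintype Λ).toMeasure

variable {rate : ℝ} (hr : 0 < rate)

instance : IsProbabilityMeasure (proposalLaw (Λ := Λ) hr) := by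
  have := isProbabilityMeasure_expMeasure hr
  unfold proposalLaw
  infer_instance

/-- No σ-algebra on lists is used: the function factors through the finite set of sequences of `k`
sites, where everything is measurable. -/
theorem measurable_hist (G : List Λ → ℝ≥0∞) (k : ℕ) :
    Measurable fun ω : ℕ → ℝ × Λ => G (hist ω k) := by
  let z₀ : Λ := Classical.arbitrary Λ
  let H : (Finset.range k → Λ) → ℝ≥0∞ := fun z =>
    G (hist (fun j => if h : j ∈ Finset.range k then ((0 : ℝ), z ⟨j, h⟩) else (0, z₀)) k)
  have : (fun ω : ℕ → ℝ × Λ => G (hist ω k)) = H ∘ fun ω i => (ω i).2 := by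
    funext ω
    simp only [Function.comp, H]
    congr 1
    refine hist_congr fun j hj => ?_
    simp [hj]
  rw [this]
  exact (measurable_of_finite H).comp (by fun_prop)

/-- The history `hist ω k` involves only the proposals with index below `k`, which are independent
of proposal `k`. -/
theorem lintegral_hist_mul (G : List Λ → ℝ≥0∞) (k : ℕ) {φ : ℝ × Λ → ℝ≥0∞} (hφ : Measurable φ) :
    ∫⁻ ω, G (hist ω k) * φ (ω k) ∂(proposalLaw hr) =
      (∫⁻ ω, G (hist ω k) ∂(proposalLaw hr)) *
        ∫⁻ y, φ y ∂((expMeasure rate).prod (PMF.uniformOfFintype Λ).toMeasure) := by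
  have := isProbabilityMeasure_expMeasure hr
  let z₀ : Λ := Classical.arbitrary Λ
  let H : (Finset.range k → ℝ × Λ) → ℝ≥0∞ := fun z =>
    G (hist (fun j => if h : j ∈ Finset.range k then z ⟨j, h⟩ else (0, z₀)) k)
  have hH : (fun ω : ℕ → ℝ × Λ => G (hist ω k)) = H ∘ fun ω i => ω i := by
    funext ω
    simp only [Function.comp, H]
    congr 1
    refine hist_congr fun j hj => ?_
    simp [hj]
  have hHm : Measurable H := by
    refine (measurable_hist G k).comp (measurable_pi_lambda _ fun j => ?_)
    by_cases h : j ∈ Finset.range k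
    · simp only [h, dif_pos]; fun_prop
    · simp only [h, dif_neg, not_false_iff]; fun_prop
  have ind : IndepFun (fun ω (i : Finset.range k) => ω i) (fun ω (i : ({k} : Finset ℕ)) => ω i)
      (proposalLaw (Λ := Λ) hr) := by
    refine iIndepFun.indepFun_finset (f := fun i (ω : ℕ → ℝ × Λ) => ω i) _ _ (by simp) ?_
      (fun i => by fun_prop)
    exact iIndepFun_infinitePi (X := fun _ y => y) (fun _ => measurable_id)
  have hψ : Measurable fun y : ({k} : Finset ℕ) → ℝ × Λ =>
      φ (y ⟨k, Finset.mem_singleton_self k⟩) := hφ.comp (measurable_pi_apply _)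
  have ind2 := ind.comp hHm hψ
  have h1 := lintegral_mul_eq_lintegral_mul_lintegral_of_indepFun
    (hHm.comp (by fun_prop)) (hφ.comp (measurable_pi_apply k)) ind2
  rw [← hH] at h1
  refine h1.trans ?_
  congr 1
  have mp := measurePreserving_eval_infinitePi
    (fun _ : ℕ => (expMeasure rate).prod (PMF.uniformOfFintype Λ).toMeasure) k
  exact mp.lintegral_comp hφ

open Classical in
theorem lintegral_site_eq {rate : ℝ} (hr : 0 < rate) (r : Λ) :
    ∫⁻ y, (if y.2 = r then 1 else 0) ∂((expMeasure rate).prod (PMF.uniformOfFintype Λ).toMeasure) =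
      (Fintype.card Λ : ℝ≥0∞)⁻¹ := by
  have := isProbabilityMeasure_expMeasure hr
  have h1 : (fun y : ℝ × Λ => if y.2 = r then (1 : ℝ≥0∞) else 0) =
      (Set.univ ×ˢ {r}).indicator 1 := by
    funext y
    by_cases h : y.2 = r <;> simp [h, Set.indicator]
  rw [h1, lintegral_indicator_one (by measurability), Measure.prod_prod, measure_univ, one_mul,
    PMF.toMeasure_apply_singleton _ _ (by measurability), PMF.uniformOfFintype_apply]

theorem lintegral_waiting_eq {rate : ℝ} (hr : 0 < rate) :
    ∫⁻ y, ENNReal.ofReal y.1 ∂((expMeasure rate).prod (PMF.uniformOfFintype Λ).toMeasure) =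
      ENNReal.ofReal rate⁻¹ := by
  have := isProbabilityMeasure_expMeasure hr
  have h := (measurePreserving_fst (μ := expMeasure rate)
    (ν := (PMF.uniformOfFintype Λ).toMeasure)).lintegral_comp (f := fun x => ENNReal.ofReal x)
    (by fun_prop)
  exact h.trans (lintegral_ofReal_expMeasure hr)

/-- Translates expectations over random proposals into the counting sums `sumSeq`: all site
sequences of length `k` are equally likely. -/
theorem lintegral_hist (G : List Λ → ℝ≥0∞) (k : ℕ) :
    (Fintype.card Λ : ℝ≥0∞) ^ k * ∫⁻ ω, G (hist ω k) ∂(proposalLaw hr) = sumSeq k G [] := by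
  classical
  induction k generalizing G with
  | zero => simp [hist, sumSeq]
  | succ k ih =>
    have h1 : ∀ ω : ℕ → ℝ × Λ, G (hist ω (k + 1)) =
        ∑ r, G (r :: hist ω k) * (if (ω k).2 = r then 1 else 0) := by
      intro ω
      simp [hist]
    have hm : ∀ r : Λ, Measurable fun y : ℝ × Λ => if y.2 = r then (1 : ℝ≥0∞) else 0 := fun r =>
      Measurable.ite (measurable_snd (measurableSet_singleton r)) measurable_const measurable_const
    simp only [h1]
    have hm2 : ∀ r ∈ Finset.univ, Measurable fun ω : ℕ → ℝ × Λ =>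
        G (r :: hist ω k) * (if (ω k).2 = r then 1 else 0) := fun r _ =>
      (measurable_hist (fun l => G (r :: l)) k).mul ((hm r).comp (measurable_pi_apply k))
    rw [lintegral_finsetSum _ hm2]
    have h2 : ∀ r, ∫⁻ ω, G (r :: hist ω k) * (if (ω k).2 = r then 1 else 0) ∂(proposalLaw hr) =
        (∫⁻ ω, G (r :: hist ω k) ∂(proposalLaw hr)) * (Fintype.card Λ : ℝ≥0∞)⁻¹ := fun r => by
      rw [lintegral_hist_mul hr (fun l => G (r :: l)) k (hm r), lintegral_site_eq hr]
    simp only [h2]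
    rw [sumSeq_succ', ← ih, lintegral_finsetSum _ fun r _ => measurable_hist (fun l => G (r :: l)) k,
      ← Finset.sum_mul, pow_succ, mul_comm _ (Fintype.card Λ : ℝ≥0∞)⁻¹, mul_assoc, ← mul_assoc _ _⁻¹,
      ENNReal.mul_inv_cancel (by simp [Fintype.card_ne_zero]) (by simp), one_mul]

/-- The expected total waiting time spent in histories with a given property. -/
theorem lintegral_tsum_waiting (P : List Λ → Prop) [DecidablePred P] :
    ∫⁻ ω, ∑' k, (if P (hist ω k) then 1 else 0) * ENNReal.ofReal (ω k).1 ∂(proposalLaw hr) =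
      ENNReal.ofReal rate⁻¹ *
        ∑' k, ENNReal.ofReal (sumSeq k (fun l => if P l then (1 : ℝ) else 0) [] /
          (Fintype.card Λ : ℝ) ^ k) := by
  have hN : (Fintype.card Λ : ℝ≥0∞) ≠ 0 := by simp [Fintype.card_ne_zero]
  have hm : ∀ k, Measurable fun ω : ℕ → ℝ × Λ => if P (hist ω k) then (1 : ℝ≥0∞) else 0 :=
    measurable_hist fun l => if P l then 1 else 0
  have hm2 : ∀ k, AEMeasurable (fun ω : ℕ → ℝ × Λ =>
      (if P (hist ω k) then 1 else 0) * ENNReal.ofReal (ω k).1) (proposalLaw hr) := fun k =>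
    ((hm k).mul (g := fun ω => ENNReal.ofReal (ω k).1) (by fun_prop)).aemeasurable
  rw [lintegral_tsum hm2, ← ENNReal.tsum_mul_left]
  refine tsum_congr fun k => ?_
  rw [lintegral_hist_mul hr (fun l => if P l then 1 else 0) k (φ := fun y => ENNReal.ofReal y.1)
    (by fun_prop), lintegral_waiting_eq hr, mul_comm]
  congr 1
  have h := lintegral_hist hr (fun l => if P l then 1 else 0) k
  have hN' : (0 : ℝ) < Fintype.card Λ := by exact_mod_cast Fintype.card_pos (α := Λ)
  rw [ENNReal.ofReal_div_of_pos (by positivity), ofReal_sumSeq fun l => by split_ifs <;> norm_num,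
    ENNReal.eq_div_iff]
  · rw [ENNReal.ofReal_pow hN'.le, ENNReal.ofReal_natCast, h]
    congr 1
    funext l
    split_ifs <;> simp
  · simp only [ne_eq, ENNReal.ofReal_eq_zero, not_le]; positivity
  · simp

theorem lintegral_hist_prop (P : List Λ → Prop) [DecidablePred P] (k : ℕ) :
    ∫⁻ ω, (if P (hist ω k) then 1 else 0) ∂(proposalLaw hr) =
      ENNReal.ofReal (sumSeq k (fun l => if P l then (1 : ℝ) else 0) [] /
          (Fintype.card Λ : ℝ) ^ k) := by
  have h := lintegral_hist hr (fun l => if P l then 1 else 0) k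
  have hN : (Fintype.card Λ : ℝ≥0∞) ≠ 0 := by simp [Fintype.card_ne_zero]
  have hN' : (0 : ℝ) < Fintype.card Λ := by exact_mod_cast Fintype.card_pos (α := Λ)
  rw [ENNReal.ofReal_div_of_pos (by positivity), ofReal_sumSeq fun l => by split_ifs <;> norm_num,
    ENNReal.eq_div_iff]
  · rw [ENNReal.ofReal_pow hN'.le, ENNReal.ofReal_natCast, h]
    congr 1
    funext l
    split_ifs <;> simp
  · simp only [ne_eq, ENNReal.ofReal_eq_zero, not_le]; positivity
  · simp

theorem ae_waiting_nonneg : ∀ᵐ ω ∂(proposalLaw (Λ := Λ) hr), ∀ k, 0 ≤ (ω k).1 := by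
  have := isProbabilityMeasure_expMeasure hr
  rw [ae_all_iff]
  intro k
  have mp := measurePreserving_eval_infinitePi
    (fun _ : ℕ => (expMeasure rate).prod (PMF.uniformOfFintype Λ).toMeasure) k
  have mp2 := (measurePreserving_fst (μ := expMeasure rate)
    (ν := (PMF.uniformOfFintype Λ).toMeasure)).comp mp
  exact mp2.quasiMeasurePreserving.ae (ae_nonneg_expMeasure rate)

variable [DecidableEq Λ] (ngb : Λ → Finset Λ)

theorem heights_hist_mono (ω : ℕ → ℝ × Λ) (r : Λ) : Monotone fun k => heights ngb (hist ω k) r :=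
  monotone_nat_of_le_succ fun _ => le_advance ngb _ _ _

variable {d : ℕ}

open Classical in
theorem tsum_lagging_le (n : ℕ) (hd : 1 ≤ d) (hcard : ∀ r, (ngb r).card ≤ d)
    (hsymm : ∀ r r', r' ∈ ngb r → r ∈ ngb r') :
    ∑' k, ENNReal.ofReal (sumSeq k (fun l => if Lagging ngb n l then (1 : ℝ) else 0) [] /
      (Fintype.card Λ : ℝ) ^ k) ≤
    ENNReal.ofReal (Fintype.card Λ *
      (4 * (Real.log (Fintype.card Λ) + n * Real.log (2 * d)) + 5)) := by
  have hN : (1 : ℝ) ≤ Fintype.card Λ := by exact_mod_cast Fintype.card_pos (α := Λ)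
  have hd' : (1 : ℝ) ≤ d := by exact_mod_cast hd
  have hN0 : (0 : ℝ) < Fintype.card Λ := by linarith
  -- `B` is the prefactor in `sumSeq_lagging_le`, so `log B = log N + n log (2d)`. The remaining `1
  -- + 4N` is at most `5N`.
  refine (tsum_le_of_le_geometric (B := Fintype.card Λ * (2 * d : ℝ) ^ n) (N := Fintype.card Λ)
    ?_ hN ?_ ?_).trans (ENNReal.ofReal_le_ofReal ?_)
  · have : (1 : ℝ) ≤ (2 * d : ℝ) ^ n := one_le_pow₀ (by linarith)
    nlinarith
  · intro k
    rw [ENNReal.ofReal_le_one, div_le_one (by positivity)]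
    refine (sumSeq_le (g' := fun _ => 1) (fun l => by split_ifs <;> norm_num) []).trans ?_
    rw [sumSeq_const]; simp
  · intro k
    refine ENNReal.ofReal_le_ofReal ?_
    rw [div_le_iff₀ (by positivity), mul_assoc, ← mul_pow]
    refine (sumSeq_lagging_le ngb hd hcard hsymm n k).trans (le_of_eq ?_)
    congr 2
    field_simp
  · rw [Real.log_mul (by positivity) (by positivity), Real.log_pow]
    nlinarith

open Classical in
theorem lintegral_lagging_le (n : ℕ) (hd : 1 ≤ d) (hcard : ∀ r, (ngb r).card ≤ d)
    (hsymm : ∀ r r', r' ∈ ngb r → r ∈ ngb r') :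
    ∫⁻ ω, ∑' k, (if Lagging ngb n (hist ω k) then 1 else 0) * ENNReal.ofReal (ω k).1
        ∂(proposalLaw hr) ≤
      ENNReal.ofReal (Fintype.card Λ / rate *
        (4 * (Real.log (Fintype.card Λ) + n * Real.log (2 * d)) + 5)) := by
  rw [lintegral_tsum_waiting hr]
  refine (mul_le_mul_right (tsum_lagging_le ngb n hd hcard hsymm) _).trans (le_of_eq ?_)
  rw [← ENNReal.ofReal_mul (by positivity)]
  congr 1
  ring

/-- The expected number of lagging prefixes is finite, so almost surely only finitely many prefixes
lag. -/
theorem ae_exists_not_lagging (hd : 1 ≤ d) (hcard : ∀ r, (ngb r).card ≤ d)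
    (hsymm : ∀ r r', r' ∈ ngb r → r ∈ ngb r') :
    ∀ᵐ ω ∂(proposalLaw (Λ := Λ) hr), ∀ n, ∃ k, ¬ Lagging ngb n (hist ω k) := by
  classical
  rw [ae_all_iff]
  intro n
  have hm : ∀ k, Measurable fun ω : ℕ → ℝ × Λ =>
      if Lagging ngb n (hist ω k) then (1 : ℝ≥0∞) else 0 :=
    measurable_hist fun l => if Lagging ngb n l then 1 else 0
  have h1 : ∫⁻ ω, ∑' k, (if Lagging ngb n (hist ω k) then (1 : ℝ≥0∞) else 0)
      ∂(proposalLaw (Λ := Λ) hr) ≠ ∞ := by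
    rw [lintegral_tsum fun k => (hm k).aemeasurable]
    simp only [lintegral_hist_prop hr]
    exact ne_top_of_le_ne_top ENNReal.ofReal_ne_top (tsum_lagging_le ngb n hd hcard hsymm)
  filter_upwards [ae_lt_top (Measurable.tsum hm) h1] with ω hω
  by_contra h
  push Not at h
  simp [h] at hω

open Classical in
theorem le_lintegral_heights_lt (r : Λ) {m : ℕ} (hm : 0 < m) :
    ENNReal.ofReal (Fintype.card Λ / rate * (m / 2)) ≤
      ∫⁻ ω, ∑' k, (if heights ngb (hist ω k) r < m then 1 else 0) * ENNReal.ofReal (ω k).1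
        ∂(proposalLaw hr) := by
  rw [lintegral_tsum_waiting hr fun l => heights ngb l r < m]
  have hN0 : (0 : ℝ) < Fintype.card Λ := by exact_mod_cast Fintype.card_pos (α := Λ)
  have hm' : (0 : ℝ) < m := by exact_mod_cast hm
  -- The lower bound `1 - k/(N m)` on the probability that `r` has height below `m` is nonnegative
  -- up to `K = N m` proposals; summed up to there it is at least `K/2`.
  set K := Fintype.card Λ * m with hK
  have hK' : (K : ℝ) = Fintype.card Λ * m := by rw [hK]; push_cast; rfl
  have hK0 : (0 : ℝ) < K := by rw [hK']; positivity
  have h1 : ∀ k ∈ Finset.range K, ENNReal.ofReal (1 - k / K) ≤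
      ENNReal.ofReal (sumSeq k (fun l => if heights ngb l r < m then (1 : ℝ) else 0) [] /
        (Fintype.card Λ : ℝ) ^ k) := by
    intro k _
    refine ENNReal.ofReal_le_ofReal ?_
    rw [le_div_iff₀ (by positivity), mul_comm, hK']
    exact le_sumSeq_heights_lt ngb r hm k
  have h2 : (K : ℝ) / 2 ≤ ∑ k ∈ Finset.range K, (1 - (k : ℝ) / K) := by
    have h3 : ∀ n : ℕ, ∑ k ∈ Finset.range n, (1 - (k : ℝ) / K) = n - n * (n - 1) / 2 / K := by
      intro n
      induction n with
      | zero => simp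
      | succ n ih => rw [Finset.sum_range_succ, ih]; push_cast; field_simp; ring
    rw [h3]
    field_simp
    linarith
  calc ENNReal.ofReal (Fintype.card Λ / rate * (m / 2))
      = ENNReal.ofReal rate⁻¹ * ENNReal.ofReal (K / 2) := by
        rw [← ENNReal.ofReal_mul (by positivity), hK']; congr 1; ring
    _ ≤ ENNReal.ofReal rate⁻¹ * ∑ k ∈ Finset.range K, ENNReal.ofReal (1 - k / K) := by
        gcongr
        rw [← ENNReal.ofReal_sum_of_nonneg]
        · exact ENNReal.ofReal_le_ofReal h2
        · intro k hk
          rw [sub_nonneg, div_le_one hK0]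
          exact_mod_cast (Finset.mem_range.mp hk).le
    _ ≤ _ := by
        gcongr
        exact (Finset.sum_le_sum h1).trans (ENNReal.sum_le_tsum _)

end Proposals

end

section

/-! ## Averages over a Poisson distribution -/

/-- A Poisson law of parameter `s` leaves every finite set as `s → ∞`. Terms with `k < K` therefore
vanish in the limit, and the others are within `ε/2` of `ℓ`. -/
theorem tendsto_poisson_average {a : ℕ → ℂ} {ℓ : ℂ} (ha : Tendsto a atTop (𝓝 ℓ)) :
    Tendsto (fun s : ℝ => Complex.exp (-s) * ∑' k : ℕ, (s ^ k / k.factorial : ℂ) * a k) atTop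
      (𝓝 ℓ) := by
  obtain ⟨A, hA⟩ : ∃ A, ∀ k, ‖a k - ℓ‖ ≤ A := by
    have h1 : Tendsto (fun k => ‖a k - ℓ‖) atTop (𝓝 0) := by
      rw [← tendsto_iff_norm_sub_tendsto_zero]; exact ha
    obtain ⟨A, hA⟩ := h1.bddAbove_range
    exact ⟨A, fun k => hA ⟨k, rfl⟩⟩
  have hA0 : 0 ≤ A := (norm_nonneg _).trans (hA 0)
  rw [Metric.tendsto_atTop]
  intro ε hε
  obtain ⟨K, hK⟩ := Metric.tendsto_atTop.mp ha (ε / 2) (half_pos hε)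
  have h2 : Tendsto (fun s : ℝ => ∑ k ∈ Finset.range K, A * (s ^ k * Real.exp (-s)) / k.factorial)
      atTop (𝓝 0) := by
    have : (0 : ℝ) = ∑ k ∈ Finset.range K, A * 0 / k.factorial := by simp
    rw [this]
    exact tendsto_finsetSum _ fun k _ =>
      ((Real.tendsto_pow_mul_exp_neg_atTop_nhds_zero k).const_mul A).div_const _
  obtain ⟨S, hS⟩ := (((tendsto_order.mp h2).2 _ (half_pos hε)).and
    (eventually_ge_atTop 0)).exists_forall_of_atTop
  refine ⟨S, fun s hs => ?_⟩
  obtain ⟨h3, hs0⟩ := hS s hs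
  have hexpR : HasSum (fun k : ℕ => s ^ k / k.factorial) (Real.exp s) := by
    rw [Real.exp_eq_exp_ℝ]; exact NormedSpace.expSeries_div_hasSum_exp s
  have hexp : HasSum (fun k : ℕ => (s ^ k / k.factorial : ℂ)) (Complex.exp s) := by
    have := (Complex.hasSum_ofReal (L := .unconditional ℕ)).mpr hexpR
    simpa using this
  have hn : ∀ k, ‖(s ^ k / k.factorial : ℂ) * (a k - ℓ)‖ ≤
      s ^ k / k.factorial * A := by
    intro k
    rw [norm_mul]
    have : ‖(s ^ k / k.factorial : ℂ)‖ = s ^ k / k.factorial := by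
      simp [abs_of_nonneg hs0]
    rw [this]
    exact mul_le_mul_of_nonneg_left (hA k) (by positivity)
  have hsum : Summable fun k : ℕ => (s ^ k / k.factorial : ℂ) * (a k - ℓ) :=
    Summable.of_norm_bounded (hexpR.summable.mul_right A) hn
  have h4 : ∑' k : ℕ, (s ^ k / k.factorial : ℂ) * a k =
      ∑' k : ℕ, (s ^ k / k.factorial : ℂ) * (a k - ℓ) + Complex.exp s * ℓ := by
    rw [← (hexp.mul_right ℓ).tsum_eq, ← hsum.tsum_add (hexp.mul_right ℓ).summable]
    exact tsum_congr fun k => by ring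
  have h5 : Complex.exp (-s) * Complex.exp s = 1 := by rw [← Complex.exp_add]; simp
  rw [dist_eq_norm, h4, mul_add, ← mul_assoc, h5, one_mul, add_sub_cancel_right, norm_mul]
  have h6 : ‖Complex.exp (-(s : ℂ))‖ = Real.exp (-s) := by
    rw [Complex.norm_exp]; simp
  rw [h6]
  have h7 : ‖∑' k : ℕ, (s ^ k / k.factorial : ℂ) * (a k - ℓ)‖ ≤
      ∑ k ∈ Finset.range K, A * s ^ k / k.factorial + Real.exp s * (ε / 2) := by
    have h8 : HasSum (fun k => if k ∈ Finset.range K then A * s ^ k / k.factorial else 0)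
        (∑ k ∈ Finset.range K, A * s ^ k / k.factorial) := by
      have := hasSum_sum_of_ne_finset_zero (s := Finset.range K) (L := .unconditional ℕ)
        (f := fun k => if k ∈ Finset.range K then A * s ^ k / k.factorial else 0)
        (fun k hk => if_neg hk)
      rwa [Finset.sum_congr rfl fun k hk => if_pos hk] at this
    refine tsum_of_norm_bounded (h8.add (hexpR.mul_right (ε / 2))) fun k => ?_
    by_cases hk : k ∈ Finset.range K
    · rw [if_pos hk]
      have : 0 ≤ s ^ k / k.factorial * (ε / 2) := by positivity
      have h9 := hn k
      have h12 : s ^ k / k.factorial * A = A * s ^ k / k.factorial := by ring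
      linarith
    · rw [if_neg hk, zero_add, norm_mul]
      have : ‖(s ^ k / k.factorial : ℂ)‖ = s ^ k / k.factorial := by
        simp [abs_of_nonneg hs0]
      rw [this]
      have h9 := hK k (by simpa using hk)
      rw [dist_eq_norm] at h9
      exact mul_le_mul_of_nonneg_left h9.le (by positivity)
  have h10 : Real.exp (-s) * Real.exp s = 1 := by rw [← Real.exp_add]; simp
  have h11 : Real.exp (-s) * ∑ k ∈ Finset.range K, A * s ^ k / k.factorial =
      ∑ k ∈ Finset.range K, A * (s ^ k * Real.exp (-s)) / k.factorial := by
    rw [Finset.mul_sum]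
    exact Finset.sum_congr rfl fun k _ => by ring
  calc _ ≤ Real.exp (-s) * (∑ k ∈ Finset.range K, A * s ^ k / k.factorial +
          Real.exp s * (ε / 2)) := mul_le_mul_of_nonneg_left h7 (Real.exp_pos _).le
    _ = ∑ k ∈ Finset.range K, A * (s ^ k * Real.exp (-s)) / k.factorial + ε / 2 := by
        rw [mul_add, h11, ← mul_assoc, h10, one_mul]
    _ < ε := by linarith

/-- The exponential series of `(Φ - N)/μ`, tested against a linear functional. -/
theorem hasSum_exp_series {V : Type*} [AddCommGroup V] [Module ℂ V] (Φ : Module.End ℂ V)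
    (f : V →ₗ[ℂ] ℂ) (x : V) {N B μ : ℝ} (hb : ∀ k, ‖f ((Φ ^ k) x)‖ ≤ B * N ^ k)
    (t : ℝ) :
    HasSum (fun k : ℕ => (t ^ k / k.factorial : ℂ) *
        f ((((μ : ℂ)⁻¹ • (Φ - (N : ℂ) • (1 : Module.End ℂ V))) ^ k) x))
      (Complex.exp (-(N * t / μ : ℝ)) *
        ∑' k : ℕ, ((t / μ : ℂ) ^ k / k.factorial) * f ((Φ ^ k) x)) := by
  set z : ℂ := -(N * t / μ : ℝ) with hz
  have hs1 : Summable fun k : ℕ => ‖((t / μ : ℂ) ^ k / k.factorial) * f ((Φ ^ k) x)‖ := by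
    refine Summable.of_nonneg_of_le (fun _ => norm_nonneg _) (fun k => ?_)
      ((Real.summable_pow_div_factorial (|t / μ| * N)).mul_left B)
    rw [norm_mul]
    have : ‖((t / μ : ℂ) ^ k / k.factorial)‖ = |t / μ| ^ k / k.factorial := by
      rw [norm_div, norm_pow, ← Complex.ofReal_div, Complex.norm_real, Real.norm_eq_abs]
      simp
    rw [this, mul_pow]
    calc _ ≤ |t / μ| ^ k / k.factorial * (B * N ^ k) :=
          mul_le_mul_of_nonneg_left (hb k) (by positivity)
      _ = _ := by ring
  have hs2 : Summable fun k : ℕ => ‖z ^ k / k.factorial‖ :=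
    NormedSpace.norm_expSeries_div_summable z
  -- Cauchy product of the series of `e^(tΦ/μ)`, tested against `f`, with that of `e^(-Nt/μ)`. Since
  -- the identity commutes with `Φ`, the binomial theorem identifies its terms with those of the
  -- series of `(Φ - N)/μ`.
  have h := hasSum_sum_range_mul_of_summable_norm hs1 hs2
  have hexp : ∑' k : ℕ, z ^ k / k.factorial = Complex.exp z := by
    rw [Complex.exp_eq_exp_ℂ]
    exact (NormedSpace.expSeries_div_hasSum_exp z).tsum_eq
  rw [hexp, mul_comm] at h
  refine (congrArg₂ (fun g y => HasSum g y) (funext fun k => ?_) rfl).mpr h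
  have hsm : (((μ : ℂ)⁻¹ • (Φ - (N : ℂ) • (1 : Module.End ℂ V))) ^ k) x =
      ∑ m ∈ Finset.range (k + 1),
        ((μ : ℂ)⁻¹ ^ k * (-(N : ℂ)) ^ (k - m) * (k.choose m : ℂ)) • (Φ ^ m) x := by
    have hc : Commute Φ ((-(N : ℂ)) • (1 : Module.End ℂ V)) := (Commute.one_right Φ).smul_right _
    rw [sub_eq_add_neg, ← neg_smul, smul_pow, hc.add_pow, LinearMap.smul_apply,
      LinearMap.sum_apply, Finset.smul_sum]
    refine Finset.sum_congr rfl fun m _ => ?_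
    rw [smul_pow, one_pow, mul_smul_comm, mul_one, smul_mul_assoc, ← nsmul_eq_mul']
    simp only [LinearMap.smul_apply, ← Nat.cast_smul_eq_nsmul ℂ, smul_smul, mul_assoc]
  rw [hsm, map_sum, Finset.mul_sum]
  refine Finset.sum_congr rfl fun m hm => ?_
  have hmk : m ≤ k := Nat.lt_succ_iff.mp (Finset.mem_range.mp hm)
  obtain ⟨j, rfl⟩ := Nat.exists_eq_add_of_le hmk
  rw [map_smul, smul_eq_mul, Nat.add_sub_cancel_left, hz, Nat.cast_add_choose]
  have h1 : ((m + j).factorial : ℂ) ≠ 0 := by exact_mod_cast (m + j).factorial_ne_zero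
  push_cast
  field_simp
  rw [show (-((N : ℂ) * t / μ)) = t * (1 / μ) * (-N) by ring,
    show (t / μ : ℂ) = t * (1 / μ) by ring]
  simp only [mul_pow, pow_add]
  ring

/-! ## Continuity of the trace norm -/

open scoped Matrix.Norms.L2Operator in
-- The sum of singular values is the trace of `√(AᴴA)`, and the continuous functional calculus
-- depends continuously on the matrix. This avoids following individual eigenvalues.
theorem continuous_traceNorm {n : Type*} [Fintype n] [DecidableEq n] :
    Continuous (traceNorm : Matrix n n ℂ → ℝ) := by
  have h1 : (traceNorm : Matrix n n ℂ → ℝ) = fun A => (cfc Real.sqrt (Aᴴ * A)).trace.re := by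
    funext A
    have hA := Matrix.isHermitian_conjTranspose_mul_self A
    rw [hA.cfc_eq, Matrix.IsHermitian.cfc, Unitary.conjStarAlgAut_apply, Matrix.trace_mul_comm,
      ← mul_assoc]
    simp [Matrix.trace, traceNorm]
  have h2 : Continuous fun A : Matrix n n ℂ => cfc Real.sqrt (Aᴴ * A) :=
    Continuous.cfc_of_mem_nhdsSet (s := Set.univ) Real.sqrt (by simp) (by fun_prop)
      (fun A => Matrix.isHermitian_conjTranspose_mul_self A) Real.continuous_sqrt.continuousOn
  rw [h1]
  exact Complex.continuous_re.comp h2.matrix_trace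

end

section

variable {D L : ℕ}

/-! ## Operators with disjoint supports -/

theorem SupportedOn.commute [NeZero L] {S T : Set (Link D L)} {A B : QMat D L}
    (hA : SupportedOn S A) (hB : SupportedOn T B) (hST : Disjoint S T) : Commute A B := by
  classical
  -- Only one intermediate basis vector survives in the matrix product: `A` can change it only in
  -- `S` and `B` only in `T`, so it equals `b` on `S` and `a` elsewhere.
  have key : ∀ {S T : Set (Link D L)} {A B : QMat D L}, SupportedOn S A → SupportedOn T B →
      Disjoint S T → ∀ a b, (A * B) a b =
        A a (fun l => if l ∈ S then b l else a l) * B (fun l => if l ∈ S then b l else a l) b := by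
    intro S T A B hA hB hST a b
    rw [Matrix.mul_apply]
    refine Finset.sum_eq_single _ (fun c _ hc => ?_) (fun h => absurd (Finset.mem_univ _) h)
    obtain ⟨l, hl⟩ := Function.ne_iff.mp hc
    by_cases hS : l ∈ S
    · rw [if_pos hS] at hl
      rw [hB.1 c b ⟨l, Set.disjoint_left.mp hST hS, hl⟩, mul_zero]
    · rw [if_neg hS] at hl
      rw [hA.1 a c ⟨l, hS, Ne.symm hl⟩, zero_mul]
  ext a b
  rw [key hA hB hST, key hB hA hST.symm]
  by_cases hab : ∃ l, l ∉ S ∧ l ∉ T ∧ a l ≠ b l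
  · obtain ⟨l, hS, hT, hl⟩ := hab
    rw [hB.1 _ b ⟨l, hT, by simpa [hS] using hl⟩, hA.1 _ b ⟨l, hS, by simpa [hT] using hl⟩]
    ring
  · push Not at hab
    rw [mul_comm]
    congr 1
    · refine hB.2 _ _ _ _ (fun l hl => ?_) fun l hl => ?_
      · have : l ∉ S := fun h => Set.disjoint_left.mp hST h hl
        simp [hl, this]
      · by_cases hS : l ∈ S
        · simp [hl, hS]
        · simp [hl, hS, hab l hS hl]
    · refine hA.2 _ _ _ _ (fun l hl => ?_) fun l hl => ?_
      · have : l ∉ T := fun h => Set.disjoint_left.mp hST hl h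
        simp [hl, this]
      · by_cases hT : l ∈ T
        · simp [hl, hT]
        · simp [hl, hT, hab l hl hT]

theorem mem_ball_comm {r r' : Site D L} {k : ℕ} : r' ∈ ball r k ↔ r ∈ ball r' k := by
  have : torusDist r r' = torusDist r' r := by
    rw [← torusDist_zero_sub r r']
    unfold torusDist
    simp
  simp only [ball, Set.mem_ofPred_eq, this]

theorem disjoint_linksIn {r r' : Site D L} {j k : ℕ} (h : r' ∉ ball r (j + k)) :
    Disjoint (linksIn (ball r j)) (linksIn (ball r' k)) :=
  Set.disjoint_left.mpr fun _ hl hl' => h (mem_ball_add hl.1 (mem_ball_comm.mp hl'.1))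

variable [NeZero L] {Δ : ℕ}

/-! ## Pauli strings -/

theorem pauli_mul_pauli (s t : PauliLabel D L) (a b : QBasis D L) :
    (pauli s * pauli t) a b = if a = b + t.1 + s.1 then
      (-1 : ℂ) ^ (∑ l, s.2 l * (b l + t.1 l)).val * (-1 : ℂ) ^ (∑ l, t.2 l * b l).val else 0 := by
  rw [Matrix.mul_apply, Finset.sum_eq_single (b + t.1)]
  · simp only [pauli, Pi.add_apply, if_true]
    split_ifs <;> simp
  · intro c _ hc
    simp [pauli, hc]
  · simp

theorem neg_one_pow_val_add (x y : ZMod 2) :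
    (-1 : ℂ) ^ (x + y).val = (-1) ^ x.val * (-1) ^ y.val := by
  have h : (x + y).val % 2 = (x.val + y.val) % 2 := by revert x y; decide
  rw [← pow_add, neg_one_pow_eq_pow_mod_two, h, ← neg_one_pow_eq_pow_mod_two]

/-- Exchanging the factors costs the sign given by the symplectic form `s.2 · t.1 + t.2 · s.1`. -/
theorem pauli_comm_or_anticomm (s t : PauliLabel D L) :
    pauli s * pauli t = pauli t * pauli s ∨ pauli s * pauli t = -(pauli t * pauli s) := by
  have h : ∀ a b, (pauli s * pauli t) a b =
      ((-1 : ℂ) ^ (∑ l, s.2 l * t.1 l).val * (-1) ^ (∑ l, t.2 l * s.1 l).val) *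
        (pauli t * pauli s) a b := by
    intro a b
    rw [pauli_mul_pauli, pauli_mul_pauli]
    simp only [mul_add, Finset.sum_add_distrib, neg_one_pow_val_add]
    rw [show b + t.1 + s.1 = b + s.1 + t.1 by abel]
    split_ifs
    · have h1 : ((-1 : ℂ) ^ (∑ l, t.2 l * s.1 l).val) * (-1) ^ (∑ l, t.2 l * s.1 l).val = 1 := by
        rw [← mul_pow]; simp
      linear_combination (-(-1 : ℂ) ^ (∑ l, s.2 l * b l).val * (-1) ^ (∑ l, s.2 l * t.1 l).val *
        (-1) ^ (∑ l, t.2 l * b l).val) * h1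
    · simp
  rcases neg_one_pow_eq_or ℂ (∑ l, s.2 l * t.1 l).val with h1 | h1 <;>
  rcases neg_one_pow_eq_or ℂ (∑ l, t.2 l * s.1 l).val with h2 | h2 <;>
  rw [h1, h2] at h
  · exact Or.inl (by ext a b; simp [h a b])
  · exact Or.inr (by ext a b; simp [h a b])
  · exact Or.inr (by ext a b; simp [h a b])
  · exact Or.inl (by ext a b; simp [h a b])

theorem pauli_mem_unitaryGroup (s : PauliLabel D L) :
    pauli s ∈ Matrix.unitaryGroup (QBasis D L) ℂ := by
  rw [Matrix.mem_unitaryGroup_iff']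
  ext a b
  rw [Matrix.star_eq_conjTranspose, Matrix.mul_apply, Finset.sum_eq_single (b + s.1)]
  · simp only [Matrix.conjTranspose_apply, pauli, if_true, add_left_inj]
    by_cases h : a = b
    · subst h
      simp [← mul_pow]
    · have h' : ¬ b = a := fun h' => h h'.symm
      simp [h, h']
  · intro c _ hc
    simp [pauli, hc]
  · simp

/-! ## States with definite syndromes -/

namespace StabilizerCode

variable (𝒞 : StabilizerCode D L Δ)

/-- The state `ρ` has the syndromes `τ`. -/
def InSector (τ : Site D L → ℤˣ) (ρ : QMat D L) : Prop :=
  ρ.IsHermitian ∧ ∀ r, 𝒞.g r * ρ = ((τ r : ℤ) : ℂ) • ρ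

variable {𝒞} {τ : Site D L → ℤˣ} {ρ : QMat D L}

theorem InSector.mul_g (h : 𝒞.InSector τ ρ) (r : Site D L) :
    ρ * 𝒞.g r = ((τ r : ℤ) : ℂ) • ρ := by
  have h1 := congrArg Matrix.conjTranspose (h.2 r)
  rw [Matrix.conjTranspose_mul, h.1, 𝒞.hermitian r, Matrix.conjTranspose_smul, h.1] at h1
  simpa using h1

theorem unit_half_add (s t : ℤˣ) :
    (2⁻¹ : ℂ) * (1 + ((s : ℤ) : ℂ) * ((t : ℤ) : ℂ)) = if s = t then 1 else 0 := by
  rcases Int.units_eq_one_or s with rfl | rfl <;> rcases Int.units_eq_one_or t with rfl | rfl <;>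
    norm_num

theorem InSector.proj_mul (h : 𝒞.InSector τ ρ) (r : Site D L) (s : ℤˣ) :
    𝒞.proj r s * ρ = if s = τ r then ρ else 0 := by
  have h1 := unit_half_add s (τ r)
  rw [proj, smul_mul_assoc, add_mul, one_mul, smul_mul_assoc, h.2 r, smul_smul]
  nth_rw 1 [← one_smul ℂ ρ]
  rw [← add_smul, smul_smul, h1]
  split_ifs <;> simp

theorem InSector.mul_proj (h : 𝒞.InSector τ ρ) (r : Site D L) (s : ℤˣ) :
    ρ * 𝒞.proj r s = if s = τ r then ρ else 0 := by
  have h1 := unit_half_add s (τ r)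
  rw [proj, mul_smul_comm, mul_add, mul_one, mul_smul_comm, h.mul_g r, smul_smul]
  nth_rw 1 [← one_smul ℂ ρ]
  rw [← add_smul, smul_smul, h1]
  split_ifs <;> simp

open Classical in
theorem InSector.projOn_mul (h : 𝒞.InSector τ ρ) (B : Finset (Site D L)) (σ : Site D L → ℤˣ) :
    𝒞.projOn B σ * ρ = if ∀ r ∈ B, σ r = τ r then ρ else 0 := by
  -- The proof of pairwise commutation is generalized along with `B`, so that the induction
  -- hypothesis applies to the smaller set.
  suffices H : ∀ (B : Finset (Site D L))
      (hc : (B : Set (Site D L)).Pairwise (Function.onFun Commute fun r => 𝒞.proj r (σ r))),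
      B.noncommProd (fun r => 𝒞.proj r (σ r)) hc * ρ = if ∀ r ∈ B, σ r = τ r then ρ else 0 from H B _
  intro B hc
  induction B using Finset.induction_on with
  | empty => simp
  | insert a B ha ih =>
    rw [Finset.noncommProd_insert_of_notMem _ _ _ _ ha, mul_assoc, ih _]
    simp only [Finset.forall_mem_insert]
    split_ifs with h1 h2 h2
    · rw [h.proj_mul, if_pos h2.1]
    · rw [h.proj_mul, if_neg fun h3 => h2 ⟨h3, h1⟩]
    · exact absurd h2.2 h1
    · simp

open Classical in
theorem InSector.mul_projOn (h : 𝒞.InSector τ ρ) (B : Finset (Site D L)) (σ : Site D L → ℤˣ) :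
    ρ * 𝒞.projOn B σ = if ∀ r ∈ B, σ r = τ r then ρ else 0 := by
  suffices H : ∀ (B : Finset (Site D L))
      (hc : (B : Set (Site D L)).Pairwise (Function.onFun Commute fun r => 𝒞.proj r (σ r))),
      ρ * B.noncommProd (fun r => 𝒞.proj r (σ r)) hc = if ∀ r ∈ B, σ r = τ r then ρ else 0 from H B _
  intro B hc
  induction B using Finset.induction_on with
  | empty => simp
  | insert a B ha ih =>
    rw [Finset.noncommProd_insert_of_notMem' _ _ _ _ ha, ← mul_assoc, ih _]
    simp only [Finset.forall_mem_insert]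
    split_ifs with h1 h2 h2
    · rw [h.mul_proj, if_pos h2.1]
    · rw [h.mul_proj, if_neg fun h3 => h2 ⟨h3, h1⟩]
    · exact absurd h2.2 h1
    · simp

theorem InSector.anyonFree_iff (h : 𝒞.InSector τ ρ) (ht : ρ.trace = 1) :
    𝒞.AnyonFree ρ ↔ τ = 1 := by
  rw [AnyonFree, h.mul_projOn]
  split_ifs with h1
  · exact ⟨fun _ => funext fun r => (h1 r (Finset.mem_univ r)).symm, fun _ => ht⟩
  · constructor
    · intro h2; simp at h2
    · rintro rfl; exact absurd (fun _ _ => rfl) h1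

/-! ## Syndromes of operators -/

variable (𝒞) in
/-- Unitary operators which commute or anticommute with each stabilizer generator. -/
def syndromeGroup : Submonoid (QMat D L) where
  carrier := {U | U ∈ Matrix.unitaryGroup (QBasis D L) ℂ ∧ 𝒞.HasSyndrome U}
  one_mem' := ⟨one_mem _, fun _ => Or.inl (by simp)⟩
  mul_mem' := by
    rintro U V ⟨hU, hU'⟩ ⟨hV, hV'⟩
    refine ⟨mul_mem hU hV, fun r => ?_⟩
    rcases hU' r with h1 | h1 <;> rcases hV' r with h2 | h2
    · exact Or.inl (by rw [← mul_assoc, h1, mul_assoc, h2, mul_assoc])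
    · exact Or.inr (by rw [← mul_assoc, h1, mul_assoc, h2, mul_assoc, mul_neg])
    · exact Or.inr (by rw [← mul_assoc, h1, neg_mul, mul_assoc, h2, mul_assoc])
    · exact Or.inl (by rw [← mul_assoc, h1, neg_mul, mul_assoc, h2, mul_neg, neg_neg, mul_assoc])

theorem g_mul_eq {U : QMat D L} (hU : 𝒞.HasSyndrome U) (r : Site D L) :
    𝒞.g r * U = ((𝒞.syndrome U r : ℤ) : ℂ) • (U * 𝒞.g r) := by
  unfold syndrome
  split_ifs with h
  · simp [h]
  · rcases hU r with h1 | h1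
    · exact absurd h1 h
    · simp [h1]

theorem mul_g_ne_zero {U : QMat D L} (hU : U ∈ Matrix.unitaryGroup (QBasis D L) ℂ) (r : Site D L) :
    U * 𝒞.g r ≠ 0 := by
  intro h
  have h1 : star U * (U * 𝒞.g r) * 𝒞.g r = 1 := by
    rw [← mul_assoc, Matrix.mem_unitaryGroup_iff'.mp hU, one_mul, 𝒞.sq]
  rw [h] at h1
  simp at h1

/-- `U g_r` is nonzero, so the two signs exclude each other and either relation determines the
syndrome. -/
theorem syndrome_eq {U : QMat D L} (hU : U ∈ Matrix.unitaryGroup (QBasis D L) ℂ) {r : Site D L}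
    {s : ℤˣ} (h : 𝒞.g r * U = ((s : ℤ) : ℂ) • (U * 𝒞.g r)) : 𝒞.syndrome U r = s := by
  have h0 := mul_g_ne_zero (𝒞 := 𝒞) hU r
  unfold syndrome
  rcases Int.units_eq_one_or s with rfl | rfl
  · rw [if_pos (by simpa using h)]
  · rw [if_neg]
    intro h1
    rw [h1] at h
    simp only [Units.val_neg, Units.val_one, Int.cast_neg, Int.cast_one, neg_smul, one_smul] at h
    refine h0 ?_
    ext a b
    have := congrFun (congrFun h a) b
    simp only [Matrix.neg_apply] at this
    rw [Matrix.zero_apply]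
    linear_combination this / 2

theorem syndrome_mul {U V : QMat D L} (hU : U ∈ 𝒞.syndromeGroup) (hV : V ∈ 𝒞.syndromeGroup) :
    𝒞.syndrome (U * V) = 𝒞.syndrome U * 𝒞.syndrome V := by
  funext r
  refine syndrome_eq (mul_mem hU hV).1 ?_
  rw [← mul_assoc, g_mul_eq hU.2, smul_mul_assoc, mul_assoc, g_mul_eq hV.2, mul_smul_comm,
    smul_smul, mul_assoc]
  simp

theorem syndrome_one : 𝒞.syndrome (1 : QMat D L) = 1 := by
  funext r
  simp [syndrome]

theorem syndrome_noncommProd {ι : Type*} [DecidableEq ι] (s : Finset ι) (f : ι → QMat D L)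
    (hc : (s : Set ι).Pairwise (Function.onFun Commute f)) (hf : ∀ i, f i ∈ 𝒞.syndromeGroup) :
    s.noncommProd f hc ∈ 𝒞.syndromeGroup ∧
      𝒞.syndrome (s.noncommProd f hc) = ∏ i ∈ s, 𝒞.syndrome (f i) := by
  induction s using Finset.induction_on with
  | empty => simp [syndrome_one, one_mem]
  | insert a s ha ih =>
    rw [Finset.noncommProd_insert_of_notMem _ _ _ _ ha, Finset.prod_insert ha]
    exact ⟨mul_mem (hf a) (ih _).1, by rw [syndrome_mul (hf a) (ih _).1, (ih _).2]⟩

theorem InSector.conj (h : 𝒞.InSector τ ρ) {U : QMat D L} (hU : U ∈ 𝒞.syndromeGroup) :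
    𝒞.InSector (τ * 𝒞.syndrome U) (U * ρ * Uᴴ) := by
  refine ⟨Matrix.isHermitian_mul_mul_conjTranspose U h.1, fun r => ?_⟩
  rw [← mul_assoc, ← mul_assoc, g_mul_eq hU.2, smul_mul_assoc, mul_assoc U, h.2 r, mul_smul_comm,
    smul_smul, smul_mul_assoc, mul_comm]
  simp

theorem trace_conj {U : QMat D L} (hU : U ∈ Matrix.unitaryGroup (QBasis D L) ℂ) :
    (U * ρ * Uᴴ).trace = ρ.trace := by
  rw [Matrix.trace_mul_comm, ← mul_assoc, ← Matrix.star_eq_conjTranspose,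
    Matrix.mem_unitaryGroup_iff'.mp hU, one_mul]

theorem pauli_mem_syndromeGroup (s : PauliLabel D L) : pauli s ∈ 𝒞.syndromeGroup := by
  refine ⟨pauli_mem_unitaryGroup s, fun r => ?_⟩
  obtain ⟨t, c, h⟩ := 𝒞.isPauli r
  rw [h, smul_mul_assoc, mul_smul_comm, ← smul_neg]
  rcases pauli_comm_or_anticomm t s with h1 | h1
  · exact Or.inl (by rw [h1])
  · exact Or.inr (by rw [h1])

theorem IsLogical.inSector (h : 𝒞.IsLogical ρ) : 𝒞.InSector 1 ρ :=
  ⟨h.1.isHermitian, fun r => by simp [(h.2.2 r).1]⟩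

theorem IsLogical.noisy_inSector (h : 𝒞.IsLogical ρ) (s : PauliLabel D L) :
    𝒞.InSector (𝒞.syndrome (pauli s)) (noisy s ρ) := by
  have := h.inSector.conj (pauli_mem_syndromeGroup s)
  rwa [one_mul] at this

theorem IsLogical.noisy_trace (h : 𝒞.IsLogical ρ) (s : PauliLabel D L) :
    (noisy s ρ).trace = 1 := (trace_conj (pauli_mem_unitaryGroup s)).trans h.2.1

/-- The stabilizer extends by `Δ` and the operator by `k`. With `k = Δ` this is why feedback changes
syndromes only within `R = 2Δ`. -/
theorem syndrome_eq_one_of_supportedOn {U : QMat D L} {r r' : Site D L} {k : ℕ}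
    (hU : SupportedOn (linksIn (ball r k)) U) (h : r' ∉ ball r (k + Δ)) :
    𝒞.syndrome U r' = 1 :=
  if_pos ((𝒞.isLocal r').commute hU (disjoint_linksIn h).symm)

end StabilizerCode

end

section

variable {D L : ℕ}

/-! ## Product states with definite classical registers -/

/-- The operator `X ⊗ |c⟩⟨d|`. -/
def ketBra [NeZero L] {N : Type*} [DecidableEq N] (X : QMat D L) (c d : Cl D L N) : State D L N :=
  X ⊗ₖ Matrix.single c d (1 : ℂ)

section KetBra

variable [NeZero L] {N : Type*} [Fintype N] [DecidableEq N]

theorem ketBra_mul_ketBra (X Y : QMat D L) (c d e : Cl D L N) :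
    ketBra X c d * ketBra Y d e = ketBra (X * Y) c e := by
  simp [ketBra, ← Matrix.mul_kronecker_mul]

theorem ketBra_mul_ketBra_of_ne (X Y : QMat D L) {c d d' e : Cl D L N} (h : d ≠ d') :
    ketBra X c d * ketBra Y d' e = 0 := by
  rw [ketBra, ketBra, ← Matrix.mul_kronecker_mul, Matrix.single_mul_single_of_ne _ _ _ _ h,
    Matrix.kronecker_zero]

theorem conjTranspose_ketBra (X : QMat D L) (c d : Cl D L N) :
    (ketBra X c d)ᴴ = ketBra Xᴴ d c := by
  simp [ketBra, Matrix.conjTranspose_kronecker, Matrix.conjTranspose_single]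

theorem ketBra_zero (c d : Cl D L N) : ketBra (0 : QMat D L) c d = 0 := by
  simp [ketBra]

theorem block_ketBra (X : QMat D L) (c d : Cl D L N) :
    block (ketBra X c c) d = if d = c then X else 0 := by
  ext a b
  by_cases h : d = c
  · subst h; simp [block, ketBra, Matrix.kroneckerMap_apply]
  · have : ¬ c = d := fun h' => h h'.symm
    simp [block, ketBra, Matrix.kroneckerMap_apply, h, this, Matrix.single]

theorem trCl_ketBra (X : QMat D L) (c : Cl D L N) : trCl (ketBra X c c) = X := by
  simp [trCl, block_ketBra]

/-- An operation which measures the classical registers, and acts conditionally on them. -/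
theorem sum_ketBra_conj (U : Cl D L N → QMat D L) (e : Cl D L N → Cl D L N) (X : QMat D L)
    (c : Cl D L N) :
    ∑ c', ketBra (U c') (e c') c' * ketBra X c c * (ketBra (U c') (e c') c')ᴴ =
      ketBra (U c * X * (U c)ᴴ) (e c) (e c) := by
  rw [Finset.sum_eq_single c]
  · rw [ketBra_mul_ketBra, conjTranspose_ketBra, ketBra_mul_ketBra]
  · intro c' _ h
    rw [ketBra_mul_ketBra_of_ne _ _ h, zero_mul]
  · simp

end KetBra

variable [NeZero L] {Δ : ℕ} {𝒞 : StabilizerCode D L Δ}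

/-! ## One step of a synchronous decoder -/

namespace SyncDecoder

variable {M : Type*} {v : ℕ} (𝒟 : SyncDecoder 𝒞 M v) [Fintype M] [DecidableEq M]

theorem channelA_ketBra (X : QMat D L) (c : Cl D L M) :
    𝒟.channelA (ketBra X c c) = ketBra X (𝒟.rule c.1 c.2, c.2) (𝒟.rule c.1 c.2, c.2) := by
  refine (sum_ketBra_conj (fun _ => 1) (fun c => (𝒟.rule c.1 c.2, c.2)) X c).trans ?_
  simp

theorem channelF_ketBra (X : QMat D L) (c : Cl D L M) :
    𝒟.channelF (ketBra X c c) =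
      ketBra (𝒟.feedback c.1 c.2 * X * (𝒟.feedback c.1 c.2)ᴴ)
        (c.1, c.2 * 𝒞.syndrome (𝒟.feedback c.1 c.2))
        (c.1, c.2 * 𝒞.syndrome (𝒟.feedback c.1 c.2)) :=
  sum_ketBra_conj (fun c => 𝒟.feedback c.1 c.2)
    (fun c => (c.1, c.2 * 𝒞.syndrome (𝒟.feedback c.1 c.2))) X c

theorem initial_eq {τ : Site D L → ℤˣ} {ρ : QMat D L} (h : 𝒞.InSector τ ρ) :
    𝒟.initial ρ = ketBra ρ (𝒟.init, τ) (𝒟.init, τ) := by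
  unfold initial
  rw [Finset.sum_eq_single τ]
  · rw [h.projOn_mul, if_pos fun _ _ => rfl, h.mul_projOn, if_pos fun _ _ => rfl, ketBra]
  · intro σ _ hσ
    have : ¬ ∀ r ∈ Finset.univ, σ r = τ r := fun h' => hσ (funext fun r => h' r (Finset.mem_univ r))
    rw [h.projOn_mul, if_neg this, zero_mul, Matrix.zero_kronecker]
  · simp

end SyncDecoder

/-! ## One update of a Lindbladian decoder -/

namespace LindbladianDecoder

variable {N : Type*} (𝒟 : LindbladianDecoder 𝒞 N)

/-- The syndromes used by an update at `r`, for a state with syndromes `τ`. -/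
def seen (r : Site D L) (τ σ : Site D L → ℤˣ) : Site D L → ℤˣ :=
  overwrite (ball r 𝒟.radius) σ fun x => τ x

theorem overwrite_of_mem {B : Set (Site D L)} {σ : Site D L → ℤˣ} {s : B → ℤˣ} {r : Site D L}
    (h : r ∈ B) : overwrite B σ s r = s ⟨r, h⟩ := by simp [overwrite, h]

theorem overwrite_of_notMem {B : Set (Site D L)} {σ : Site D L → ℤˣ} {s : B → ℤˣ} {r : Site D L}
    (h : r ∉ B) : overwrite B σ s r = σ r := by simp [overwrite, h]

theorem seen_of_mem {r r' : Site D L} (h : r' ∈ ball r 𝒟.radius) (τ σ : Site D L → ℤˣ) :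
    𝒟.seen r τ σ r' = τ r' := overwrite_of_mem h

/-- The classical registers after an update at `r` with measured syndromes `s`. -/
def after (r : Site D L) (s : ball r 𝒟.radius → ℤˣ) (c : Cl D L N) : Cl D L N :=
  (𝒟.rule r c.1 (overwrite _ c.2 s),
    overwrite _ c.2 s * 𝒞.syndrome (𝒟.feedback r c.1 (overwrite _ c.2 s)))

/-- The index of the jump at `r` which occurs in a state with syndromes `τ`. -/
def jumpIndex (r : Site D L) (τ : Site D L → ℤˣ) (c : Cl D L N) : 𝒟.JumpIndex r :=
  (fun x => (c.1 x, c.2 x), fun x => τ x)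

/-- Configurations that agree in the ball receive the same feedback, and outside the ball they
change only by its syndrome, which cancels. Hence a jump operator followed by its adjoint returns
each classical configuration to itself. -/
theorem after_injective {r : Site D L} {s : ball r 𝒟.radius → ℤˣ} {c d : Cl D L N}
    (h : ∀ x ∈ ball r 𝒟.radius, c.1 x = d.1 x ∧ c.2 x = d.2 x)
    (he : 𝒟.after r s c = 𝒟.after r s d) : c = d := by
  have hov : ∀ x ∈ ball r 𝒟.radius, c.1 x = d.1 x ∧
      overwrite (ball r 𝒟.radius) c.2 s x = overwrite (ball r 𝒟.radius) d.2 s x := by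
    intro x hx
    exact ⟨(h x hx).1, by rw [overwrite_of_mem hx, overwrite_of_mem hx]⟩
  have hf := 𝒟.feedback_local r c.1 _ d.1 _ hov
  simp only [after, hf, Prod.mk.injEq, mul_left_inj] at he
  refine Prod.ext (funext fun x => ?_) (funext fun x => ?_)
  · by_cases hx : x ∈ ball r 𝒟.radius
    · exact (h x hx).1
    · have := congrFun he.1 x
      rwa [𝒟.rule_eq _ _ _ _ hx, 𝒟.rule_eq _ _ _ _ hx] at this
  · by_cases hx : x ∈ ball r 𝒟.radius
    · exact (h x hx).2
    · have := congrFun he.2 x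
      rwa [overwrite_of_notMem hx, overwrite_of_notMem hx] at this

variable [Fintype N] [DecidableEq N]

/-- The quantum part of a jump operator. -/
def jumpOp (r : Site D L) (s : ball r 𝒟.radius → ℤˣ) (c : Cl D L N) : QMat D L :=
  open Classical in
  𝒟.feedback r c.1 (overwrite _ c.2 s) * 𝒞.projOn (ball r 𝒟.radius).toFinset (overwrite _ c.2 s)

open Classical in
theorem jump_mul_ketBra (r : Site D L) (i : 𝒟.JumpIndex r) (X : QMat D L) (c d : Cl D L N) :
    𝒟.jump r i * ketBra X c d = ((1 / √𝒟.μ : ℝ) : ℂ) •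
      if ∀ x : ball r 𝒟.radius, i.1 x = (c.1 x, c.2 x) then
        ketBra (𝒟.jumpOp r i.2 c * X) (𝒟.after r i.2 c) d else 0 := by
  unfold jump
  rw [smul_mul_assoc]
  congr 1
  rw [Finset.sum_mul, Finset.sum_eq_single c]
  · split_ifs with h
    · exact ketBra_mul_ketBra _ _ _ _ _
    · exact zero_mul _
  · intro c' _ hc
    split_ifs with h
    · exact ketBra_mul_ketBra_of_ne _ _ hc
    · exact zero_mul _
  · simp

open Classical in
theorem conjTranspose_jump_mul_ketBra (r : Site D L) (i : 𝒟.JumpIndex r) (X : QMat D L)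
    (c d : Cl D L N) (hc : ∀ x : ball r 𝒟.radius, i.1 x = (c.1 x, c.2 x)) :
    (𝒟.jump r i)ᴴ * ketBra X (𝒟.after r i.2 c) d = ((1 / √𝒟.μ : ℝ) : ℂ) •
        ketBra ((𝒟.jumpOp r i.2 c)ᴴ * X) c d := by
  unfold jump
  rw [Matrix.conjTranspose_smul, Matrix.conjTranspose_sum, smul_mul_assoc]
  congr 1
  · simp
  rw [Finset.sum_mul, Finset.sum_eq_single c]
  · rw [if_pos hc]
    exact (congrArg (· * _) (conjTranspose_ketBra _ _ _)).trans (ketBra_mul_ketBra _ _ _ _ _)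
  · intro c' _ hc'
    split_ifs with h
    · refine (congrArg (· * _) (conjTranspose_ketBra _ _ _)).trans
        (ketBra_mul_ketBra_of_ne _ _ fun he => hc' ?_)
      refine 𝒟.after_injective (fun x hx => ?_) he
      have := (h ⟨x, hx⟩).symm.trans (hc ⟨x, hx⟩)
      simpa using this
    · simp
  · simp

variable {τ : Site D L → ℤˣ} {ρ : QMat D L}

open Classical in
theorem jumpOp_mul (h : 𝒞.InSector τ ρ) (r : Site D L) (s : ball r 𝒟.radius → ℤˣ)
    (c : Cl D L N) :
    𝒟.jumpOp r s c * ρ = if s = fun x : ball r 𝒟.radius => τ x then 𝒟.feedback r c.1 (overwrite _ c.2 s) * ρ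
      else 0 := by
  have h1 : (∀ x ∈ (ball r 𝒟.radius).toFinset, overwrite (ball r 𝒟.radius) c.2 s x = τ x) ↔
      s = fun x : ball r 𝒟.radius => τ x := by
    constructor
    · intro h'
      funext x
      have := h' x (by simp)
      rwa [overwrite_of_mem x.2] at this
    · rintro rfl x hx
      rw [overwrite_of_mem (by simpa using hx)]
  rw [jumpOp, mul_assoc, h.projOn_mul]
  simp only [h1]
  split_ifs <;> simp

theorem jumpIndex_eq_iff (r : Site D L) (i : 𝒟.JumpIndex r) (c : Cl D L N) :
    i = 𝒟.jumpIndex r τ c ↔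
      (∀ x : ball r 𝒟.radius, i.1 x = (c.1 x, c.2 x)) ∧ i.2 = fun x : ball r 𝒟.radius => τ x := by
  rw [jumpIndex, Prod.ext_iff, funext_iff]

open Classical in
-- For definite registers and syndromes exactly one jump at `r` acts nontrivially. The right factor
-- `Y` lets the same formula be applied again to `ρ Fᴴ` when the state is conjugated.
theorem jump_mul_of_inSector (h : 𝒞.InSector τ ρ) (r : Site D L) (i : 𝒟.JumpIndex r)
    (c d : Cl D L N) (Y : QMat D L) :
    𝒟.jump r i * ketBra (ρ * Y) c d = ((1 / √𝒟.μ : ℝ) : ℂ) •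
      if i = 𝒟.jumpIndex r τ c then
        ketBra (𝒟.feedback r c.1 (𝒟.seen r τ c.2) * ρ * Y)
          (𝒟.after r (fun x => τ x) c) d else 0 := by
  rw [jump_mul_ketBra]
  congr 1
  simp only [jumpIndex_eq_iff]
  by_cases h1 : ∀ x : ball r 𝒟.radius, i.1 x = (c.1 x, c.2 x)
  · rw [if_pos h1, ← mul_assoc, 𝒟.jumpOp_mul h]
    by_cases h2 : i.2 = fun x : ball r 𝒟.radius => τ x
    · rw [if_pos h2, if_pos ⟨h1, h2⟩, h2, seen]
    · rw [if_neg h2, if_neg fun h3 => h2 h3.2, zero_mul, ketBra_zero]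
  · rw [if_neg h1, if_neg fun h3 => h1 h3.1]

theorem inv_sqrt_smul_smul {E : Type*} [AddCommGroup E] [Module ℂ E] (x : E) :
    ((1 / √𝒟.μ : ℝ) : ℂ) • ((1 / √𝒟.μ : ℝ) : ℂ) • x = (𝒟.μ : ℂ)⁻¹ • x := by
  rw [smul_smul, ← Complex.ofReal_mul, div_mul_div_comm, Real.mul_self_sqrt 𝒟.μ_pos.le]
  simp

open Classical in
theorem jump_conj (h : 𝒞.InSector τ ρ) (r : Site D L) (i : 𝒟.JumpIndex r) (c : Cl D L N) :
    𝒟.jump r i * ketBra ρ c c * (𝒟.jump r i)ᴴ =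
      if i = 𝒟.jumpIndex r τ c then (𝒟.μ : ℂ)⁻¹ •
        ketBra (𝒟.feedback r c.1 (𝒟.seen r τ c.2) * ρ * (𝒟.feedback r c.1 (𝒟.seen r τ c.2))ᴴ)
          (𝒟.after r (fun x => τ x) c) (𝒟.after r (fun x => τ x) c) else 0 := by
  have h1 := 𝒟.jump_mul_of_inSector h r i c c 1
  rw [mul_one, mul_one] at h1
  have h2 : ketBra ρ c c * (𝒟.jump r i)ᴴ = (𝒟.jump r i * ketBra ρ c c)ᴴ := by
    rw [Matrix.conjTranspose_mul, conjTranspose_ketBra, h.1]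
  rw [mul_assoc, h2, h1]
  split_ifs with hi
  · rw [Matrix.conjTranspose_smul, conjTranspose_ketBra, Matrix.conjTranspose_mul, h.1,
      mul_smul_comm, 𝒟.jump_mul_of_inSector h, if_pos hi]
    rw [← inv_sqrt_smul_smul]
    congr 1
    simp
  · simp

open Classical in
-- The feedback is unitary and the syndrome projector acts trivially on the state. Hence each site
-- has jump rate `1/μ`, whatever the state.
theorem conjTranspose_jump_mul_jump (h : 𝒞.InSector τ ρ) (r : Site D L) (i : 𝒟.JumpIndex r)
    (c : Cl D L N) :
    (𝒟.jump r i)ᴴ * 𝒟.jump r i * ketBra ρ c c =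
      if i = 𝒟.jumpIndex r τ c then (𝒟.μ : ℂ)⁻¹ • ketBra ρ c c else 0 := by
  have h1 := 𝒟.jump_mul_of_inSector h r i c c 1
  rw [mul_one, mul_one] at h1
  rw [mul_assoc, h1]
  split_ifs with hi
  · subst hi
    have hc : ∀ x : ball r 𝒟.radius, (𝒟.jumpIndex r τ c).1 x = (c.1 x, c.2 x) := fun _ => rfl
    have h2 := 𝒟.conjTranspose_jump_mul_ketBra r (𝒟.jumpIndex r τ c)
      (𝒟.feedback r c.1 (𝒟.seen r τ c.2) * ρ) c c hc
    rw [mul_smul_comm]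
    refine (congrArg (_ • ·) h2).trans ?_
    rw [inv_sqrt_smul_smul]
    congr 2
    rw [jumpOp, Matrix.conjTranspose_mul]
    change (𝒞.projOn _ (𝒟.seen r τ c.2))ᴴ * (𝒟.feedback r c.1 (𝒟.seen r τ c.2))ᴴ * _ = _
    rw [mul_assoc, ← mul_assoc _ᴴ (𝒟.feedback _ _ _), ← Matrix.star_eq_conjTranspose (𝒟.feedback _ _ _),
      Matrix.mem_unitaryGroup_iff'.mp (𝒟.feedback_unitary _ _ _), one_mul]
    have h3 := h.mul_projOn (ball r 𝒟.radius).toFinset (𝒟.seen r τ c.2)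
    rw [if_pos fun x hx => 𝒟.seen_of_mem (by simpa using hx) _ _] at h3
    have h4 := congrArg Matrix.conjTranspose h3
    rwa [Matrix.conjTranspose_mul, h.1] at h4
  · simp

open Classical in
theorem updateChannel_ketBra (h : 𝒞.InSector τ ρ) (r : Site D L) (c : Cl D L N) :
    𝒟.updateChannel r (ketBra ρ c c) =
      ketBra (𝒟.feedback r c.1 (𝒟.seen r τ c.2) * ρ * (𝒟.feedback r c.1 (𝒟.seen r τ c.2))ᴴ)
          (𝒟.after r (fun x => τ x) c) (𝒟.after r (fun x => τ x) c) := by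
  unfold updateChannel
  simp only [𝒟.jump_conj h, Finset.sum_ite_eq', Finset.mem_univ, if_true]
  rw [smul_smul, mul_inv_cancel₀ (by exact_mod_cast 𝒟.μ_pos.ne'), one_smul]

/-- Exactly one jump per site contributes, and both halves of its anticommutator term are `1/(2μ)`
times the state. The generator acts as that of a Poisson process of updates. -/
theorem lindbladian_ketBra (h : 𝒞.InSector τ ρ) (c : Cl D L N) :
    𝒟.lindbladian (ketBra ρ c c) = (𝒟.μ : ℂ)⁻¹ •
      (∑ r, 𝒟.updateChannel r (ketBra ρ c c) - (Fintype.card (Site D L) : ℂ) • ketBra ρ c c) := by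
  classical
  have h1 : ∀ r, ∑ i : 𝒟.JumpIndex r,
      (𝒟.jump r i * ketBra ρ c c * (𝒟.jump r i)ᴴ -
        (2⁻¹ : ℂ) • ((𝒟.jump r i)ᴴ * 𝒟.jump r i * ketBra ρ c c +
          ketBra ρ c c * ((𝒟.jump r i)ᴴ * 𝒟.jump r i))) =
      (𝒟.μ : ℂ)⁻¹ • (𝒟.updateChannel r (ketBra ρ c c) - ketBra ρ c c) := by
    intro r
    have h2 : ∀ i : 𝒟.JumpIndex r, ketBra ρ c c * ((𝒟.jump r i)ᴴ * 𝒟.jump r i) =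
        ((𝒟.jump r i)ᴴ * 𝒟.jump r i * ketBra ρ c c)ᴴ := by
      intro i
      rw [Matrix.conjTranspose_mul, Matrix.conjTranspose_mul, Matrix.conjTranspose_conjTranspose,
        conjTranspose_ketBra, h.1]
    rw [𝒟.updateChannel_ketBra h]
    simp only [h2, 𝒟.jump_conj h, 𝒟.conjTranspose_jump_mul_jump h]
    rw [Finset.sum_eq_single (𝒟.jumpIndex r τ c)]
    · rw [if_pos rfl, if_pos rfl, Matrix.conjTranspose_smul, conjTranspose_ketBra, h.1, smul_sub]
      congr 1
      simp only [star_inv₀, Complex.star_def, Complex.conj_ofReal]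
      rw [← two_smul ℂ, smul_smul, inv_mul_cancel₀ two_ne_zero, one_smul]
    · intro i _ hi
      simp [hi]
    · simp
  unfold lindbladian
  refine (Finset.sum_congr rfl fun r _ => ?_).trans
    ((Finset.smul_sum (r := (𝒟.μ : ℂ)⁻¹) (f := fun r => 𝒟.updateChannel r (ketBra ρ c c) - ketBra ρ c c)).symm.trans ?_)
  · exact h1 r
  · rw [Finset.sum_sub_distrib, Finset.sum_const, Finset.card_univ, Nat.cast_smul_eq_nsmul]

end LindbladianDecoder

end

section

variable {D L : ℕ} [NeZero L] {Δ : ℕ} {𝒞 : StabilizerCode D L Δ}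

namespace SyncDecoder

variable {M : Type*} {v : ℕ} (𝒟 : SyncDecoder 𝒞 M v) (τ : Site D L → ℤˣ)

/-! ## The history of a synchronous decoder -/

/-- The control variables and syndromes after `j` time steps, if the initial syndromes are `τ`. -/
def syncState : ℕ → Cl D L M
  | 0 => (𝒟.init, τ)
  | j + 1 => (𝒟.rule (syncState j).1 (syncState j).2, (syncState j).2 *
      𝒞.syndrome (𝒟.feedback (𝒟.rule (syncState j).1 (syncState j).2) (syncState j).2))

/-- The syndromes after `j` time steps. -/
def syn (j : ℕ) : Site D L → ℤˣ := (𝒟.syncState τ j).2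

/-- The control variables after `n` elementary automaton updates. -/
def ctrl (n : ℕ) : Site D L → M :=
  (fun m => 𝒟.A m (𝒟.syn τ (n / v)))^[n % v] (𝒟.syncState τ (n / v)).1

/-- The feedback operator applied at `r` in time step `j`. -/
def fb (j : ℕ) (r : Site D L) : QMat D L := 𝒟.F r (𝒟.syncState τ (j + 1)).1 (𝒟.syn τ j)

theorem ctrl_zero : 𝒟.ctrl τ 0 = 𝒟.init := by simp [ctrl, syncState]

variable [NeZero v]

theorem ctrl_succ (n : ℕ) : 𝒟.ctrl τ (n + 1) = 𝒟.A (𝒟.ctrl τ n) (𝒟.syn τ (n / v)) := by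
  have hv : 0 < v := NeZero.pos v
  unfold ctrl
  rw [← Function.iterate_succ_apply' (fun m => 𝒟.A m (𝒟.syn τ (n / v)))]
  -- The last of the `v` elementary updates completes `rule`, and `ctrl` passes to the next
  -- `syncState`; any other update stays within the same time step and uses the same syndromes.
  by_cases h : n % v + 1 = v
  · have hd : n + 1 = (n / v + 1) * v := by
      have := Nat.div_add_mod n v
      rw [add_mul, one_mul, mul_comm]
      omega
    rw [hd, Nat.mul_div_cancel _ hv, Nat.mul_mod_left, Nat.succ_eq_add_one, h, Function.iterate_zero_apply]
    rfl
  · have hlt : n % v + 1 < v := lt_of_le_of_ne (Nat.mod_lt n hv) h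
    have hd : (n + 1) / v = n / v := by
      rw [Nat.succ_div, if_neg, add_zero]
      intro hdvd
      have h1 := Nat.mod_eq_zero_of_dvd hdvd
      rw [Nat.add_mod, Nat.mod_eq_of_lt (lt_of_le_of_lt (Nat.le_add_left 1 (n % v)) hlt),
        Nat.mod_eq_of_lt hlt] at h1
      omega
    have hm : (n + 1) % v = n % v + 1 := by
      have h1 := Nat.div_add_mod n v
      have h2 := Nat.div_add_mod (n + 1) v
      rw [hd] at h2
      omega
    rw [hd, hm]

theorem ctrl_mul (j : ℕ) : 𝒟.ctrl τ (j * v) = (𝒟.syncState τ j).1 := by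
  simp [ctrl, Nat.mul_div_cancel _ (NeZero.pos v)]

theorem F_mem_syndromeGroup (r : Site D L) (m : Site D L → M) (σ : Site D L → ℤˣ) :
    𝒟.F r m σ ∈ 𝒞.syndromeGroup := ⟨𝒟.F_unitary r m σ, 𝒟.F_syndrome r m σ⟩

theorem fb_mem_syndromeGroup (j : ℕ) (r : Site D L) : 𝒟.fb τ j r ∈ 𝒞.syndromeGroup :=
  𝒟.F_mem_syndromeGroup _ _ _

theorem feedback_mem_syndromeGroup (m : Site D L → M) (σ : Site D L → ℤˣ) :
    𝒟.feedback m σ ∈ 𝒞.syndromeGroup :=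
  (StabilizerCode.syndrome_noncommProd _ _ _ fun r => 𝒟.F_mem_syndromeGroup r m σ).1

theorem syn_succ (j : ℕ) : 𝒟.syn τ (j + 1) = 𝒟.syn τ j * ∏ r, 𝒞.syndrome (𝒟.fb τ j r) := by
  refine congrArg (𝒟.syn τ j * ·) ?_
  exact (StabilizerCode.syndrome_noncommProd _ _ _ fun r => 𝒟.F_mem_syndromeGroup r _ _).2

theorem syn_eq (j : ℕ) :
    𝒟.syn τ j = τ * ∏ r, ∏ i ∈ Finset.range j, 𝒞.syndrome (𝒟.fb τ i r) := by
  induction j with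
  | zero => simp [syn, syncState]
  | succ j ih =>
    rw [syn_succ, ih]
    simp only [Finset.prod_range_succ, Finset.prod_mul_distrib, mul_assoc]

theorem syndrome_fb_eq_one (j : ℕ) {r r' : Site D L} (h : r' ∉ ball r 𝒟.range) :
    𝒞.syndrome (𝒟.fb τ j r) r' = 1 := by
  refine StabilizerCode.syndrome_eq_one_of_supportedOn (𝒟.F_supp r _ _) ?_
  rwa [← two_mul]

theorem fb_commute (j : ℕ) (r r' : Site D L) : Commute (𝒟.fb τ j r) (𝒟.fb τ j r') :=
  𝒟.F_comm _ _ _ _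

theorem fb_commute_of_notMem (i j : ℕ) {r r' : Site D L} (h : r' ∉ ball r 𝒟.range) :
    Commute (𝒟.fb τ i r) (𝒟.fb τ j r') := by
  refine (𝒟.F_supp r _ _).commute (𝒟.F_supp r' _ _) (disjoint_linksIn ?_)
  rwa [← two_mul]

/-! ## Products of feedback operators -/

/-- The product of the feedback operators of time step `j` at the sites that have completed it,
where `k r` is the number of time steps completed at `r`. -/
def layer (k : Site D L → ℕ) (j : ℕ) : QMat D L :=
  (Finset.univ.filter fun r => j < k r).noncommProd (𝒟.fb τ j)
    fun _ _ _ _ _ => 𝒟.fb_commute τ _ _ _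

/-- The product of the feedback operators of the first `J` time steps at the sites that have
completed them. -/
def layers (k : Site D L → ℕ) : ℕ → QMat D L
  | 0 => 1
  | J + 1 => 𝒟.layer τ k J * layers k J

/-- The product of all feedback operators, where `k r` is the number of time steps completed at
`r`. -/
def totalFb (k : Site D L → ℕ) : QMat D L := 𝒟.layers τ k (Finset.univ.sup k)

/-- The product of all feedback operators applied by the synchronous decoder in `t` steps. -/
def syncOp : ℕ → QMat D L
  | 0 => 1
  | t + 1 => 𝒟.feedback (𝒟.syncState τ (t + 1)).1 (𝒟.syn τ t) * syncOp t

variable {τ}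

theorem layer_eq_one {k : Site D L → ℕ} {j : ℕ} (h : ∀ r, j < k r → 𝒟.fb τ j r = 1) :
    𝒟.layer τ k j = 1 := by
  refine (Finset.noncommProd_eq_pow_card _ _ _ 1 fun r hr => ?_).trans (one_pow _)
  exact h r (Finset.mem_filter.mp hr).2

theorem layer_eq_feedback {k : Site D L → ℕ} {j : ℕ} (h : ∀ r, j < k r) :
    𝒟.layer τ k j = 𝒟.feedback (𝒟.syncState τ (j + 1)).1 (𝒟.syn τ j) :=
  Finset.noncommProd_congr (by simp [h]) (fun _ _ => rfl) _

theorem layer_congr {k k' : Site D L → ℕ} {j : ℕ} (h : ∀ r, j < k r ↔ j < k' r) :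
    𝒟.layer τ k j = 𝒟.layer τ k' j :=
  Finset.noncommProd_congr (by simp [h]) (fun _ _ => rfl) _

theorem layer_update {k : Site D L → ℕ} {r : Site D L} :
    𝒟.layer τ (Function.update k r (k r + 1)) (k r) = 𝒟.fb τ (k r) r * 𝒟.layer τ k (k r) := by
  have h : (Finset.univ.filter fun r' => k r < Function.update k r (k r + 1) r') =
      insert r (Finset.univ.filter fun r' => k r < k r') := by
    ext r'
    by_cases e : r' = r
    · subst e; simp
    · simp [e]
  refine (Finset.noncommProd_congr h (fun _ _ => rfl) _).trans ?_
  exact Finset.noncommProd_insert_of_notMem _ _ _ _ (by simp)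

theorem layers_eq_of_le {k : Site D L → ℕ} {J J' : ℕ} (hJ : ∀ j r, J ≤ j → j < k r →
    𝒟.fb τ j r = 1) (h : J ≤ J') : 𝒟.layers τ k J' = 𝒟.layers τ k J := by
  induction J', h using Nat.le_induction with
  | base => rfl
  | succ n hn ih => rw [layers, 𝒟.layer_eq_one fun r hr => hJ n r hn hr, one_mul, ih]

theorem layers_eq_totalFb {k : Site D L → ℕ} {J : ℕ} (hJ : ∀ r, k r ≤ J) :
    𝒟.layers τ k J = 𝒟.totalFb τ k :=
  𝒟.layers_eq_of_le (fun j r h1 h2 =>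
    absurd (lt_of_lt_of_le h2 (Finset.le_sup (Finset.mem_univ r))) (not_lt.mpr h1))
    (Finset.sup_le fun r _ => hJ r)

/-- The new operator of time step `k r` has to be moved past the layers of later time steps. Only
sites `r'` with `k r + 1 < k r'` occur there, and by hypothesis these are out of range, so their
operators have disjoint support from the new one. -/
theorem layers_update {k : Site D L → ℕ} {r : Site D L}
    (h : ∀ r', k r + 1 < k r' → r' ∉ ball r 𝒟.range) (J : ℕ) :
    𝒟.layers τ (Function.update k r (k r + 1)) J =
      if k r < J then 𝒟.fb τ (k r) r * 𝒟.layers τ k J else 𝒟.layers τ k J := by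
  induction J with
  | zero => simp [layers]
  | succ J ih =>
    rw [layers, ih, layers]
    have hlayer : J ≠ k r →
        𝒟.layer τ (Function.update k r (k r + 1)) J = 𝒟.layer τ k J := by
      intro hJ
      refine 𝒟.layer_congr fun r' => ?_
      by_cases e : r' = r
      · subst e; simp; omega
      · simp [e]
    rcases lt_trichotomy (k r) J with h1 | h1 | h1
    · rw [if_pos h1, if_pos (by omega), hlayer h1.ne', ← mul_assoc, ← mul_assoc]
      congr 1
      refine ((Finset.noncommProd_commute _ _ _ _ fun r' hr' => ?_).eq).symm
      have := (Finset.mem_filter.mp hr').2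
      exact 𝒟.fb_commute_of_notMem τ _ _ (h r' (by omega))
    · subst h1
      rw [if_neg (lt_irrefl _), if_pos (Nat.lt_succ_self _), layer_update, mul_assoc]
    · rw [if_neg (by omega), if_neg (by omega), hlayer (by omega)]

theorem totalFb_update {k : Site D L → ℕ} {r : Site D L}
    (h : ∀ r', k r + 1 < k r' → r' ∉ ball r 𝒟.range) :
    𝒟.totalFb τ (Function.update k r (k r + 1)) = 𝒟.fb τ (k r) r * 𝒟.totalFb τ k := by
  -- One layer beyond the largest count makes room for the new operator as well.
  have h1 := 𝒟.layers_update (τ := τ) h (Finset.univ.sup k + 1)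
  have hk : ∀ r, k r ≤ Finset.univ.sup k := fun r => Finset.le_sup (Finset.mem_univ r)
  rw [if_pos (Nat.lt_succ_of_le (hk r)), 𝒟.layers_eq_totalFb, 𝒟.layers_eq_totalFb] at h1
  · exact h1
  · exact fun r' => (hk r').trans (Nat.le_succ _)
  · intro r'
    by_cases e : r' = r
    · subst e; simpa using hk r'
    · simpa [e] using (hk r').trans (Nat.le_succ _)

theorem layers_eq_syncOp {k : Site D L → ℕ} {T : ℕ} (hk : ∀ r, T ≤ k r) :
    𝒟.layers τ k T = 𝒟.syncOp τ T := by
  induction T with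
  | zero => rfl
  | succ T ih =>
    rw [layers, syncOp, ih fun r => (Nat.le_succ T).trans (hk r), 𝒟.layer_eq_feedback fun r => hk r]

/-- Sites may have run beyond step `T` by different amounts, but all operators applied after it are
trivial. -/
theorem totalFb_eq_syncOp {k : Site D L → ℕ} {T : ℕ} (hk : ∀ r, T ≤ k r)
    (hT : ∀ j r, T ≤ j → 𝒟.fb τ j r = 1) : 𝒟.totalFb τ k = 𝒟.syncOp τ T := by
  rw [← 𝒟.layers_eq_syncOp hk,
    ← 𝒟.layers_eq_totalFb (J := max T (Finset.univ.sup k)) fun r =>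
      (Finset.le_sup (Finset.mem_univ r)).trans (le_max_right _ _)]
  exact 𝒟.layers_eq_of_le (fun j r h _ => hT j r h) (le_max_left _ _)

theorem syncOp_mem_syndromeGroup (t : ℕ) : 𝒟.syncOp τ t ∈ 𝒞.syndromeGroup := by
  induction t with
  | zero => exact one_mem _
  | succ t ih => exact mul_mem (𝒟.feedback_mem_syndromeGroup _ _) ih

theorem layer_mem_syndromeGroup (k : Site D L → ℕ) (j : ℕ) :
    𝒟.layer τ k j ∈ 𝒞.syndromeGroup :=
  (StabilizerCode.syndrome_noncommProd _ _ _ fun r => 𝒟.fb_mem_syndromeGroup τ j r).1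

theorem layers_mem_syndromeGroup (k : Site D L → ℕ) (J : ℕ) :
    𝒟.layers τ k J ∈ 𝒞.syndromeGroup := by
  induction J with
  | zero => exact one_mem _
  | succ J ih => exact mul_mem (𝒟.layer_mem_syndromeGroup _ _) ih

theorem totalFb_zero : 𝒟.totalFb τ 0 = 1 := by
  have : Finset.univ.sup (0 : Site D L → ℕ) = 0 := by simp
  rw [totalFb, this, layers]

/-! ## The evolution of the synchronous decoder -/

variable [Fintype M] [DecidableEq M] {ρ : QMat D L}

theorem evolve_eq (h : 𝒞.InSector τ ρ) (t : ℕ) :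
    𝒟.evolve ρ t = ketBra (𝒟.syncOp τ t * ρ * (𝒟.syncOp τ t)ᴴ)
      (𝒟.syncState τ t) (𝒟.syncState τ t) := by
  induction t with
  | zero =>
    change 𝒟.initial ρ = _
    rw [𝒟.initial_eq h]
    simp [syncOp, syncState]
  | succ t ih =>
    rw [evolve, Function.iterate_succ_apply']
    change 𝒟.channelF (𝒟.channelA (𝒟.evolve ρ t)) = _
    rw [ih, channelA_ketBra, channelF_ketBra]
    simp only [syncOp, Matrix.conjTranspose_mul, mul_assoc]
    rfl

theorem output_eq (h : 𝒞.InSector τ ρ) (t : ℕ) :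
    𝒟.output ρ t = 𝒟.syncOp τ t * ρ * (𝒟.syncOp τ t)ᴴ := by
  rw [output, 𝒟.evolve_eq h, trCl_ketBra]

theorem syndrome_syncOp (t : ℕ) : τ * 𝒞.syndrome (𝒟.syncOp τ t) = 𝒟.syn τ t := by
  induction t with
  | zero => simp [syncOp, StabilizerCode.syndrome_one, syn, syncState]
  | succ t ih =>
    rw [syncOp, StabilizerCode.syndrome_mul (𝒟.feedback_mem_syndromeGroup _ _)
      (𝒟.syncOp_mem_syndromeGroup t), mul_left_comm, ih, mul_comm]
    rfl

theorem anyonFree_output_iff (h : 𝒞.InSector τ ρ) (ht : ρ.trace = 1) (t : ℕ) :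
    𝒞.AnyonFree (𝒟.output ρ t) ↔ 𝒟.syn τ t = 1 := by
  have h1 := h.conj (𝒟.syncOp_mem_syndromeGroup (τ := τ) t)
  rw [syndrome_syncOp] at h1
  rw [𝒟.output_eq h, h1.anyonFree_iff]
  rw [StabilizerCode.trace_conj (𝒟.syncOp_mem_syndromeGroup t).1, ht]

/-- The synchronous history is the configuration that occurs, with block of trace 1, so the
termination hypothesis applies to it. -/
theorem fb_eq_one_of_terminatesIn (h : 𝒞.InSector τ ρ) (ht : ρ.trace = 1) {T : ℕ}
    (hT : 𝒟.TerminatesIn ρ T) (j : ℕ) (r : Site D L) (hj : T ≤ j) : 𝒟.fb τ j r = 1 := by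
  refine hT j hj ((𝒟.syncState τ (j + 1)).1, 𝒟.syn τ j) ?_ r
  rw [𝒟.evolve_eq h, channelA_ketBra, block_ketBra]
  have : (((𝒟.syncState τ (j + 1)).1, 𝒟.syn τ j) : Cl D L M) =
    (𝒟.rule (𝒟.syncState τ j).1 (𝒟.syncState τ j).2, (𝒟.syncState τ j).2) := rfl
  rw [if_pos this, StabilizerCode.trace_conj (𝒟.syncOp_mem_syndromeGroup j).1, ht]
  exact one_ne_zero

theorem syncOp_eq_of_le {T t : ℕ} (hT : ∀ j r, T ≤ j → 𝒟.fb τ j r = 1) (h : T ≤ t) :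
    𝒟.syncOp τ t = 𝒟.syncOp τ T := by
  rw [← 𝒟.totalFb_eq_syncOp (k := fun _ => t) (fun _ => h) hT,
    𝒟.totalFb_eq_syncOp (k := fun _ => t) (fun _ => le_rfl) fun j r hj => hT j r (h.trans hj)]

end SyncDecoder

end

section

variable {D L : ℕ} [NeZero L] {Δ : ℕ} {𝒞 : StabilizerCode D L Δ}

theorem signType_cast_le_zero {l : SignType} : (l : ℤ) ≤ 0 ↔ l ≤ 0 := by
  cases l <;> decide

theorem signType_cast_mem (l : SignType) : -1 ≤ (l : ℤ) ∧ (l : ℤ) ≤ 1 := by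
  cases l <;> decide

theorem signType_cast_eq_neg_one {l : SignType} : (l : ℤ) = -1 ↔ l = -1 := by
  cases l <;> decide

theorem signType_cast_eq_zero {l : SignType} : (l : ℤ) = 0 ↔ l = 0 := by
  cases l <;> decide

theorem lagSucc_cast {l : SignType} (h : (l : ℤ) ≤ 0) : (lagSucc l : ℤ) = l + 1 := by
  cases l <;> revert h <;> decide

theorem lagPred_cast {l : SignType} (h : 0 ≤ (l : ℤ)) : (lagPred l : ℤ) = l - 1 := by
  cases l <;> revert h <;> decide

theorem div_succ_of_mod {n v : ℕ} (h : n % v + 1 = v) : (n + 1) / v = n / v + 1 := by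
  have hv : 0 < v := by omega
  have h1 := Nat.div_add_mod n v
  have hd : n + 1 = (n / v + 1) * v := by
    rw [add_mul, one_mul, mul_comm]
    omega
  rw [hd, Nat.mul_div_cancel _ hv]

theorem div_succ_of_mod_ne {n v : ℕ} (hv : 0 < v) (h : n % v + 1 ≠ v) : (n + 1) / v = n / v := by
  have hlt : n % v + 1 < v := lt_of_le_of_ne (Nat.mod_lt n hv) h
  rw [Nat.succ_div, if_neg, add_zero]
  intro hdvd
  have h1 := Nat.mod_eq_zero_of_dvd hdvd
  rw [Nat.add_mod, Nat.mod_eq_of_lt (lt_of_le_of_lt (Nat.le_add_left 1 (n % v)) hlt),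
    Nat.mod_eq_of_lt hlt] at h1
  omega

theorem div_succ_le (n v : ℕ) : (n + 1) / v ≤ n / v + 1 := by
  rw [Nat.succ_div]
  split_ifs <;> omega

namespace SyncDecoder

variable {M : Type*} {v : ℕ} [NeZero v] (𝒟 : SyncDecoder 𝒞 M v) {τ : Site D L → ℤˣ}

/-! ## Syndromes of the desynchronized decoder -/

theorem syndrome_layers (k : Site D L → ℕ) (J : ℕ) :
    𝒞.syndrome (𝒟.layers τ k J) =
      ∏ j ∈ Finset.range J, ∏ r ∈ Finset.univ.filter fun r => j < k r,
        𝒞.syndrome (𝒟.fb τ j r) := by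
  induction J with
  | zero => simp [layers, StabilizerCode.syndrome_one]
  | succ J ih =>
    rw [layers, StabilizerCode.syndrome_mul (𝒟.layer_mem_syndromeGroup _ _)
      (𝒟.layers_mem_syndromeGroup _ _), ih, Finset.prod_range_succ, mul_comm]
    congr 1
    exact (StabilizerCode.syndrome_noncommProd _ _ _ fun r => 𝒟.fb_mem_syndromeGroup τ J r).2

/-- The syndromes of the quantum state, where `h r` is the number of elementary updates of `r`. -/
def quantumSyn (τ : Site D L → ℤˣ) (h : Site D L → ℕ) : Site D L → ℤˣ :=
  τ * 𝒞.syndrome (𝒟.totalFb τ fun r => h r / v)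

theorem quantumSyn_apply (h : Site D L → ℕ) (r : Site D L) :
    𝒟.quantumSyn τ h r =
      τ r * ∏ r', ∏ j ∈ Finset.range (h r' / v), 𝒞.syndrome (𝒟.fb τ j r') r := by
  rw [quantumSyn, Pi.mul_apply, totalFb, syndrome_layers]
  congr 1
  rw [Finset.prod_comm' (t' := Finset.univ) (s' := fun r => Finset.range (h r / v))]
  · simp only [Finset.prod_apply]
  · intro j r'
    simp only [Finset.mem_range, Finset.mem_filter, Finset.mem_univ, true_and, and_true]
    constructor
    · exact fun h1 => h1.2
    · exact fun h1 => ⟨lt_of_lt_of_le h1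
        (Finset.le_sup (f := fun r => h r / v) (Finset.mem_univ r')), h1⟩

/-- The syndrome changes at `r` due to the sites that are one time step ahead of `r`. -/
def futureSyn (τ : Site D L → ℤˣ) (h : Site D L → ℕ) (r : Site D L) : ℤˣ :=
  ∏ r', if h r / v < h r' / v then 𝒞.syndrome (𝒟.fb τ (h r / v) r') r else 1

/-- A site in range of `r` has completed either the same number of time steps as `r` or one more. In
the latter case its premature contribution appears in both factors and cancels, being a sign. Sites
out of range do not affect the syndrome at `r`. -/
theorem quantumSyn_mul_futureSyn {h : Site D L → ℕ} {r : Site D L}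
    (hr : ∀ r' ∈ ball r 𝒟.range, h r ≤ h r' ∧ h r' ≤ h r + 1) :
    𝒟.quantumSyn τ h r * 𝒟.futureSyn τ h r = 𝒟.syn τ (h r / v) r := by
  rw [quantumSyn_apply, syn_eq, futureSyn, mul_assoc, ← Finset.prod_mul_distrib, Pi.mul_apply]
  simp only [Finset.prod_apply]
  congr 1
  refine Finset.prod_congr rfl fun r' _ => ?_
  by_cases hb : r' ∈ ball r 𝒟.range
  · obtain ⟨h1, h2⟩ := hr r' hb
    have h3 : h r / v ≤ h r' / v := Nat.div_le_div_right h1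
    have h4 : h r' / v ≤ h r / v + 1 := (Nat.div_le_div_right h2).trans (div_succ_le _ _)
    split_ifs with h5
    · have h6 : h r' / v = h r / v + 1 := by omega
      rw [h6, Finset.prod_range_succ, mul_assoc, Int.units_mul_self, mul_one]
    · rw [mul_one, show h r' / v = h r / v by omega]
  · have hb' : r ∉ ball r' 𝒟.range := fun h' => hb (mem_ball_comm.mp h')
    simp [𝒟.syndrome_fb_eq_one τ _ hb']

/-! ## The desynchronized decoder follows the synchronous decoder -/

open Classical in
/-- The sites which may not lag behind `r` when `r` is updated. -/
def nbhd (r : Site D L) : Finset (Site D L) := (ball r (2 * 𝒟.range)).toFinset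

theorem mem_nbhd {r r' : Site D L} : r' ∈ 𝒟.nbhd r ↔ r' ∈ ball r (2 * 𝒟.range) := by
  simp [nbhd]

/-- The control variables `x` of the desynchronized decoder agree with the history of the
synchronous decoder, where `h r` is the number of elementary updates made at `r`. -/
structure Follows (τ : Site D L → ℤˣ) (h : Site D L → ℕ) (x : 𝒟.AConf) : Prop where
  lag : ∀ r, ∀ r' ∈ ball r (2 * 𝒟.range), (lagTo x r r' : ℤ) = h r - h r'
  u : ∀ r, (x r).u.val = h r % v
  mNew : ∀ r, (x r).mNew = 𝒟.ctrl τ (h r) r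
  old : ∀ r n, h r = n + 1 → (x r).mOld = 𝒟.ctrl τ n r ∧ (x r).sOld = 𝒟.syn τ (n / v) r
  fut : ∀ r, (x r).sFut = 𝒟.futureSyn τ h r

variable {𝒟} {h : Site D L → ℕ} {x : 𝒟.AConf} {σ : Site D L → ℤˣ}

theorem lagTo_self (x : 𝒟.AConf) (r : Site D L) : lagTo x r r = 0 := by
  simp [lagTo]

theorem Follows.le_succ (hx : 𝒟.Follows τ h x) {r r' : Site D L}
    (hr : r' ∈ ball r (2 * 𝒟.range)) : h r' ≤ h r + 1 := by
  have h1 := hx.lag r r' hr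
  have h2 := signType_cast_mem (lagTo x r r')
  omega

theorem Follows.accepted_iff (hx : 𝒟.Follows τ h x) (r : Site D L) :
    Accepted x r ↔ ∀ r' ∈ 𝒟.nbhd r, h r ≤ h r' := by
  simp only [mem_nbhd]
  constructor
  · intro ha r' hr'
    by_cases e : r' = r
    · rw [e]
    · have h1 := signType_cast_le_zero.mpr (ha r' hr' e)
      have h2 := hx.lag r r' hr'
      omega
  · intro ha r' hr' _
    have h1 := ha r' hr'
    have h2 := hx.lag r r' hr'
    exact signType_cast_le_zero.mp (by omega)

section Present

variable {r : Site D L} (hx : 𝒟.Follows τ h x) (ha : ∀ r' ∈ ball r (2 * 𝒟.range), h r ≤ h r')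
  (hσ : ∀ r' ∈ ball r (2 * 𝒟.range), σ r' = 𝒟.quantumSyn τ h r')

include hx ha hσ in
-- To correct the syndrome at `r'` one must know that all sites within `R` of `r'` are level with it
-- or one update ahead. Those sites lie within `2R` of `r`, which is why acceptance is tested on the
-- larger ball; the upper bound comes from the lags at `r'`.
theorem Follows.newSyn_eq {r' : Site D L} (hr' : r' ∈ ball r 𝒟.range) (he : h r' = h r) :
    newSyn x r σ r' = 𝒟.syn τ (h r / v) r' := by
  rw [newSyn, if_pos hr', hσ r' (ball_mono r (by omega) hr'), hx.fut, ← he]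
  refine 𝒟.quantumSyn_mul_futureSyn fun r'' hr'' => ⟨?_, ?_⟩
  · rw [he]
    have := mem_ball_add hr' hr''
    rw [← two_mul] at this
    exact ha r'' this
  · exact hx.le_succ (ball_mono r' (by omega) hr'')

include hx ha hσ in
-- A site in range is either level with `r`, so that its new values are current, or one update
-- ahead, so that its old values are.
theorem Follows.present_eq {r' : Site D L} (hr' : r' ∈ ball r 𝒟.range) :
    mPresent x r r' = 𝒟.ctrl τ (h r) r' ∧ sPresent x r σ r' = 𝒟.syn τ (h r / v) r' := by
  have hr2 := ball_mono r (show 𝒟.range ≤ 2 * 𝒟.range by omega) hr'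
  have h1 := hx.lag r r' hr2
  have h2 := ha r' hr2
  have h3 := hx.le_succ hr2
  unfold mPresent sPresent
  by_cases hl : lagTo x r r' = -1
  · have h4 : h r' = h r + 1 := by
      rw [signType_cast_eq_neg_one.mpr hl] at h1
      omega
    rw [if_pos hl, if_pos hl]
    exact hx.old r' _ h4
  · have h4 : h r' = h r := by
      have hne : (lagTo x r r' : ℤ) ≠ -1 := fun h' => hl (signType_cast_eq_neg_one.mp h')
      omega
    rw [if_neg hl, if_neg hl, hx.mNew, h4]
    exact ⟨rfl, hx.newSyn_eq ha hσ hr' h4⟩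

include hx ha hσ in
theorem Follows.A_present {r' : Site D L} (hr' : r' ∈ ball r Δ) :
    𝒟.A (mPresent x r) (sPresent x r σ) r' = 𝒟.ctrl τ (h r + 1) r' := by
  rw [ctrl_succ]
  refine 𝒟.A_local _ _ _ _ _ fun r'' hr'' => hx.present_eq ha hσ ?_
  have := mem_ball_add hr' hr''
  rwa [← two_mul] at this

include hx ha hσ in
theorem Follows.asyncF_eq :
    𝒟.asyncF r x σ = if h r % v + 1 = v then 𝒟.fb τ (h r / v) r else 1 := by
  have hacc : Accepted x r := (hx.accepted_iff r).mpr fun r' hr' => ha r' (𝒟.mem_nbhd.mp hr')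
  unfold asyncF
  simp only [hacc, true_and, hx.u]
  split_ifs with hv
  · refine 𝒟.F_local _ _ _ _ _ fun r' hr' => ?_
    refine ⟨?_, (hx.present_eq ha hσ (ball_mono r (by unfold range; omega) hr')).2⟩
    -- The feedback reads the updated controls within `Δ`, which depend on the previous ones within
    -- `2Δ = R`. As the update completes a time step, `h r + 1` is a multiple of `v`, and `ctrl`
    -- there is a `syncState`.
    rw [hx.A_present ha hσ hr', ← ctrl_mul]
    congr 1
    have := Nat.div_add_mod (h r) v
    rw [add_mul, one_mul, mul_comm]
    omega
  · rfl

include hx in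
theorem Follows.totalFb_advance :
    𝒟.totalFb τ (fun r' => Function.update h r (h r + 1) r' / v) =
      (if h r % v + 1 = v then 𝒟.fb τ (h r / v) r else 1) * 𝒟.totalFb τ (fun r' => h r' / v) := by
  have h1 : (fun r' => Function.update h r (h r + 1) r' / v) =
      Function.update (fun r' => h r' / v) r ((h r + 1) / v) := by
    funext r'
    by_cases e : r' = r
    · subst e; simp
    · simp [e]
  rw [h1]
  split_ifs with hv
  · rw [div_succ_of_mod hv]
    refine 𝒟.totalFb_update fun r' hr' hb => ?_
    have h2 := hx.le_succ (ball_mono r (show 𝒟.range ≤ 2 * 𝒟.range by omega) hb)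
    have h3 := (Nat.div_le_div_right (c := v) h2).trans (div_succ_le _ _)
    exact absurd hr' (not_lt.mpr h3)
  · rw [div_succ_of_mod_ne (NeZero.pos v) hv, one_mul]
    congr 1
    exact Function.update_eq_self r fun r' => h r' / v

/-- Neighbours have height at most `h r + 1`, so none is a full time step ahead of `r` once `r` has
completed one. This justifies the reset of `sFut` to 1. -/
theorem futureSyn_update_self (hr : ∀ r' ∈ ball r (2 * 𝒟.range), h r' ≤ h r + 1) :
    𝒟.futureSyn τ (Function.update h r (h r + 1)) r =
      if h r % v + 1 = v then 1 else 𝒟.futureSyn τ h r := by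
  unfold futureSyn
  rw [Function.update_self]
  split_ifs with hv
  · refine Finset.prod_eq_one fun r' _ => ?_
    by_cases hb : r ∈ ball r' 𝒟.range
    · rw [if_neg]
      rw [not_lt]
      by_cases e : r' = r
      · subst e; simp
      · rw [Function.update_of_ne e]
        exact Nat.div_le_div_right (hr r' (ball_mono r (by omega) (mem_ball_comm.mp hb)))
    · rw [𝒟.syndrome_fb_eq_one τ _ hb, ite_self]
  · rw [div_succ_of_mod_ne (NeZero.pos v) hv]
    refine Finset.prod_congr rfl fun r' _ => ?_
    by_cases e : r' = r
    · subst e; simp [div_succ_of_mod_ne (NeZero.pos v) hv]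
    · rw [Function.update_of_ne e]

open Classical in
-- The update of `r` adds a premature syndrome at `r'` only if it completes a time step that `r'`
-- has not completed. For `r'` in range this forces equal heights, which is the condition `lag = 0`
-- in the rule; if `r'` is one update ahead, it has completed the same step already.
theorem futureSyn_update_of_ne {r' : Site D L} (e : r' ≠ r)
    (hr : r' ∈ ball r 𝒟.range → h r ≤ h r' ∧ h r' ≤ h r + 1) :
    𝒟.futureSyn τ (Function.update h r (h r + 1)) r' =
      if r' ∈ ball r 𝒟.range ∧ h r' = h r then
        𝒟.futureSyn τ h r' *
          𝒞.syndrome (if h r % v + 1 = v then 𝒟.fb τ (h r / v) r else 1) r'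
      else 𝒟.futureSyn τ h r' := by
  unfold futureSyn
  rw [Function.update_of_ne e, ← Finset.mul_prod_erase _ _ (Finset.mem_univ r),
    ← Finset.mul_prod_erase (a := r)
      (f := fun r'' => if h r' / v < h r'' / v then 𝒞.syndrome (𝒟.fb τ (h r' / v) r'') r' else 1)
      _ (Finset.mem_univ r), Function.update_self]
  have h1 : ∏ r'' ∈ Finset.univ.erase r, (if h r' / v < Function.update h r (h r + 1) r'' / v then
      𝒞.syndrome (𝒟.fb τ (h r' / v) r'') r' else 1) = ∏ r'' ∈ Finset.univ.erase r,
      (if h r' / v < h r'' / v then 𝒞.syndrome (𝒟.fb τ (h r' / v) r'') r' else 1) :=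
    Finset.prod_congr rfl fun r'' hr'' => by
      rw [Function.update_of_ne (Finset.ne_of_mem_erase hr'')]
  rw [h1]
  by_cases hb : r' ∈ ball r 𝒟.range
  · obtain ⟨h2, h3⟩ := hr hb
    have h4 : h r / v ≤ h r' / v := Nat.div_le_div_right h2
    rw [if_neg (not_lt.mpr h4), one_mul]
    by_cases hv : h r % v + 1 = v
    · rw [div_succ_of_mod hv, if_pos hv]
      by_cases h5 : h r' = h r
      · rw [h5, if_pos (show h r / v < h r / v + 1 by omega), if_pos ⟨hb, rfl⟩, mul_comm]
      · have h6 : h r' / v = h r / v + 1 := by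
          rw [show h r' = h r + 1 by omega, div_succ_of_mod hv]
        rw [if_neg (show ¬ h r' / v < h r / v + 1 by omega), one_mul,
          if_neg (show ¬ (r' ∈ ball r 𝒟.range ∧ h r' = h r) from fun h7 => h5 h7.2)]
    · rw [div_succ_of_mod_ne (NeZero.pos v) hv, if_neg (not_lt.mpr h4), if_neg hv, one_mul,
        StabilizerCode.syndrome_one, Pi.one_apply, mul_one, ite_self]
  · simp [𝒟.syndrome_fb_eq_one τ _ hb, hb]

include hx ha hσ in
theorem Follows.update : 𝒟.Follows τ (Function.update h r (h r + 1)) (𝒟.asyncA r x σ) := by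
  classical
  have hacc : Accepted x r := (hx.accepted_iff r).mpr fun r' hr' => ha r' (𝒟.mem_nbhd.mp hr')
  have hself : 𝒟.asyncA r x σ r =
      { mOld := (x r).mNew
        mNew := 𝒟.A (mPresent x r) (sPresent x r σ) r
        sOld := newSyn x r σ r
        sNew := newSyn x r σ r
        sFut := if (x r).u.val + 1 = v then 1 else (x r).sFut
        lag := fun d => lagSucc ((x r).lag d)
        u := (x r).u + 1 } := by
    unfold asyncA
    rw [if_pos hacc, if_pos rfl]
  have hother : ∀ r', r' ≠ r → 𝒟.asyncA r x σ r' =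
      { x r' with
        sNew := newSyn x r σ r'
        sFut :=
          if r' ∈ ball r 𝒟.range ∧ lagTo x r r' = 0 then
            (x r').sFut * 𝒞.syndrome (𝒟.asyncF r x σ) r'
          else (x r').sFut
        lag := fun d => if d.val = r - r' then lagPred ((x r').lag d) else (x r').lag d } := by
    intro r' e
    unfold asyncA
    rw [if_pos hacc, if_neg e]
  refine ⟨?_, ?_, ?_, ?_, ?_⟩
  · intro a b hb
    by_cases hab : b = a
    · subst hab; rw [lagTo_self]; simp
    have hcond : b - a ≠ 0 ∧ torusDist 0 (b - a) ≤ 2 * 𝒟.range := by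
      refine ⟨sub_ne_zero.mpr hab, ?_⟩
      rw [torusDist_zero_sub]
      exact mem_ball_comm.mp hb
    have hlag := hx.lag a b hb
    unfold lagTo at hlag ⊢
    rw [dif_pos hcond] at hlag ⊢
    by_cases hra : a = r
    · subst hra
      have h1 := ha b hb
      rw [hself, Function.update_self, Function.update_of_ne hab]
      rw [lagSucc_cast (by omega), hlag]
      push_cast
      ring
    · rw [hother a hra, Function.update_of_ne hra]
      by_cases hrb : b = r
      · subst hrb
        have h1 := ha a (mem_ball_comm.mp hb)
        simp only [if_true, Function.update_self]
        rw [lagPred_cast (by omega), hlag]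
        push_cast
        ring
      · have : ¬ b - a = r - a := fun h' => hrb (sub_left_injective h')
        simp only [this, if_false]
        rw [Function.update_of_ne hrb, hlag]
  · intro a
    by_cases hra : a = r
    · subst hra
      rw [hself, Function.update_self]
      simp only
      rw [Fin.val_add, Fin.val_one', hx.u, ← Nat.add_mod]
    · rw [hother a hra, Function.update_of_ne hra]
      exact hx.u a
  · intro a
    by_cases hra : a = r
    · subst hra
      rw [hself, Function.update_self]
      exact hx.A_present ha hσ (mem_ball_self _ _)
    · rw [hother a hra, Function.update_of_ne hra]
      exact hx.mNew a
  · intro a n hn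
    by_cases hra : a = r
    · subst hra
      rw [Function.update_self] at hn
      obtain rfl : h a = n := by omega
      rw [hself]
      exact ⟨hx.mNew a, hx.newSyn_eq ha hσ (mem_ball_self _ _) rfl⟩
    · rw [Function.update_of_ne hra] at hn
      rw [hother a hra]
      exact hx.old a n hn
  · intro a
    by_cases hra : a = r
    · subst hra
      rw [hself, 𝒟.futureSyn_update_self fun r' hr' => hx.le_succ hr']
      simp only [hx.u, hx.fut]
    · rw [hother a hra, 𝒟.futureSyn_update_of_ne hra]
      · simp only [hx.fut, hx.asyncF_eq ha hσ]
        refine if_congr ?_ rfl rfl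
        refine and_congr_right fun hb => ?_
        have h1 := hx.lag r a (ball_mono r (by omega) hb)
        rw [← signType_cast_eq_zero, h1]
        omega
      · intro hb
        have hb2 := ball_mono r (show 𝒟.range ≤ 2 * 𝒟.range by omega) hb
        exact ⟨ha a hb2, hx.le_succ hb2⟩

end Present

theorem Follows.asyncA_of_not_accepted (hx : 𝒟.Follows τ h x) {r : Site D L}
    (hacc : ¬ Accepted x r) : 𝒟.Follows τ h (𝒟.asyncA r x σ) := by
  have he : 𝒟.asyncA r x σ = fun r' => { x r' with sNew := newSyn x r σ r' } := by
    funext r'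
    unfold asyncA
    rw [if_neg hacc]
  rw [he]
  exact ⟨hx.lag, hx.u, hx.mNew, hx.old, hx.fut⟩

theorem Follows.advance (hx : 𝒟.Follows τ h x) {r : Site D L}
    (hσ : ∀ r' ∈ ball r (2 * 𝒟.range), σ r' = 𝒟.quantumSyn τ h r') :
    𝒟.Follows τ (advance 𝒟.nbhd r h) (𝒟.asyncA r x σ) ∧
      𝒟.totalFb τ (fun r' => AutomatonDecoder.advance 𝒟.nbhd r h r' / v) =
        𝒟.asyncF r x σ * 𝒟.totalFb τ (fun r' => h r' / v) := by
  unfold AutomatonDecoder.advance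
  by_cases hacc : Accepted x r
  · have ha := (hx.accepted_iff r).mp hacc
    rw [if_pos ha]
    have ha' : ∀ r' ∈ ball r (2 * 𝒟.range), h r ≤ h r' := fun r' hr' => ha r' (𝒟.mem_nbhd.mpr hr')
    exact ⟨hx.update ha' hσ, by rw [hx.asyncF_eq ha' hσ, hx.totalFb_advance]⟩
  · rw [if_neg fun ha => hacc ((hx.accepted_iff r).mpr ha)]
    refine ⟨hx.asyncA_of_not_accepted hacc, ?_⟩
    rw [asyncF, if_neg fun h' => hacc h'.1, one_mul]

end SyncDecoder

end

section

variable {D L : ℕ} [NeZero L] {Δ : ℕ} {𝒞 : StabilizerCode D L Δ}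

namespace LindbladianDecoder

variable {N : Type*} [Fintype N] [DecidableEq N] (𝒟 : LindbladianDecoder 𝒞 N)

/-! ## States after a history of proposed updates -/

/-- The state after the proposed updates in a history. -/
def histState (ρ : QMat D L) (l : List (Site D L)) : State D L N :=
  l.foldr 𝒟.updateChannel (𝒟.initial ρ)

theorem trajectory_eq (ρ : QMat D L) (ω : Clock D L) (k : ℕ) :
    𝒟.trajectory ρ ω k = 𝒟.histState ρ (hist ω k) := by
  induction k with
  | zero => rfl
  | succ k ih => rw [trajectory, ih]; rfl

theorem feedback_mem_syndromeGroup (r : Site D L) (m : Site D L → N) (σ : Site D L → ℤˣ) :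
    𝒟.feedback r m σ ∈ 𝒞.syndromeGroup := ⟨𝒟.feedback_unitary r m σ, 𝒟.feedback_syndrome r m σ⟩

variable {τ : Site D L → ℤˣ} {ρ : QMat D L}

theorem exists_histState_eq (h : 𝒞.InSector τ ρ) (l : List (Site D L)) :
    ∃ U ∈ 𝒞.syndromeGroup, ∃ c, 𝒟.histState ρ l = ketBra (U * ρ * Uᴴ) c c := by
  induction l with
  | nil => exact ⟨1, one_mem _, (𝒟.init, 1), by simp [histState, initial, ketBra]⟩
  | cons r l ih =>
    obtain ⟨U, hU, c, hc⟩ := ih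
    have h1 := 𝒟.updateChannel_ketBra (h.conj hU) r c
    rw [← hc] at h1
    refine ⟨𝒟.feedback r c.1 (𝒟.seen r (τ * 𝒞.syndrome U) c.2) * U,
      mul_mem (𝒟.feedback_mem_syndromeGroup _ _ _) hU,
      𝒟.after r (fun x => (τ * 𝒞.syndrome U) x) c, h1.trans ?_⟩
    simp only [Matrix.conjTranspose_mul, mul_assoc]

theorem norm_histState_apply_le (h : 𝒞.InSector τ ρ) (l : List (Site D L))
    (i j : QBasis D L × Cl D L N) : ‖𝒟.histState ρ l i j‖ ≤ ∑ d, ∑ c, ‖ρ c d‖ := by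
  obtain ⟨U, hU, c, hc⟩ := 𝒟.exists_histState_eq h l
  have h1 : ∀ a b, ‖U a b‖ ≤ 1 := entry_norm_bound_of_unitary hU.1
  have h2 : ∀ a b, ‖(U * ρ * Uᴴ) a b‖ ≤ ∑ d, ∑ c, ‖ρ c d‖ := by
    intro a b
    rw [Matrix.mul_apply]
    refine (norm_sum_le _ _).trans (Finset.sum_le_sum fun d _ => ?_)
    rw [norm_mul, Matrix.mul_apply, Matrix.conjTranspose_apply, norm_star]
    refine (mul_le_of_le_one_right (norm_nonneg _) (h1 _ _)).trans ?_
    refine (norm_sum_le _ _).trans (Finset.sum_le_sum fun c _ => ?_)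
    rw [norm_mul]
    exact mul_le_of_le_one_left (norm_nonneg _) (h1 _ _)
  rw [hc, ketBra, Matrix.kroneckerMap_apply, norm_mul]
  refine (mul_le_of_le_one_right (norm_nonneg _) ?_).trans (h2 _ _)
  rw [Matrix.single_apply]
  split_ifs <;> simp

/-- Histories act on `ρ` by unitaries, whose entries have norm at most 1, so the bound is uniform in
the history. This makes the exponential series converge. -/
theorem exists_norm_histState_le (h : 𝒞.InSector τ ρ) (f : State D L N →ₗ[ℂ] ℂ) :
    ∃ B : ℝ, ∀ l, ‖f (𝒟.histState ρ l)‖ ≤ B := by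
  classical
  refine ⟨∑ i, ∑ j, (∑ d, ∑ c, ‖ρ c d‖) * ‖f (Matrix.single i j 1)‖, fun l => ?_⟩
  have h1 : f (𝒟.histState ρ l) =
      ∑ i, ∑ j, 𝒟.histState ρ l i j * f (Matrix.single i j 1) := by
    conv_lhs => rw [Matrix.matrix_eq_sum_single (𝒟.histState ρ l)]
    simp only [map_sum]
    refine Finset.sum_congr rfl fun i _ => Finset.sum_congr rfl fun j _ => ?_
    rw [← smul_eq_mul, ← map_smul, Matrix.smul_single, smul_eq_mul, mul_one]
  rw [h1]
  refine (norm_sum_le _ _).trans (Finset.sum_le_sum fun i _ => ?_)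
  refine (norm_sum_le _ _).trans (Finset.sum_le_sum fun j _ => ?_)
  rw [norm_mul]
  exact mul_le_mul_of_nonneg_right (𝒟.norm_histState_apply_le h l i j) (norm_nonneg _)

/-! ## The Lindbladian evolution as an average over histories -/

/-- The Lindbladian, as a linear map. -/
def lindbladianLin : Module.End ℂ (State D L N) where
  toFun := 𝒟.lindbladian
  map_add' X Y := by
    simp only [lindbladian, mul_add, add_mul, ← Finset.sum_add_distrib]
    refine Finset.sum_congr rfl fun r _ => Finset.sum_congr rfl fun i _ => ?_
    module
  map_smul' a X := by
    simp only [lindbladian, mul_smul_comm, smul_mul_assoc, Finset.smul_sum, RingHom.id_apply]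
    refine Finset.sum_congr rfl fun r _ => Finset.sum_congr rfl fun i _ => ?_
    module

theorem lindbladian_iterate (k : ℕ) (X : State D L N) :
    𝒟.lindbladian^[k] X = (𝒟.lindbladianLin ^ k) X := by
  rw [Module.End.pow_apply]
  rfl

/-- The sum of the channels by which updates act, as a linear map. -/
def updateLin : Module.End ℂ (State D L N) where
  toFun X := ∑ r, 𝒟.updateChannel r X
  map_add' X Y := by
    simp only [updateChannel, mul_add, add_mul, Finset.sum_add_distrib, smul_add]
  map_smul' a X := by
    simp only [updateChannel, mul_smul_comm, smul_mul_assoc, ← Finset.smul_sum, RingHom.id_apply]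
    exact smul_comm (𝒟.μ : ℂ) a _

theorem updateLin_pow_histState (k : ℕ) (l : List (Site D L)) :
    (𝒟.updateLin ^ k) (𝒟.histState ρ l) = sumSeq k (𝒟.histState ρ) l := by
  induction k generalizing l with
  | zero => rfl
  | succ k ih =>
    rw [pow_succ, Module.End.mul_apply]
    change (𝒟.updateLin ^ k) (∑ r, 𝒟.histState ρ (r :: l)) = _
    rw [map_sum]
    exact Finset.sum_congr rfl fun r _ => ih (r :: l)

/-- The Poisson form of the generator is established only on states with definite syndromes and
registers. It extends to powers because the span of the states after all histories is invariant. -/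
theorem lindbladian_pow_initial (h : 𝒞.InSector τ ρ) (k : ℕ) :
    (𝒟.lindbladianLin ^ k) (𝒟.initial ρ) =
      (((𝒟.μ : ℂ)⁻¹ • (𝒟.updateLin - (((Fintype.card (Site D L) : ℝ) : ℂ)) •
        (1 : Module.End ℂ (State D L N)))) ^ k) (𝒟.initial ρ) := by
  set G : Module.End ℂ (State D L N) := (𝒟.μ : ℂ)⁻¹ • (𝒟.updateLin -
    (((Fintype.card (Site D L) : ℝ) : ℂ)) • (1 : Module.End ℂ (State D L N))) with hG
  let S : Submodule ℂ (State D L N) := Submodule.span ℂ (Set.range (𝒟.histState ρ))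
  have h1 : ∀ l, 𝒟.lindbladianLin (𝒟.histState ρ l) = G (𝒟.histState ρ l) := by
    intro l
    obtain ⟨U, hU, c, hc⟩ := 𝒟.exists_histState_eq h l
    rw [hc]
    refine (𝒟.lindbladian_ketBra (h.conj hU) c).trans ?_
    simp [hG, updateLin]
    rfl
  have h2 : ∀ X ∈ S, 𝒟.lindbladianLin X = G X := by
    intro X hX
    refine LinearMap.eqOn_span (s := Set.range (𝒟.histState ρ)) ?_ hX
    rintro _ ⟨l, rfl⟩
    exact h1 l
  have h3 : ∀ X ∈ S, G X ∈ S := by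
    intro X hX
    have : S ≤ S.comap G := by
      refine Submodule.span_le.mpr ?_
      rintro _ ⟨l, rfl⟩
      refine S.smul_mem _ (S.sub_mem (S.sum_mem fun r _ => Submodule.subset_span ⟨r :: l, rfl⟩)
        (S.smul_mem _ (Submodule.subset_span ⟨l, rfl⟩)))
    exact this hX
  have h4 : ∀ k, (G ^ k) (𝒟.initial ρ) ∈ S ∧
      (𝒟.lindbladianLin ^ k) (𝒟.initial ρ) = (G ^ k) (𝒟.initial ρ) := by
    intro k
    induction k with
    | zero => exact ⟨Submodule.subset_span ⟨[], rfl⟩, rfl⟩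
    | succ k ih =>
      rw [pow_succ', pow_succ', Module.End.mul_apply, Module.End.mul_apply, ih.2]
      exact ⟨h3 _ ih.1, h2 _ ih.1⟩
  exact (h4 k).2

theorem hasSum_functional (h : 𝒞.InSector τ ρ) (f : State D L N →ₗ[ℂ] ℂ) (t : ℝ) :
    HasSum (fun k : ℕ => f (((t ^ k / k.factorial : ℝ) : ℂ) • 𝒟.lindbladian^[k] (𝒟.initial ρ)))
      (Complex.exp (-(Fintype.card (Site D L) * t / 𝒟.μ : ℝ)) *
        ∑' k : ℕ, ((t / 𝒟.μ : ℂ) ^ k / k.factorial) *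
          sumSeq k (fun l => f (𝒟.histState ρ l)) []) := by
  obtain ⟨B, hB⟩ := 𝒟.exists_norm_histState_le h f
  have h1 : ∀ k, f ((𝒟.updateLin ^ k) (𝒟.initial ρ)) =
      sumSeq k (fun l => f (𝒟.histState ρ l)) [] := fun k => by
    rw [← map_sumSeq, ← updateLin_pow_histState]
    rfl
  have h2 : ∀ k, ‖f ((𝒟.updateLin ^ k) (𝒟.initial ρ))‖ ≤ B * (Fintype.card (Site D L) : ℝ) ^ k := by
    intro k
    rw [h1]
    refine (norm_sumSeq_le _ _ _).trans ((sumSeq_le hB []).trans (le_of_eq ?_))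
    rw [sumSeq_const, nsmul_eq_mul, mul_comm]
    push_cast
    rfl
  have h3 := hasSum_exp_series 𝒟.updateLin f (𝒟.initial ρ) (μ := 𝒟.μ) h2 t
  simp only [h1] at h3
  refine (congrArg₂ (fun g y => HasSum g y) (funext fun k => ?_) rfl).mpr h3
  rw [lindbladian_iterate, 𝒟.lindbladian_pow_initial h, map_smul, smul_eq_mul]
  push_cast
  rfl

theorem hasSum_evolve (h : 𝒞.InSector τ ρ) (t : ℝ) :
    HasSum (fun k : ℕ => ((t ^ k / k.factorial : ℝ) : ℂ) • 𝒟.lindbladian^[k] (𝒟.initial ρ))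
      (𝒟.evolve ρ t) := by
  refine Summable.hasSum (Pi.summable.mpr fun i => Pi.summable.mpr fun j => ?_)
  exact (𝒟.hasSum_functional h (Matrix.entryLinearMap ℂ ℂ i j) t).summable

/-- The entries of the quantum marginal, as linear functionals. -/
def trClEntry (a b : QBasis D L) : State D L N →ₗ[ℂ] ℂ where
  toFun X := trCl X a b
  map_add' X Y := by
    simp [trCl, block, Matrix.sum_apply, Finset.sum_add_distrib]
  map_smul' z X := by
    simp [trCl, block, Matrix.sum_apply, Finset.mul_sum]

theorem continuous_trClEntry (a b : QBasis D L) :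
    Continuous (trClEntry a b : State D L N →ₗ[ℂ] ℂ) := by
  have : (trClEntry a b : State D L N →ₗ[ℂ] ℂ) = fun X : State D L N => ∑ c, X (a, c) (b, c) := by
    funext X
    simp [trClEntry, trCl, block, Matrix.sum_apply]
  rw [this]
  fun_prop

theorem output_apply (h : 𝒞.InSector τ ρ) (t : ℝ) (a b : QBasis D L) :
    𝒟.output ρ t a b = Complex.exp (-(Fintype.card (Site D L) * t / 𝒟.μ : ℝ)) *
        ∑' k : ℕ, ((t / 𝒟.μ : ℂ) ^ k / k.factorial) *
          sumSeq k (fun l => trCl (𝒟.histState ρ l) a b) [] :=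
  ((𝒟.hasSum_evolve h t).map (trClEntry a b) (continuous_trClEntry a b)).unique
    (𝒟.hasSum_functional h (trClEntry a b) t)

/-- A mixture over noise has no definite syndromes, so its series is obtained by adding those of the
components, whose convergence is known sector by sector. -/
theorem output_sum {ι : Type*} [Fintype ι] (w : ι → ℂ) (ρ : ι → QMat D L) (τ : ι → Site D L → ℤˣ)
    (h : ∀ i, 𝒞.InSector (τ i) (ρ i)) (t : ℝ) :
    𝒟.output (∑ i, w i • ρ i) t = ∑ i, w i • 𝒟.output (ρ i) t := by
  have h1 : HasSum (fun k : ℕ => ((t ^ k / k.factorial : ℝ) : ℂ) •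
      𝒟.lindbladian^[k] (𝒟.initial (∑ i, w i • ρ i))) (∑ i, w i • 𝒟.evolve (ρ i) t) := by
    have h2 := hasSum_sum (s := Finset.univ) fun i _ => (𝒟.hasSum_evolve (h i) t).const_smul (w i)
    refine (congrArg₂ (fun g y => HasSum g y) (funext fun k => ?_) rfl).mpr h2
    have h3 : 𝒟.initial (∑ i, w i • ρ i) = ∑ i, w i • 𝒟.initial (ρ i) := by
      ext i j
      simp only [initial, Matrix.kroneckerMap_apply, Matrix.sum_apply, Matrix.smul_apply,
        Finset.sum_mul, smul_mul_assoc]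
    rw [h3]
    simp only [lindbladian_iterate, map_sum, map_smul, Finset.smul_sum]
    exact Finset.sum_congr rfl fun i _ => smul_comm _ _ _
  have h4 : 𝒟.evolve (∑ i, w i • ρ i) t = ∑ i, w i • 𝒟.evolve (ρ i) t := h1.tsum_eq
  ext a b
  change trClEntry a b (𝒟.evolve _ t) = _
  rw [h4, map_sum, Matrix.sum_apply]
  exact Finset.sum_congr rfl fun i _ => map_smul _ _ _

open Classical in
/-- If almost all histories lead to the same quantum state, the evolution converges to it. -/
theorem tendsto_output (h : 𝒞.InSector τ ρ) {P : List (Site D L) → Prop} {ρ' : QMat D L}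
    (hP : ∀ l, ¬ P l → trCl (𝒟.histState ρ l) = ρ')
    (hlim : Tendsto (fun k => sumSeq k (fun l => if P l then (1 : ℝ) else 0) [] /
      (Fintype.card (Site D L) : ℝ) ^ k) atTop (𝓝 0)) :
    Tendsto (𝒟.output ρ) atTop (𝓝 ρ') := by
  refine tendsto_pi_nhds.mpr fun a => tendsto_pi_nhds.mpr fun b => ?_
  have hN : (0 : ℝ) < Fintype.card (Site D L) := by exact_mod_cast Fintype.card_pos
  obtain ⟨B, hB⟩ := 𝒟.exists_norm_histState_le h (trClEntry a b)
  set b' : ℕ → ℂ := fun k => sumSeq k (fun l => trCl (𝒟.histState ρ l) a b) [] with hb'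
  -- The average over histories of length `k` differs from `ρ'` only through those satisfying `P`,
  -- each contributing a bounded amount.
  have h1 : Tendsto (fun k => b' k / ((Fintype.card (Site D L) : ℝ) : ℂ) ^ k) atTop
      (𝓝 (ρ' a b)) := by
    rw [tendsto_iff_norm_sub_tendsto_zero]
    refine squeeze_zero (g := fun k => (B + ‖ρ' a b‖) * (sumSeq k
      (fun l => if P l then (1 : ℝ) else 0) [] / (Fintype.card (Site D L) : ℝ) ^ k))
      (fun _ => norm_nonneg _) (fun k => ?_) (by simpa using hlim.const_mul (B + ‖ρ' a b‖))
    have h2 : b' k / ((Fintype.card (Site D L) : ℝ) : ℂ) ^ k - ρ' a b =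
        (sumSeq k (fun l => trCl (𝒟.histState ρ l) a b - ρ' a b) []) /
          ((Fintype.card (Site D L) : ℝ) : ℂ) ^ k := by
      have hN' : ((Fintype.card (Site D L) : ℝ) : ℂ) ^ k ≠ 0 := by
        exact pow_ne_zero _ (by exact_mod_cast hN.ne')
      simp only [sub_eq_add_neg]
      rw [sumSeq_add, sumSeq_const]
      field_simp
      simp [hb']
    rw [h2, norm_div, norm_pow, Complex.norm_real, Real.norm_eq_abs, abs_of_pos hN, ← mul_div_assoc]
    refine div_le_div_of_nonneg_right ?_ (by positivity)
    refine (norm_sumSeq_le _ _ _).trans ?_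
    rw [← sumSeq_mul]
    refine sumSeq_le (fun l => ?_) _
    split_ifs with hl
    · rw [mul_one]
      exact (norm_sub_le _ _).trans (add_le_add (hB l) le_rfl)
    · simp [hP l hl]
  -- The number of proposals up to time `t` is Poisson with parameter `N t / μ`.
  have h3 := (tendsto_poisson_average h1).comp
    (tendsto_id.const_mul_atTop (div_pos hN 𝒟.μ_pos))
  refine h3.congr fun t => ?_
  rw [𝒟.output_apply h]
  simp only [Function.comp, id]
  congr 1
  · congr 1
    push_cast
    ring
  · refine tsum_congr fun k => ?_
    have hN' : ((Fintype.card (Site D L) : ℝ) : ℂ) ≠ 0 := by exact_mod_cast hN.ne'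
    change _ = _ * b' k
    push_cast at hN' ⊢
    rw [mul_pow, div_pow]
    field_simp
    rw [div_pow]
    ring

end LindbladianDecoder

end

section

variable {D L : ℕ} [NeZero L] {Δ : ℕ} {𝒞 : StabilizerCode D L Δ}

namespace SyncDecoder

/-! ## The size of the neighbourhoods -/

section Neighbourhood

variable {M : Type*} {v : ℕ} [NeZero v] (𝒟 : SyncDecoder 𝒞 M v)

theorem nbhd_symm (r r' : Site D L) (h : r' ∈ 𝒟.nbhd r) : r ∈ 𝒟.nbhd r' :=
  𝒟.mem_nbhd.mpr (mem_ball_comm.mp (𝒟.mem_nbhd.mp h))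

/-- Minimal representatives of the displacements embed the ball of radius `2R = 4Δ` into a box of
side `8Δ + 1`. The bound does not depend on `L`, which makes the constants uniform. -/
theorem card_nbhd_le (r : Site D L) : (𝒟.nbhd r).card ≤ (8 * Δ + 1) ^ D := by
  have h := Finset.card_le_card_of_injOn (s := 𝒟.nbhd r)
    (t := Fintype.piFinset fun _ : Fin D => Finset.Icc (-(4 * Δ : ℤ)) (4 * Δ))
    (fun r' a => (r' a - r a).valMinAbs) ?_ ?_
  · refine h.trans (le_of_eq ?_)
    rw [Fintype.card_piFinset, Finset.prod_const, Finset.card_univ, Fintype.card_fin, Int.card_Icc]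
    congr 1
    omega
  · intro r' hr'
    have h1 := (torusDist_le_iff _ _ _).mp (𝒟.mem_nbhd.mp hr')
    simp only [Finset.mem_coe, Fintype.mem_piFinset, Finset.mem_Icc]
    intro a
    have h2 := h1 a
    unfold range at h2
    omega
  · intro r' _ r'' _ he
    funext a
    have h1 := congrFun he a
    exact sub_left_injective (ZMod.injective_valMinAbs h1)

end Neighbourhood

/-! ## The state of the desynchronized decoder -/

variable {M : Type*} {v : ℕ} [NeZero v] (𝒟 : SyncDecoder 𝒞 M v)
  {μ : ℝ} (hμ : 0 < μ) {τ : Site D L → ℤˣ} {ρ : QMat D L}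

theorem follows_init : 𝒟.Follows τ 0 (𝒟.desynchronize μ hμ).init := by
  refine ⟨?_, ?_, ?_, ?_, ?_⟩
  · intro r r' _
    unfold lagTo
    split_ifs <;> simp [desynchronize]
  · intro r
    simp [desynchronize]
  · intro r
    simp [desynchronize, ctrl_zero]
  · intro r n hn
    simp at hn
  · intro r
    simp [desynchronize, futureSyn]

theorem totalFb_mem_syndromeGroup (k : Site D L → ℕ) : 𝒟.totalFb τ k ∈ 𝒞.syndromeGroup :=
  𝒟.layers_mem_syndromeGroup k _

variable [Fintype M] [DecidableEq M]

/-- The syndromes measured in the state conjugated by `totalFb` are `quantumSyn`, as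
`Follows.advance` requires, so the induction closes. The stored syndromes `σ` are left unspecified
because an update overwrites them wherever it reads them. -/
theorem desynchronize_histState (h : 𝒞.InSector τ ρ) (l : List (Site D L)) :
    ∃ x σ, 𝒟.Follows τ (heights 𝒟.nbhd l) x ∧
      (𝒟.desynchronize μ hμ).histState ρ l =
        ketBra (𝒟.totalFb τ (fun r => heights 𝒟.nbhd l r / v) * ρ *
          (𝒟.totalFb τ (fun r => heights 𝒟.nbhd l r / v))ᴴ) (x, σ) (x, σ) := by
  induction l with
  | nil =>
    refine ⟨_, 1, 𝒟.follows_init hμ, ?_⟩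
    have : (fun r : Site D L => heights 𝒟.nbhd [] r / v) = 0 := by
      funext r
      simp [heights]
    rw [this, totalFb_zero, one_mul, Matrix.conjTranspose_one, mul_one]
    rfl
  | cons r l ih =>
    obtain ⟨x, σ, hx, hs⟩ := ih
    have h1 := (𝒟.desynchronize μ hμ).updateChannel_ketBra
      (h.conj (𝒟.totalFb_mem_syndromeGroup (τ := τ) fun r => heights 𝒟.nbhd l r / v)) r (x, σ)
    rw [← hs] at h1
    set s := (𝒟.desynchronize μ hμ).seen r
      (τ * 𝒞.syndrome (𝒟.totalFb τ fun r => heights 𝒟.nbhd l r / v)) σ with hs'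
    obtain ⟨h2, h3⟩ := hx.advance (r := r) (σ := s) fun r' hr' =>
      (𝒟.desynchronize μ hμ).seen_of_mem hr' _ _
    refine ⟨_, s * 𝒞.syndrome (𝒟.asyncF r x s), h2, h1.trans ?_⟩
    change _ = ketBra (𝒟.totalFb τ (fun r' => advance 𝒟.nbhd r (heights 𝒟.nbhd l) r' / v) * ρ *
      (𝒟.totalFb τ fun r' => advance 𝒟.nbhd r (heights 𝒟.nbhd l) r' / v)ᴴ) _ _
    rw [h3]
    simp only [Matrix.conjTranspose_mul, mul_assoc]
    rfl

theorem trCl_desynchronize_histState (h : 𝒞.InSector τ ρ) (l : List (Site D L)) :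
    trCl ((𝒟.desynchronize μ hμ).histState ρ l) =
      𝒟.totalFb τ (fun r => heights 𝒟.nbhd l r / v) * ρ *
        (𝒟.totalFb τ (fun r => heights 𝒟.nbhd l r / v))ᴴ := by
  obtain ⟨x, σ, -, hs⟩ := 𝒟.desynchronize_histState hμ h l
  rw [hs, trCl_ketBra]

theorem anyonFree_trajectory_iff (h : 𝒞.InSector τ ρ) (ht : ρ.trace = 1)
    (ω : LindbladianDecoder.Clock D L) (k : ℕ) :
    𝒞.AnyonFree (trCl ((𝒟.desynchronize μ hμ).trajectory ρ ω k)) ↔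
      𝒟.quantumSyn τ (heights 𝒟.nbhd (hist ω k)) = 1 := by
  have hU := 𝒟.totalFb_mem_syndromeGroup (τ := τ) fun r => heights 𝒟.nbhd (hist ω k) r / v
  rw [LindbladianDecoder.trajectory_eq, 𝒟.trCl_desynchronize_histState hμ h,
    (h.conj hU).anyonFree_iff ((StabilizerCode.trace_conj hU.1).trans ht)]
  rfl

/-! ## Decoding times for fixed syndromes -/

theorem le_div_of_not_lagging {T : ℕ} {l : List (Site D L)} (hl : ¬ Lagging 𝒟.nbhd (T * v) l)
    (r : Site D L) : T ≤ heights 𝒟.nbhd l r / v := by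
  rw [Nat.le_div_iff_mul_le (NeZero.pos v)]
  exact not_lt.mp fun hr => hl ⟨r, hr⟩

theorem totalFb_eq_of_not_lagging {T : ℕ} (hT : ∀ j r, T ≤ j → 𝒟.fb τ j r = 1)
    {l : List (Site D L)} (hl : ¬ Lagging 𝒟.nbhd (T * v) l) :
    𝒟.totalFb τ (fun r => heights 𝒟.nbhd l r / v) = 𝒟.syncOp τ T :=
  𝒟.totalFb_eq_syncOp (𝒟.le_div_of_not_lagging hl) hT

theorem quantumSyn_eq_of_not_lagging {T : ℕ} (hT : ∀ j r, T ≤ j → 𝒟.fb τ j r = 1)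
    {l : List (Site D L)} (hl : ¬ Lagging 𝒟.nbhd (T * v) l) :
    𝒟.quantumSyn τ (heights 𝒟.nbhd l) = 𝒟.syn τ T := by
  rw [quantumSyn, 𝒟.totalFb_eq_of_not_lagging hT hl, syndrome_syncOp]

theorem not_lagging_hist_mono {n k k' : ℕ} {ω : LindbladianDecoder.Clock D L}
    (hk : ¬ Lagging 𝒟.nbhd n (hist ω k)) (h : k ≤ k') : ¬ Lagging 𝒟.nbhd n (hist ω k') := by
  rintro ⟨r, hr⟩
  exact hk ⟨r, lt_of_le_of_lt (heights_hist_mono 𝒟.nbhd ω r h) hr⟩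

/-- The waiting times before an event that does not recur once it has failed to occur. -/
theorem tsum_ite_mul_ofReal {P : ℕ → Prop} [DecidablePred P] {w : ℕ → ℝ} {k : ℕ}
    (h1 : ∀ j < k, P j) (h2 : ∀ j, k ≤ j → ¬ P j) (hw : ∀ j, 0 ≤ w j) :
    ∑' j, (if P j then (1 : ℝ≥0∞) else 0) * ENNReal.ofReal (w j) =
      ENNReal.ofReal (∑ j ∈ Finset.range k, w j) := by
  rw [tsum_eq_sum (s := Finset.range k), ENNReal.ofReal_sum_of_nonneg fun j _ => hw j]
  · refine Finset.sum_congr rfl fun j hj => ?_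
    rw [if_pos (h1 j (Finset.mem_range.mp hj)), one_mul]
  · intro j hj
    rw [if_neg (h2 j (by simpa using hj)), zero_mul]

open Classical in
-- From the first moment when no site lags behind `T v`, the quantum syndromes equal the final
-- synchronous ones for ever, so the total lagging time bounds the decoding time.
theorem decodingTime_le (h : 𝒞.InSector τ ρ) (ht : ρ.trace = 1) {T : ℕ}
    (hT : ∀ j r, T ≤ j → 𝒟.fb τ j r = 1) (hsyn : 𝒟.syn τ T = 1)
    {ω : LindbladianDecoder.Clock D L} (hw : ∀ k, 0 ≤ (ω k).1)
    (hω : ∀ n, ∃ k, ¬ Lagging 𝒟.nbhd n (hist ω k)) :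
    (𝒟.desynchronize μ hμ).decodingTime ρ ω ≤
      ∑' k, (if Lagging 𝒟.nbhd (T * v) (hist ω k) then (1 : ℝ≥0∞) else 0) *
        ENNReal.ofReal (ω k).1 := by
  have hk := Nat.find_spec (hω (T * v))
  set k := Nat.find (hω (T * v)) with hk'
  rw [tsum_ite_mul_ofReal (k := k) (fun j hj => not_not.mp (Nat.find_min (hω (T * v)) hj))
    (fun j hj => 𝒟.not_lagging_hist_mono hk hj) hw]
  refine iInf₂_le k fun k' hk' => ?_
  rw [𝒟.anyonFree_trajectory_iff hμ h ht,
    𝒟.quantumSyn_eq_of_not_lagging hT (𝒟.not_lagging_hist_mono hk hk'), hsyn]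

theorem decodingTime_eq_top (h : 𝒞.InSector τ ρ) (ht : ρ.trace = 1) {T : ℕ}
    (hT : ∀ j r, T ≤ j → 𝒟.fb τ j r = 1) (hsyn : 𝒟.syn τ T ≠ 1)
    {ω : LindbladianDecoder.Clock D L} (hω : ∀ n, ∃ k, ¬ Lagging 𝒟.nbhd n (hist ω k)) :
    (𝒟.desynchronize μ hμ).decodingTime ρ ω = ∞ := by
  refine iInf₂_eq_top.mpr fun k hk => ?_
  obtain ⟨k', hk'⟩ := hω (T * v)
  have h1 := hk (max k k') (le_max_left _ _)
  rw [𝒟.anyonFree_trajectory_iff hμ h ht,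
    𝒟.quantumSyn_eq_of_not_lagging hT (𝒟.not_lagging_hist_mono hk' (le_max_right _ _))] at h1
  exact absurd h1 hsyn

theorem decodingTime_eq_zero (h : 𝒞.InSector τ ρ) (ht : ρ.trace = 1)
    (hT : ∀ j r, 𝒟.fb τ j r = 1) (hsyn : τ = 1) (ω : LindbladianDecoder.Clock D L) :
    (𝒟.desynchronize μ hμ).decodingTime ρ ω = 0 := by
  have h0 : ∀ k, 𝒞.AnyonFree (trCl ((𝒟.desynchronize μ hμ).trajectory ρ ω k)) := by
    intro k
    rw [𝒟.anyonFree_trajectory_iff hμ h ht, 𝒟.quantumSyn_eq_of_not_lagging (T := 0)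
      (fun j r _ => hT j r) (by simp [Lagging])]
    exact hsyn
  refine le_antisymm ((iInf₂_le 0 fun k _ => h0 k).trans ?_) bot_le
  simp

/-- The update that completes the time step `T` at `r` changes the syndromes by those of the
feedback operator. -/
theorem quantumSyn_step {T : ℕ} {r a : Site D L} {l : List (Site D L)}
    (hl : heights 𝒟.nbhd l r < (T + 1) * v)
    (hl' : (T + 1) * v ≤ heights 𝒟.nbhd (a :: l) r) :
    𝒟.quantumSyn τ (heights 𝒟.nbhd (a :: l)) =
      𝒟.quantumSyn τ (heights 𝒟.nbhd l) * 𝒞.syndrome (𝒟.fb τ T r) := by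
  have hv := NeZero.pos v
  simp only [heights, advance] at hl' ⊢
  split_ifs at hl' ⊢ with hacc
  · have e : a = r := by
      by_contra e
      rw [Function.update_of_ne (Ne.symm e)] at hl'
      omega
    subst e
    rw [Function.update_self] at hl'
    set h := heights 𝒟.nbhd l with hh
    have h1 : h a + 1 = (T + 1) * v := by omega
    have h2 : (h a + 1) / v = T + 1 := by rw [h1, Nat.mul_div_cancel _ hv]
    have h3 : h a / v = T := by
      have h4 := div_succ_le (h a) v
      have h5 : h a / v < T + 1 := (Nat.div_lt_iff_lt_mul hv).mpr hl
      omega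
    funext b
    rw [Pi.mul_apply, quantumSyn_apply, quantumSyn_apply, mul_assoc,
      ← Finset.mul_prod_erase _ _ (Finset.mem_univ a),
      ← Finset.mul_prod_erase (a := a)
        (f := fun r' => ∏ j ∈ Finset.range (h r' / v), 𝒞.syndrome (𝒟.fb τ j r') b)
        _ (Finset.mem_univ a),
      Function.update_self, h2, h3, Finset.prod_range_succ]
    have h6 : ∏ r' ∈ Finset.univ.erase a, ∏ j ∈ Finset.range (Function.update h a (h a + 1) r' / v),
        𝒞.syndrome (𝒟.fb τ j r') b = ∏ r' ∈ Finset.univ.erase a, ∏ j ∈ Finset.range (h r' / v),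
        𝒞.syndrome (𝒟.fb τ j r') b :=
      Finset.prod_congr rfl fun r' hr' => by
        rw [Function.update_of_ne (Finset.ne_of_mem_erase hr')]
    rw [h6]
    ac_rfl
  · omega

open Classical in
-- When `r` completes time step `T`, the quantum syndromes are multiplied by a nontrivial factor, so
-- the states just before and just after cannot both be anyon-free. Accidental anyon-freeness at an
-- earlier time is harmless, as the decoding time requires it to persist.
theorem le_decodingTime (h : 𝒞.InSector τ ρ) (ht : ρ.trace = 1) {T : ℕ} {r : Site D L}
    (hr : 𝒞.syndrome (𝒟.fb τ T r) ≠ 1)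
    {ω : LindbladianDecoder.Clock D L} (hw : ∀ k, 0 ≤ (ω k).1)
    (hω : ∀ n, ∃ k, ¬ Lagging 𝒟.nbhd n (hist ω k)) :
    ∑' k, (if heights 𝒟.nbhd (hist ω k) r < (T + 1) * v then (1 : ℝ≥0∞) else 0) *
        ENNReal.ofReal (ω k).1 ≤
      (𝒟.desynchronize μ hμ).decodingTime ρ ω := by
  have hex : ∃ k, ¬ heights 𝒟.nbhd (hist ω k) r < (T + 1) * v :=
    (hω ((T + 1) * v)).imp fun k hk hr => hk ⟨r, hr⟩
  have hk := Nat.find_spec hex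
  set k := Nat.find hex with hk'
  have hmono := heights_hist_mono 𝒟.nbhd ω r
  rw [tsum_ite_mul_ofReal (P := fun k => heights 𝒟.nbhd (hist ω k) r < (T + 1) * v) (k := k)
    (fun j hj => not_not.mp (Nat.find_min hex hj))
    (fun j hj hlt => hk (lt_of_le_of_lt (hmono hj) hlt)) hw]
  refine le_iInf₂ fun k₀ hk₀ => ENNReal.ofReal_le_ofReal ?_
  refine Finset.sum_le_sum_of_subset_of_nonneg (Finset.range_subset_range.mpr ?_) fun j _ _ => hw j
  by_contra hlt
  push Not at hlt
  obtain ⟨k₁, hk₁⟩ : ∃ k₁, k = k₁ + 1 := ⟨k - 1, by omega⟩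
  have h1 : heights 𝒟.nbhd (hist ω k₁) r < (T + 1) * v :=
    not_not.mp (Nat.find_min hex (m := k₁) (by omega))
  rw [hk₁] at hk
  have h2 := 𝒟.quantumSyn_step (τ := τ) h1 (not_lt.mp hk)
  have h3 := (𝒟.anyonFree_trajectory_iff hμ h ht ω k₁).mp (hk₀ k₁ (by omega))
  have h4 := (𝒟.anyonFree_trajectory_iff hμ h ht ω (k₁ + 1)).mp (hk₀ (k₁ + 1) (by omega))
  rw [h3, one_mul] at h2
  exact hr (h2.symm.trans h4)

end SyncDecoder

end

section

variable {D L : ℕ} [NeZero L] {Δ : ℕ} {𝒞 : StabilizerCode D L Δ}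

namespace SyncDecoder

/-! ## Expected decoding times for fixed noise -/

section DecodingTime

variable {M : Type*} {v : ℕ} [NeZero v] (𝒟 : SyncDecoder 𝒞 M v)
  {μ : ℝ} (hμ : 0 < μ) {τ : Site D L → ℤˣ} {ρ : QMat D L} [Fintype M] [DecidableEq M]

theorem decodingTime_eq_find (h : 𝒞.InSector τ ρ) (ht : ρ.trace = 1) {T : ℕ}
    (hT : 𝒟.syn τ T = 1) (hmin : ∀ t < T, 𝒟.syn τ t ≠ 1) : 𝒟.decodingTime ρ = T := by
  refine le_antisymm (iInf₂_le T ((𝒟.anyonFree_output_iff h ht T).mpr hT)) ?_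
  refine le_iInf₂ fun t h' => ?_
  rw [𝒟.anyonFree_output_iff h ht] at h'
  exact_mod_cast not_lt.mp fun hlt => hmin t hlt h'

theorem decodingTime_eq_top_of_forall (h : 𝒞.InSector τ ρ) (ht : ρ.trace = 1)
    (hT : ∀ t, 𝒟.syn τ t ≠ 1) : 𝒟.decodingTime ρ = ∞ :=
  iInf₂_eq_top.mpr fun t h' => absurd ((𝒟.anyonFree_output_iff h ht t).mp h') (hT t)

/-- The possible values of the decoding time of a decoder that terminates. -/
theorem decodingTime_cases (h : 𝒞.InSector τ ρ) (ht : ρ.trace = 1) (hterm : 𝒟.Terminates ρ) :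
    (∃ T : ℕ, 𝒟.decodingTime ρ = T ∧ 𝒟.syn τ T = 1 ∧ (∀ t < T, 𝒟.syn τ t ≠ 1) ∧
      ∀ j r, T ≤ j → 𝒟.fb τ j r = 1) ∨
    (𝒟.decodingTime ρ = ∞ ∧ ∃ T, 𝒟.syn τ T ≠ 1 ∧ ∀ j r, T ≤ j → 𝒟.fb τ j r = 1) := by
  classical
  by_cases hex : ∃ t, 𝒟.syn τ t = 1
  · have hT := Nat.find_spec hex
    refine Or.inl ⟨Nat.find hex, ?_, hT, fun t => Nat.find_min hex, ?_⟩
    · exact 𝒟.decodingTime_eq_find h ht hT fun t => Nat.find_min hex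
    · exact 𝒟.fb_eq_one_of_terminatesIn h ht
        (hterm.2 _ ((𝒟.anyonFree_output_iff h ht _).mpr hT))
  · push Not at hex
    obtain ⟨T, hT⟩ := hterm.1
    exact Or.inr ⟨𝒟.decodingTime_eq_top_of_forall h ht hex, T, hex T,
      𝒟.fb_eq_one_of_terminatesIn h ht hT⟩

theorem exists_syndrome_fb_ne_one {T : ℕ} (h1 : 𝒟.syn τ (T + 1) = 1) (h0 : 𝒟.syn τ T ≠ 1) :
    ∃ r, 𝒞.syndrome (𝒟.fb τ T r) ≠ 1 := by
  by_contra hall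
  push Not at hall
  rw [syn_succ, Finset.prod_eq_one fun r _ => hall r, mul_one] at h1
  exact h0 h1

theorem ae_clock : ∀ᵐ ω ∂(𝒟.desynchronize μ hμ).clockLaw, (∀ k, 0 ≤ (ω k).1) ∧
    ∀ n, ∃ k, ¬ Lagging 𝒟.nbhd n (hist ω k) := by
  have h1 := ae_waiting_nonneg (Λ := Site D L) (𝒟.desynchronize μ hμ).rate_pos
  have h2 := ae_exists_not_lagging (𝒟.desynchronize μ hμ).rate_pos 𝒟.nbhd
    (d := (8 * Δ + 1) ^ D) (Nat.one_le_pow _ _ (by omega)) 𝒟.card_nbhd_le 𝒟.nbhd_symm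
  exact h1.and h2

theorem card_div_rate : (Fintype.card (Site D L) : ℝ) / (Fintype.card (Site D L) / μ) = μ := by
  have : (Fintype.card (Site D L) : ℝ) ≠ 0 := by exact_mod_cast Fintype.card_ne_zero
  rw [div_div_cancel₀ this]

/-- The constant in the upper bound on the decoding time. -/
def timeFactor (D Δ v : ℕ) (μ : ℝ) : ℝ :=
  μ * (4 * D + 4 * v * Real.log (2 * (8 * Δ + 1) ^ D) + 5)

theorem log_nonneg (D Δ : ℕ) : 0 ≤ Real.log (2 * (8 * Δ + 1) ^ D) := by
  refine Real.log_nonneg ?_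
  have : (1 : ℝ) ≤ (8 * Δ + 1) ^ D := one_le_pow₀ (by linarith [Nat.cast_nonneg (α := ℝ) Δ])
  linarith

theorem timeFactor_pos (D Δ v : ℕ) (hμ : 0 < μ) : 0 < timeFactor D Δ v μ := by
  have := log_nonneg D Δ
  unfold timeFactor
  positivity

theorem lintegral_decodingTime_le (h : 𝒞.InSector τ ρ) (ht : ρ.trace = 1)
    (hterm : 𝒟.Terminates ρ) :
    ∫⁻ ω, (𝒟.desynchronize μ hμ).decodingTime ρ ω ∂(𝒟.desynchronize μ hμ).clockLaw ≤
      ENNReal.ofReal (timeFactor D Δ v μ) *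
        (𝒟.decodingTime ρ + ENNReal.ofReal (Real.log L)) := by
  classical
  have hC := timeFactor_pos D Δ v hμ
  obtain ⟨T, hT, hsyn, -, hfb⟩ | ⟨hT, -⟩ := 𝒟.decodingTime_cases h ht hterm
  · rcases Nat.eq_zero_or_pos T with rfl | hpos
    · simp only [𝒟.decodingTime_eq_zero hμ h ht (fun j r => hfb j r (Nat.zero_le j)) hsyn,
        lintegral_zero]
      exact bot_le
    · have hlog : 0 ≤ Real.log L :=
        Real.log_nonneg (by exact_mod_cast Nat.one_le_iff_ne_zero.mpr (NeZero.ne L))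
      have h1 := lintegral_lagging_le (𝒟.desynchronize μ hμ).rate_pos 𝒟.nbhd (T * v)
        (d := (8 * Δ + 1) ^ D) (Nat.one_le_pow _ _ (by omega)) 𝒟.card_nbhd_le 𝒟.nbhd_symm
      calc _ ≤ ∫⁻ ω, ∑' k, (if Lagging 𝒟.nbhd (T * v) (hist ω k) then (1 : ℝ≥0∞) else 0) *
            ENNReal.ofReal (ω k).1 ∂(𝒟.desynchronize μ hμ).clockLaw := by
            refine lintegral_mono_ae ?_
            filter_upwards [𝒟.ae_clock hμ] with ω hω
            exact 𝒟.decodingTime_le hμ h ht hfb hsyn hω.1 hω.2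
        _ ≤ _ := h1
        _ ≤ ENNReal.ofReal (timeFactor D Δ v μ * (T + Real.log L)) := by
            refine ENNReal.ofReal_le_ofReal ?_
            rw [show (𝒟.desynchronize μ hμ).μ = μ from rfl, card_div_rate]
            have h2 : (Fintype.card (Site D L) : ℝ) = (L : ℝ) ^ D := by
              rw [Fintype.card_fun, ZMod.card, Fintype.card_fin]; push_cast; rfl
            have h3 := log_nonneg D Δ
            have hT1 : (1 : ℝ) ≤ T := by exact_mod_cast hpos
            rw [h2, Real.log_pow, timeFactor, mul_assoc]
            push_cast
            refine mul_le_mul_of_nonneg_left ?_ hμ.le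
            set l := Real.log (2 * (8 * Δ + 1) ^ D)
            have h4 : 0 ≤ (v : ℝ) * l * Real.log L := by positivity
            have h5 : 0 ≤ (D : ℝ) * T := by positivity
            nlinarith
        _ = _ := by
            rw [hT, ENNReal.ofReal_mul hC.le, ENNReal.ofReal_add (by positivity) hlog,
              ENNReal.ofReal_natCast]
  · rw [hT, top_add, ENNReal.mul_top (by simpa using hC)]
    exact le_top

theorem le_lintegral_decodingTime (h : 𝒞.InSector τ ρ) (ht : ρ.trace = 1)
    (hterm : 𝒟.Terminates ρ) :
    ENNReal.ofReal (μ * v / 2) * 𝒟.decodingTime ρ ≤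
      ∫⁻ ω, (𝒟.desynchronize μ hμ).decodingTime ρ ω ∂(𝒟.desynchronize μ hμ).clockLaw := by
  classical
  obtain ⟨T, hT, hsyn, hmin, hfb⟩ | ⟨hT, T, hsyn, hfb⟩ := 𝒟.decodingTime_cases h ht hterm
  · rcases T with _ | T
    · simp [hT]
    · obtain ⟨r, hr⟩ := 𝒟.exists_syndrome_fb_ne_one hsyn (hmin T (Nat.lt_succ_self T))
      have h1 := le_lintegral_heights_lt (𝒟.desynchronize μ hμ).rate_pos 𝒟.nbhd r
        (m := (T + 1) * v) (Nat.mul_pos (Nat.succ_pos T) (NeZero.pos v))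
      calc _ = ENNReal.ofReal (Fintype.card (Site D L) /
            ((Fintype.card (Site D L) : ℝ) / (𝒟.desynchronize μ hμ).μ) *
              (((T + 1) * v : ℕ) / 2)) := by
            rw [show (𝒟.desynchronize μ hμ).μ = μ from rfl, card_div_rate, hT,
              ← ENNReal.ofReal_natCast, ← ENNReal.ofReal_mul (by positivity)]
            congr 1
            push_cast
            ring
        _ ≤ _ := h1
        _ ≤ _ := by
            refine lintegral_mono_ae ?_
            filter_upwards [𝒟.ae_clock hμ] with ω hω
            exact 𝒟.le_decodingTime hμ h ht hr hω.1 hω.2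
  -- If the synchronous decoder never becomes anyon-free, almost every trajectory ends with its
  -- nontrivial final syndromes, so both times are infinite.
  · have h1 : ∀ᵐ ω ∂(𝒟.desynchronize μ hμ).clockLaw,
        (𝒟.desynchronize μ hμ).decodingTime ρ ω = ∞ := by
      filter_upwards [𝒟.ae_clock hμ] with ω hω
      exact 𝒟.decodingTime_eq_top hμ h ht hfb hsyn hω.2
    have h2 : (𝒟.desynchronize μ hμ).clockLaw Set.univ = 1 :=
      measure_univ (μ := proposalLaw (𝒟.desynchronize μ hμ).rate_pos)
    rw [lintegral_congr_ae h1, lintegral_const, h2, mul_one]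
    exact le_top

end DecodingTime

/-! ## Expected decoding times -/

section Expected

variable {M : Type*} {v : ℕ} [NeZero v] (𝒟 : SyncDecoder 𝒞 M v)
  {μ : ℝ} (hμ : 0 < μ) {ρ : QMat D L} [Fintype M] [DecidableEq M] {p : PMF (PauliLabel D L)}

theorem expectedDecodingTime_desynchronize_le (h : 𝒞.IsLogical ρ)
    (hterm : ∀ s ∈ p.support, 𝒟.Terminates (noisy s ρ)) :
    (𝒟.desynchronize μ hμ).expectedDecodingTime p ρ ≤ ENNReal.ofReal (timeFactor D Δ v μ) *
      (𝒟.expectedDecodingTime p ρ + ENNReal.ofReal (Real.log L)) := by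
  have hp : ∑ s, p s = 1 := by rw [← tsum_fintype (L := .unconditional _), p.tsum_coe]
  calc _ ≤ ∑ s, p s * (ENNReal.ofReal (timeFactor D Δ v μ) *
        (𝒟.decodingTime (noisy s ρ) + ENNReal.ofReal (Real.log L))) := by
        refine Finset.sum_le_sum fun s _ => ?_
        -- Termination is assumed only on the support of `p`; other terms vanish even if their
        -- decoding time is infinite.
        by_cases hs : p s = 0
        · simp [hs]
        · gcongr
          exact 𝒟.lintegral_decodingTime_le hμ (h.noisy_inSector s) (h.noisy_trace s)
            (hterm s ((p.mem_support_iff s).mpr hs))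
    _ = ENNReal.ofReal (timeFactor D Δ v μ) *
        (∑ s, p s * 𝒟.decodingTime (noisy s ρ) + (∑ s, p s) * ENNReal.ofReal (Real.log L)) := by
        rw [Finset.sum_mul, ← Finset.sum_add_distrib, Finset.mul_sum]
        refine Finset.sum_congr rfl fun s _ => ?_
        rw [mul_left_comm, mul_add (p s)]
    _ = _ := by rw [hp, one_mul]; rfl

theorem le_expectedDecodingTime_desynchronize (h : 𝒞.IsLogical ρ)
    (hterm : ∀ s ∈ p.support, 𝒟.Terminates (noisy s ρ)) :
    ENNReal.ofReal (μ * v / 2) * 𝒟.expectedDecodingTime p ρ ≤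
      (𝒟.desynchronize μ hμ).expectedDecodingTime p ρ := by
  rw [expectedDecodingTime, Finset.mul_sum]
  refine Finset.sum_le_sum fun s _ => ?_
  by_cases hs : p s = 0
  · simp [hs]
  · rw [mul_left_comm]
    gcongr
    exact 𝒟.le_lintegral_decodingTime hμ (h.noisy_inSector s) (h.noisy_trace s)
      (hterm s ((p.mem_support_iff s).mpr hs))

end Expected

/-! ## Logical failure rates -/

section Failure

variable {M : Type*} {v : ℕ} (𝒟 : SyncDecoder 𝒞 M v) [Fintype M] [DecidableEq M]

theorem sum_kraus_sum_smul {ι κ : Type*} [Fintype ι] [Fintype κ] (K : κ → State D L M) (w : ι → ℂ)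
    (X : ι → State D L M) :
    ∑ c, K c * (∑ i, w i • X i) * (K c)ᴴ = ∑ i, w i • ∑ c, K c * X i * (K c)ᴴ := by
  simp only [Finset.mul_sum, Finset.sum_mul, Finset.smul_sum, mul_smul_comm, smul_mul_assoc]
  exact Finset.sum_comm

theorem output_sum {ι : Type*} [Fintype ι] (w : ι → ℂ) (ρ : ι → QMat D L) (t : ℕ) :
    𝒟.output (∑ i, w i • ρ i) t = ∑ i, w i • 𝒟.output (ρ i) t := by
  have h1 : 𝒟.evolve (∑ i, w i • ρ i) t = ∑ i, w i • 𝒟.evolve (ρ i) t := by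
    induction t with
    | zero =>
      change 𝒟.initial _ = ∑ i, w i • 𝒟.initial (ρ i)
      ext a b
      simp only [initial, Finset.mul_sum, Finset.sum_mul, mul_smul_comm, smul_mul_assoc,
        Matrix.sum_apply, Matrix.smul_apply, Matrix.kroneckerMap_apply, Finset.smul_sum]
      exact Finset.sum_comm
    | succ t ih =>
      have h2 : ∀ ρ : QMat D L,
          𝒟.evolve ρ (t + 1) = 𝒟.channelF (𝒟.channelA (𝒟.evolve ρ t)) := fun ρ => by
        rw [evolve, Function.iterate_succ_apply']
        rfl
      simp only [h2, ih]
      simp only [channelA, channelF, sum_kraus_sum_smul]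
  rw [output, h1]
  ext a b
  simp only [output, trCl, block, Matrix.sum_apply, Matrix.smul_apply, Finset.smul_sum]
  exact Finset.sum_comm

variable [NeZero v] {μ : ℝ} (hμ : 0 < μ) {τ : Site D L → ℤˣ} {ρ : QMat D L}

open Classical in
theorem tendsto_sumSeq_lagging (n : ℕ) :
    Tendsto (fun k => sumSeq k (fun l => if Lagging 𝒟.nbhd n l then (1 : ℝ) else 0) [] /
      (Fintype.card (Site D L) : ℝ) ^ k) atTop (𝓝 0) := by
  set N : ℝ := ((Fintype.card (Site D L) : ℕ) : ℝ) with hN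
  have hN1 : 1 ≤ N := by rw [hN]; exact_mod_cast Fintype.card_pos (α := Site D L)
  have h1 : Tendsto (fun k : ℕ => N * (2 * ((8 * Δ + 1) ^ D : ℕ)) ^ n * ((N - 1 / 4) / N) ^ k)
      atTop (𝓝 0) := by
    rw [← mul_zero (N * (2 * (((8 * Δ + 1) ^ D : ℕ) : ℝ)) ^ n)]
    refine (tendsto_pow_atTop_nhds_zero_of_lt_one ?_ ?_).const_mul _
    · exact div_nonneg (by linarith) (by linarith)
    · rw [div_lt_one (by linarith)]
      linarith
  refine squeeze_zero (fun k => ?_) (fun k => ?_) h1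
  · refine div_nonneg ?_ (by positivity)
    have := sumSeq_le (k := k) (g := fun _ => 0)
      (g' := fun l => if Lagging 𝒟.nbhd n l then (1 : ℝ) else 0)
      (fun l => by split_ifs <;> norm_num) []
    rwa [sumSeq_const, smul_zero] at this
  · rw [div_pow, ← mul_div_assoc]
    refine div_le_div_of_nonneg_right ?_ (by positivity)
    exact sumSeq_lagging_le 𝒟.nbhd (Nat.one_le_pow _ _ (by omega)) 𝒟.card_nbhd_le 𝒟.nbhd_symm n k

/-- The common limit is the synchronous output at the time feedback stops: one side is eventually
constant, the other reaches it in all histories in which no site lags behind `T v`. -/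
theorem tendsto_outputs (h : 𝒞.InSector τ ρ) (ht : ρ.trace = 1) (hterm : 𝒟.Terminates ρ) :
    ∃ ρ', Tendsto (𝒟.output ρ) atTop (𝓝 ρ') ∧
      Tendsto ((𝒟.desynchronize μ hμ).output ρ) atTop (𝓝 ρ') := by
  obtain ⟨T, hT⟩ := hterm.1
  have hfb := 𝒟.fb_eq_one_of_terminatesIn h ht hT
  refine ⟨𝒟.syncOp τ T * ρ * (𝒟.syncOp τ T)ᴴ, ?_, ?_⟩
  · refine tendsto_const_nhds.congr' ?_
    filter_upwards [eventually_ge_atTop T] with t htT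
    rw [𝒟.output_eq h, 𝒟.syncOp_eq_of_le hfb htT]
  · refine (𝒟.desynchronize μ hμ).tendsto_output h (P := Lagging 𝒟.nbhd (T * v)) (fun l hl => ?_)
      (𝒟.tendsto_sumSeq_lagging _)
    rw [𝒟.trCl_desynchronize_histState hμ h, 𝒟.totalFb_eq_of_not_lagging hfb hl]

theorem tendsto_failures {p : PMF (PauliLabel D L)} (h : 𝒞.IsLogical ρ)
    (hterm : ∀ s ∈ p.support, 𝒟.Terminates (noisy s ρ)) :
    ∃ ℓ, Tendsto (failure 𝒟.output p ρ) atTop (𝓝 ℓ) ∧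
      Tendsto (failure (𝒟.desynchronize μ hμ).output p ρ) atTop (𝓝 ℓ) := by
  have h1 : ∀ s, ∃ ρ', Tendsto (fun t => ((p s).toReal : ℂ) • 𝒟.output (noisy s ρ) t) atTop
        (𝓝 (((p s).toReal : ℂ) • ρ')) ∧
      Tendsto (fun t => ((p s).toReal : ℂ) • (𝒟.desynchronize μ hμ).output (noisy s ρ) t) atTop
        (𝓝 (((p s).toReal : ℂ) • ρ')) := by
    intro s
    by_cases hs : p s = 0
    · exact ⟨0, by simp [hs], by simp [hs]⟩
    · obtain ⟨ρ', h2, h3⟩ := 𝒟.tendsto_outputs hμ (h.noisy_inSector s) (h.noisy_trace s)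
        (hterm s ((p.mem_support_iff s).mpr hs))
      exact ⟨ρ', h2.const_smul _, h3.const_smul _⟩
  choose ρ' h2 h3 using h1
  refine ⟨traceNorm (∑ s, ((p s).toReal : ℂ) • ρ' s - ρ) / 2, ?_, ?_⟩
  · refine Tendsto.div_const ((continuous_traceNorm.tendsto _).comp (Tendsto.sub_const ?_ _)) _
    exact (tendsto_finsetSum _ fun s _ => h2 s).congr fun t => (𝒟.output_sum _ _ t).symm
  · refine Tendsto.div_const ((continuous_traceNorm.tendsto _).comp (Tendsto.sub_const ?_ _)) _
    exact (tendsto_finsetSum _ fun s _ => h3 s).congr fun t =>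
      ((𝒟.desynchronize μ hμ).output_sum _ _ _ h.noisy_inSector t).symm

end Failure

end SyncDecoder

end

end AutomatonDecoder

end

/-! ### Assembly of the main theorem -/

theorem mainTheorem4 (D Δ v : ℕ) [NeZero v] (μ : ℝ) (hμ : 0 < μ) :
    ∃ C : ℝ, 0 < C ∧ ∃ c K : ℝ → ℝ, (∀ f, 0 < f → 0 < c f ∧ 0 < K f) ∧
      ∀ (L : ℕ) [NeZero L] (𝒞 : AutomatonDecoder.StabilizerCode D L Δ)
        (M : Type*) [Fintype M] [DecidableEq M] (𝒟 : AutomatonDecoder.SyncDecoder 𝒞 M v)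
        (p : PMF (AutomatonDecoder.PauliLabel D L)),
        (∀ ρ, 𝒞.IsLogical ρ → ∀ s ∈ p.support, 𝒟.Terminates (AutomatonDecoder.noisy s ρ)) →
        (∀ ρ, 𝒞.IsLogical ρ →
          (∃ ℓ, Tendsto (AutomatonDecoder.failure 𝒟.output p ρ) atTop (𝓝 ℓ)) ∧
          (∃ ℓ, Tendsto (AutomatonDecoder.failure (𝒟.desynchronize μ hμ).output p ρ)
            atTop (𝓝 ℓ))) ∧
        AutomatonDecoder.failureRate 𝒞 (𝒟.desynchronize μ hμ).output p =
          AutomatonDecoder.failureRate 𝒞 𝒟.output p ∧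
        (∀ ρ, 𝒞.IsLogical ρ →
          (𝒟.desynchronize μ hμ).expectedDecodingTime p ρ ≤
            ENNReal.ofReal C *
              (𝒟.expectedDecodingTime p ρ + ENNReal.ofReal (Real.log L))) ∧
        (∀ f : ℝ, 0 < f → ∀ ρ, 𝒞.IsLogical ρ →
          ENNReal.ofReal (f * Real.log L) ≤ 𝒟.expectedDecodingTime p ρ →
          ENNReal.ofReal (c f) * 𝒟.expectedDecodingTime p ρ ≤
              (𝒟.desynchronize μ hμ).expectedDecodingTime p ρ ∧
            (𝒟.desynchronize μ hμ).expectedDecodingTime p ρ ≤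
              ENNReal.ofReal (K f) * 𝒟.expectedDecodingTime p ρ) := by
  have hC := AutomatonDecoder.SyncDecoder.timeFactor_pos D Δ v hμ
  have hv : (0 : ℝ) < v := by exact_mod_cast NeZero.pos v
  -- The lower constant does not depend on `f`, since the lower bound has no logarithm. The factor
  -- `1 + 1/f` in the upper one comes from `log L ≤ T_dec / f`.
  refine ⟨AutomatonDecoder.SyncDecoder.timeFactor D Δ v μ, hC, fun _ => μ * v / 2,
    fun f => AutomatonDecoder.SyncDecoder.timeFactor D Δ v μ * (1 + 1 / f), fun f hf => ⟨by positivity, by positivity⟩,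
    ?_⟩
  intro L _ 𝒞 M _ _ 𝒟 p hterm
  have hlim := fun ρ (hρ : 𝒞.IsLogical ρ) => 𝒟.tendsto_failures hμ hρ (hterm ρ hρ)
  refine ⟨fun ρ hρ => ?_, ?_, fun ρ hρ => ?_, fun f hf ρ hρ hT => ⟨?_, ?_⟩⟩
  · obtain ⟨ℓ, h1, h2⟩ := hlim ρ hρ
    exact ⟨⟨ℓ, h1⟩, ℓ, h2⟩
  · refine iSup_congr fun ρ => iSup_congr fun hρ => ?_
    obtain ⟨ℓ, h1, h2⟩ := hlim ρ hρ
    -- The limits exist, so the upper limits in `failureRate` are these limits, and they agree for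
    -- each logical state before the supremum is taken.
    rw [(ENNReal.tendsto_ofReal h1).limsup_eq, (ENNReal.tendsto_ofReal h2).limsup_eq]
  · exact 𝒟.expectedDecodingTime_desynchronize_le hμ hρ (hterm ρ hρ)
  · exact 𝒟.le_expectedDecodingTime_desynchronize hμ hρ (hterm ρ hρ)
  · refine (𝒟.expectedDecodingTime_desynchronize_le hμ hρ (hterm ρ hρ)).trans ?_
    rw [ENNReal.ofReal_mul hC.le, mul_assoc]
    gcongr
    have h1 : ENNReal.ofReal (Real.log L) =
        ENNReal.ofReal (1 / f) * ENNReal.ofReal (f * Real.log L) := by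
      rw [← ENNReal.ofReal_mul (by positivity)]
      congr 1
      field_simp
    rw [h1, ENNReal.ofReal_add zero_le_one (by positivity), ENNReal.ofReal_one, add_mul, one_mul]
    gcongr
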